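/- **Setting.** Let $0\to\mathbb Z^d\xrightarrow{P}\mathbb Z^n\xrightarrow{Q^T}\mathbb Z^k\to 0$ be an exact sequence given by integer matrices $P\in\mathbb Z^{n\times d}$, $Q\in\mathbb Z^{n\times k}$. It encodes an abelian gauge theory with gauge group $G=U(1)^k\hookrightarrow U(1)^n$ acting on the Weyl algebra $\mathscr W=\mathbb C\langle x_j,\partial_j\rangle_{1\le j\le n}$, $[\partial_i,x_j]=\delta_{ij}$; here $t\in G$ multiplies $x_j$ by $\prod_a t_a^{Q_{ja}}$ and $\partial_j$ by the inverse. Write $h_j^\vee\in\mathbb Z^k$ and $h_j\in\mathbb Z^d$ for the rows of $Q$ and $P$. A *basis* is a set $I\subset\{1,\dots,n\}$ such that $(h_i)_{i\in I}$ is a basis of $\mathbb R^d$; assume that then it is always a basis of $\mathbb Z^d$ (unimodularity). Put $J=\{1,\dots,n\}\setminus I$. Fix real mass and FI parameters $m,\zeta\in\mathbb R^n$. For $\beta\in\mathbb C^n$ put $\hat\mu_\zeta(\beta)=\sum_j\beta_j(h_j+i\zeta_j)\in\mathscr W$, where also $h_j=x_j\partial_j+\frac12$. Let $A=(\mathscr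 W/\sum_a\mathscr W\hat\mu_\zeta(Q_{\cdot a}))^G$ be the hypertoric enveloping algebra. For $b\in\mathbb R^n$ with all $b_j\ne0$, let $\mathbb V_b$ be the quotient of $\mathscr W$ by the left ideal generated by the $x_j$ with $b_j>0$ and the $\partial_j$ with $b_j<0$, and let $\mathrm{Tr}_b(w)=\mathrm{Tr}(\mathbb V_b;(-1)^Fe^{2\pi\hat\mu_\zeta(b)}w)$, where $(-1)^F$ fixes the vacuum and anticommutes with all $x_j,\partial_j$. The sphere trace is $$\mathrm{Tr}^G_m(w)=\int_{\mathbb R^k}\mathrm{Tr}_{m+Qt}(w)\,dt .$$ For a basis $I$ write $h_s=\sum_{i\in I}(R_I)_{si}h_i$ (so $R_I$ is an integer matrix), $\sum_s m_sh_s=\sum_{i\in I}z_ih_i$, $\sigma_I(i)=\operatorname{sign}z_i$, and $\mathsf r_i(I)=-\sigma_I(i)\sum_s(R_I)_{si}$. Exchanging $(P,m,I)$ with $(Q,\zeta,J)$ gives the dual quantities $R^!_J,z^!_j,\sigma^!_J(j),\mathsf r^!_j(J)$. Assume that the parameters are generic: $z_i\neq0$ and $z^!_j\ne0$ for every basis $I$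 and all $i\in I$, $j\in J$. A Verma module $\Delta_I$ is an $A$-module with a basis $v_c$, $c\in\mathbb Z_{\ge0}^I$, such that $h_iv_c=-\sigma_I(i)(c_i+\frac12)v_c$ for $i\in I$, generated by $v_0$. Let $(-1)^Fv_c=(-1)^{\sum_{i\in I}\mathsf r_i(I)c_i}v_c$ and $\mathrm{Tr}_{\Delta_I}(a)=\mathrm{Tr}(\Delta_I;(-1)^Fe^{2\pi\hat\mu_\zeta(m)}a)$. Let $\mathrm{CS}_r$ be $\operatorname{sech}$ for odd $r$ and $\operatorname{csch}$ for even $r$. Let $\varpi(r)=i,1,-i,-1$ for $r\equiv0,1,2,3\pmod 4$, so that $\operatorname{sech}(x+\frac{\pi i(r-1)}2)=\varpi(r)\,\mathrm{CS}_r(x)$. For $i\in I$ let $\tilde{\mathsf r}_i(J)=1+\sum_{j\in J}(R^!_J)_{ij}\sigma^!_J(j)$. **Statement.** For every basis $I$, the rows $(h_j^\vee)_{j\in J}$ are a basis of $\mathbb Z^k$, and the Verma module $\Delta_I$ and the Verma module $\Delta^!_J$ of the dual theory (obtained by exchanging $Q$ with $P$ and $m$ with $\zeta$) exist. For $w\in\mathscr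 W^G$ the trace $\mathrm{Tr}_{m+Qt}(w)$ converges absolutely for almost all $t$ and is integrable in $t$; the traces $\mathrm{Tr}_{\Delta_I}$ converge absolutely on $A$. With $[w]$ the class of $w$ in $A$, $$\mathrm{Tr}^G_m(w)=\sum_I C_I\,\mathrm{Tr}_{\Delta_I}([w]),\qquad C_I=\prod_{i\in I}\varpi(\tilde{\mathsf r}_i(J))\,\sigma_I(i)^{\mathsf r_i(I)+1}\ \prod_{j\in J}\tfrac12\,\sigma^!_J(j)^{\mathsf r^!_j(J)+1}\,\mathrm{CS}_{\mathsf r^!_j(J)}(\pi z^!_j),$$ the sum being over all bases $I$. Moreover, $\mathrm{Tr}_{\Delta^!_J}(1)$ converges absolutely, and up to a fourth root of unity $C_I$ is the trace of $1$ on the dual Verma module: there is $u$ with $u^4=1$ and $$C_I\,e^{2\pi i\sum_{j\in J}z^!_jm_j}=u\,\mathrm{Tr}_{\Delta^!_J}(1).$$ (The exponential is the scalar by which the dual FI parameter $m$ enters $e^{2\pi\hat\mu}$; it is $1$ if $m$ is chosen in its class modulo $Q\mathbb R^k$ to be supported on $I$.) -/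

import Mathlib

noncomputable section

namespace SphereTrace

open scoped Matrix

/-! ## The Weyl algebra -/

/-- The defining relations of the Weyl algebra on generators `x_j` (`Sum.inl j`) and
`∂_j` (`Sum.inr j`). -/
inductive WeylRel (n : ℕ) :
    FreeAlgebra ℂ (Fin n ⊕ Fin n) → FreeAlgebra ℂ (Fin n ⊕ Fin n) → Prop
  | xx (i j : Fin n) : WeylRel n
      (FreeAlgebra.ι ℂ (Sum.inl i) * FreeAlgebra.ι ℂ (Sum.inl j))
      (FreeAlgebra.ι ℂ (Sum.inl j) * FreeAlgebra.ι ℂ (Sum.inl i))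
  | dd (i j : Fin n) : WeylRel n
      (FreeAlgebra.ι ℂ (Sum.inr i) * FreeAlgebra.ι ℂ (Sum.inr j))
      (FreeAlgebra.ι ℂ (Sum.inr j) * FreeAlgebra.ι ℂ (Sum.inr i))
  | dx (i j : Fin n) : WeylRel n
      (FreeAlgebra.ι ℂ (Sum.inr i) * FreeAlgebra.ι ℂ (Sum.inl j))
      (FreeAlgebra.ι ℂ (Sum.inl j) * FreeAlgebra.ι ℂ (Sum.inr i) + if i = j then 1 else 0)

/-- The Weyl algebra of `n` hypermultiplets. -/
abbrev Weyl (n : ℕ) : Type := RingQuot (WeylRel n)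

variable {n k d : ℕ}

/-- The generator `x_j`. -/
def Weyl.x (j : Fin n) : Weyl n :=
  RingQuot.mkAlgHom ℂ (WeylRel n) (FreeAlgebra.ι ℂ (Sum.inl j))

/-- The generator `∂_j`. -/
def Weyl.del (j : Fin n) : Weyl n :=
  RingQuot.mkAlgHom ℂ (WeylRel n) (FreeAlgebra.ι ℂ (Sum.inr j))

theorem Weyl.x_mul_x (i j : Fin n) : Weyl.x i * Weyl.x j = Weyl.x j * Weyl.x i := by
  simpa [Weyl.x] using RingQuot.mkAlgHom_rel ℂ (WeylRel.xx i j)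

theorem Weyl.del_mul_del (i j : Fin n) : Weyl.del i * Weyl.del j = Weyl.del j * Weyl.del i := by
  simpa [Weyl.del] using RingQuot.mkAlgHom_rel ℂ (WeylRel.dd i j)

theorem Weyl.del_mul_x (i j : Fin n) :
    Weyl.del i * Weyl.x j = Weyl.x j * Weyl.del i + if i = j then 1 else 0 := by
  have h := RingQuot.mkAlgHom_rel ℂ (WeylRel.dx i j)
  by_cases hij : i = j
  · simpa [Weyl.del, Weyl.x, hij] using h
  · simpa [Weyl.del, Weyl.x, hij] using h

/-- The universal property of the Weyl algebra. -/
def Weyl.lift {A : Type} [Ring A] [Algebra ℂ A] (X D : Fin n → A)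
    (hxx : ∀ i j, X i * X j = X j * X i) (hdd : ∀ i j, D i * D j = D j * D i)
    (hdx : ∀ i j, D i * X j = X j * D i + if i = j then 1 else 0) : Weyl n →ₐ[ℂ] A :=
  RingQuot.liftAlgHom ℂ ⟨FreeAlgebra.lift ℂ (Sum.elim X D), by
    intro a b hab
    cases hab with
    | xx i j => simpa using hxx i j
    | dd i j => simpa using hdd i j
    | dx i j =>
      by_cases hij : i = j
      · subst hij; simpa using hdx i i
      · simpa [hij] using hdx i j⟩

section lift

variable {A : Type} [Ring A] [Algebra ℂ A] {X D : Fin n → A}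
  {hxx : ∀ i j, X i * X j = X j * X i} {hdd : ∀ i j, D i * D j = D j * D i}
  {hdx : ∀ i j, D i * X j = X j * D i + if i = j then 1 else 0}

theorem Weyl.lift_x (j : Fin n) : Weyl.lift X D hxx hdd hdx (Weyl.x j) = X j := by
  simp [Weyl.lift, Weyl.x]

theorem Weyl.lift_del (j : Fin n) : Weyl.lift X D hxx hdd hdx (Weyl.del j) = D j := by
  simp [Weyl.lift, Weyl.del]

end lift

/-- `h_j = x_j ∂_j + 1/2`, the quantum moment map of the `j`-th coordinate of the diagonal torus. -/
def Weyl.h (j : Fin n) : Weyl n := Weyl.x j * Weyl.del j + algebraMap ℂ (Weyl n) (1 / 2)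

/-- The shifted quantum moment map `μ̂_ζ(β) = Σ_j β_j (h_j + i ζ_j)` for `β = Σ_j β_j ḣ_j` in the
complexified Lie algebra of the diagonal torus.  The FI parameter is the character
`β ↦ i Σ_j ζ_j β_j`, which is real on the Lie algebra of the compact torus, where the `β_j` are
imaginary. -/
def muHat (ζ : Fin n → ℝ) (β : Fin n → ℂ) : Weyl n :=
  ∑ j, β j • (Weyl.h j + algebraMap ℂ (Weyl n) (Complex.I * (ζ j : ℂ)))

/-! ## Hamiltonian reduction by `G = U(1)^k` with charge matrix `Q` -/

/-- The value at `t ∈ U(1)^k` of the character through which `G` acts on `x_j`. -/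
def charge (Q : Matrix (Fin n) (Fin k) ℤ) (t : Fin k → Circle) (j : Fin n) : Circle :=
  ∏ a, t a ^ Q j a

/-- The action of `t ∈ U(1)^k` on the Weyl algebra: `x_j ↦ χ_j(t) x_j`, `∂_j ↦ χ_j(t)⁻¹ ∂_j`. -/
def gaugeAct (Q : Matrix (Fin n) (Fin k) ℤ) (t : Fin k → Circle) : Weyl n →ₐ[ℂ] Weyl n :=
  Weyl.lift (fun j => ((charge Q t j : Circle) : ℂ) • Weyl.x j)
    (fun j => (((charge Q t j)⁻¹ : Circle) : ℂ) • Weyl.del j)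
    (fun i j => by
      simp only [smul_mul_assoc, mul_smul_comm, smul_smul, Weyl.x_mul_x i j, mul_comm])
    (fun i j => by
      simp only [smul_mul_assoc, mul_smul_comm, smul_smul, Weyl.del_mul_del i j, mul_comm])
    (fun i j => by
      simp only [smul_mul_assoc, mul_smul_comm, smul_smul, Weyl.del_mul_x i j, smul_add]
      by_cases hij : i = j
      · subst hij
        simp
      · simp [hij, mul_comm])

/-- The algebra of `G`-invariants of the Weyl algebra. -/
def invariants (Q : Matrix (Fin n) (Fin k) ℤ) : Subalgebra ℂ (Weyl n) :=
  ⨅ t : Fin k → Circle, AlgHom.equalizer (gaugeAct Q t) (AlgHom.id ℂ (Weyl n))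

theorem mem_invariants (Q : Matrix (Fin n) (Fin k) ℤ) (w : Weyl n) :
    w ∈ invariants Q ↔ ∀ t, gaugeAct Q t w = w := by
  simp [invariants, Algebra.mem_iInf]

theorem h_mem_invariants (Q : Matrix (Fin n) (Fin k) ℤ) (j : Fin n) :
    Weyl.h j ∈ invariants Q := by
  rw [mem_invariants]
  intro t
  simp [Weyl.h, gaugeAct, Weyl.lift_x, Weyl.lift_del, smul_smul]

theorem muHat_mem_invariants (Q : Matrix (Fin n) (Fin k) ℤ) (ζ : Fin n → ℝ) (β : Fin n → ℂ) :
    muHat ζ β ∈ invariants Q :=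
  Subalgebra.sum_mem _ fun j _ => Subalgebra.smul_mem _
    (Subalgebra.add_mem _ (h_mem_invariants Q j) (Subalgebra.algebraMap_mem _ _)) _

/-- The left ideal of the Weyl algebra generated by `μ̂_ζ(X)` for `X` in the Lie algebra of `G`;
the columns of `Q` are a basis of this Lie algebra. -/
def momentIdeal (Q : Matrix (Fin n) (Fin k) ℤ) (ζ : Fin n → ℝ) : Ideal (Weyl n) :=
  Ideal.span (Set.range fun a : Fin k => muHat ζ (fun j => (Q j a : ℂ)))

/-- The quantum Higgs branch (hypertoric enveloping algebra) `(𝒲 / 𝒲 μ̂_ζ(𝔤))^G`.  As `G` is a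
torus, every invariant class has an invariant representative, so this is the algebra of invariants
with `a` and `b` identified when `a - b` lies in the left ideal `𝒲 μ̂_ζ(𝔤)`. -/
abbrev AHiggs (Q : Matrix (Fin n) (Fin k) ℤ) (ζ : Fin n → ℝ) : Type :=
  RingQuot (fun a b : invariants Q => (a : Weyl n) - (b : Weyl n) ∈ momentIdeal Q ζ)

/-- The quotient map from the invariants to the quantum Higgs branch. -/
def toHiggs (Q : Matrix (Fin n) (Fin k) ℤ) (ζ : Fin n → ℝ) :
    invariants Q →ₐ[ℂ] AHiggs Q ζ :=
  RingQuot.mkAlgHom ℂ _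

/-- The class of `h_j` in the quantum Higgs branch. -/
def higgsH (Q : Matrix (Fin n) (Fin k) ℤ) (ζ : Fin n → ℝ) (j : Fin n) : AHiggs Q ζ :=
  toHiggs Q ζ ⟨Weyl.h j, h_mem_invariants Q j⟩

/-- The class of `μ̂_ζ(m)` in the quantum Higgs branch, for the mass parameter `m = Σ_j m_j ḣ_j`. -/
def higgsMu (Q : Matrix (Fin n) (Fin k) ℤ) (m ζ : Fin n → ℝ) : AHiggs Q ζ :=
  toHiggs Q ζ ⟨muHat ζ (fun j => (m j : ℂ)), muHat_mem_invariants Q ζ _⟩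

/-! ## The twisted trace on the Weyl algebra and the sphere trace -/

/-- The operator of multiplication by the `j`-th variable. -/
def mulOp (j : Fin n) : Module.End ℂ (MvPolynomial (Fin n) ℂ) :=
  LinearMap.mulLeft ℂ (MvPolynomial.X j)

/-- The operator of differentiation in the `j`-th variable. -/
def derOp (j : Fin n) : Module.End ℂ (MvPolynomial (Fin n) ℂ) :=
  ((MvPolynomial.pderiv j : Derivation ℂ (MvPolynomial (Fin n) ℂ) (MvPolynomial (Fin n) ℂ)) :
    MvPolynomial (Fin n) ℂ →ₗ[ℂ] MvPolynomial (Fin n) ℂ)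

theorem mulOp_comm (i j : Fin n) : mulOp i * mulOp j = mulOp j * mulOp i := by
  refine LinearMap.ext fun p => ?_
  simp only [mulOp, Module.End.mul_apply, LinearMap.mulLeft_apply]
  ring

theorem derOp_mulOp (i j : Fin n) :
    derOp i * mulOp j = mulOp j * derOp i + if i = j then 1 else 0 := by
  refine LinearMap.ext fun p => ?_
  by_cases hij : i = j
  · subst hij
    simp [mulOp, derOp, Module.End.mul_apply]
  · have hji : j ≠ i := fun h => hij h.symm
    simp [mulOp, derOp, Module.End.mul_apply, hij, MvPolynomial.pderiv_X_of_ne hji]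

theorem derOp_comm (i j : Fin n) : derOp i * derOp j = derOp j * derOp i := by
  refine LinearMap.ext fun p => ?_
  have h : ⁅(MvPolynomial.pderiv i : Derivation ℂ (MvPolynomial (Fin n) ℂ)
      (MvPolynomial (Fin n) ℂ)), (MvPolynomial.pderiv j : Derivation ℂ (MvPolynomial (Fin n) ℂ)
      (MvPolynomial (Fin n) ℂ))⁆ = 0 := by
    refine MvPolynomial.derivation_ext fun l => ?_
    by_cases h1 : l = i <;> by_cases h2 : l = j <;>
      simp_all [Derivation.commutator_apply, MvPolynomial.pderiv_X]
  have h' := congrArg (fun D : Derivation ℂ (MvPolynomial (Fin n) ℂ) (MvPolynomial (Fin n) ℂ) => D p) h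
  simp only [Derivation.commutator_apply, Derivation.coe_zero, Pi.zero_apply] at h'
  simpa [derOp, Module.End.mul_apply] using sub_eq_zero.mp h'

section flip

variable {A : Type} [Ring A] (s : Fin n → Prop) [DecidablePred s] (X D : Fin n → A)

/-- Replace `X_j` by `-D_j` whenever `s j` holds. -/
def flipX (j : Fin n) : A := if s j then -D j else X j

/-- Replace `D_j` by `X_j` whenever `s j` holds. -/
def flipD (j : Fin n) : A := if s j then X j else D j

theorem flip_rel (hxx : ∀ i j, X i * X j = X j * X i) (hdd : ∀ i j, D i * D j = D j * D i)
    (hdx : ∀ i j, D i * X j = X j * D i + if i = j then 1 else 0) (i j : Fin n) :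
    flipX s X D i * flipX s X D j = flipX s X D j * flipX s X D i ∧
    flipD s X D i * flipD s X D j = flipD s X D j * flipD s X D i ∧
    flipD s X D i * flipX s X D j =
      flipX s X D j * flipD s X D i + if i = j then 1 else 0 := by
  have h1 := hdx i j
  have h2 := hdx j i
  have hc := hdd i j
  have hm := hxx i j
  unfold flipX flipD
  by_cases hij : i = j
  · subst hij
    simp only [if_true] at h1 ⊢
    by_cases hs : s i <;> simp [hs, h1]
  · have hji : j ≠ i := fun h => hij h.symm
    simp only [hij, hji, if_false, add_zero] at h1 h2 ⊢
    by_cases hs : s i <;> by_cases hs' : s j <;> simp [hs, hs', h1, h2, hc, hm]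

end flip

/-- The vacuum module `𝒲 / 𝒲 V⁺`, realized on polynomials with vacuum vector `1`.  For
`β = Σ_j b_j ḣ_j` the positive eigenspace `V⁺` is spanned by the `x_j` with `b_j > 0` and the `∂_j`
with `b_j < 0`.  If `b_j > 0`, then `x_j` acts by minus the `j`-th derivative and `∂_j` by
multiplication by the `j`-th variable; otherwise `x_j` acts by multiplication and `∂_j` by the
derivative. -/
def fock (b : Fin n → ℝ) : Weyl n →ₐ[ℂ] Module.End ℂ (MvPolynomial (Fin n) ℂ) :=
  Weyl.lift (flipX (fun j => 0 < b j) mulOp derOp) (flipD (fun j => 0 < b j) mulOp derOp)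
    (fun i j => (flip_rel _ _ _ mulOp_comm derOp_comm derOp_mulOp i j).1)
    (fun i j => (flip_rel _ _ _ mulOp_comm derOp_comm derOp_mulOp i j).2.1)
    (fun i j => (flip_rel _ _ _ mulOp_comm derOp_comm derOp_mulOp i j).2.2)

/-- The diagonal matrix coefficient of `w` at the basis monomial `u` of the vacuum module. -/
def fockDiag (b : Fin n → ℝ) (w : Weyl n) (u : Fin n →₀ ℕ) : ℂ :=
  MvPolynomial.coeff u (fock b w (MvPolynomial.monomial u 1))

/-- The diagonal matrix coefficient at the monomial `u` of `(-1)^F exp(2π μ̂_ζ(β)) w` on the vacuum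
module of `β = Σ_j b_j ḣ_j`.  The operator `μ̂_ζ(β)` is diagonal in the monomial basis and `(-1)^F`
acts on the monomial `u` by `(-1)^{|u|}`. -/
def weylTraceTerm (ζ b : Fin n → ℝ) (w : Weyl n) (u : Fin n →₀ ℕ) : ℂ :=
  (-1) ^ (∑ j, u j) *
    Complex.exp (2 * Real.pi * fockDiag b (muHat ζ (fun j => (b j : ℂ))) u) * fockDiag b w u

/-- The twisted trace `Tr_β(w)` on the Weyl algebra: the trace of `(-1)^F exp(2π μ̂_ζ(β)) w` on the
vacuum module of `β = Σ_j b_j ḣ_j` (with all `b_j` nonzero). -/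
def weylTrace (ζ b : Fin n → ℝ) (w : Weyl n) : ℂ :=
  ∑' u : Fin n →₀ ℕ, weylTraceTerm ζ b w u

/-- The point `m + Q t` of the affine space `i𝔤 + m`, in the coordinates `h_j^∨`. -/
def contourPoint (Q : Matrix (Fin n) (Fin k) ℤ) (m : Fin n → ℝ) (t : Fin k → ℝ) : Fin n → ℝ :=
  fun j => m j + ∑ a, (Q j a : ℝ) * t a

/-- The sphere trace: the integral of `Tr_β(w)` over `β ∈ i𝔤 + m`. -/
def sphereTrace (Q : Matrix (Fin n) (Fin k) ℤ) (m ζ : Fin n → ℝ) (w : Weyl n) : ℂ :=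
  ∫ t : Fin k → ℝ, weylTrace ζ (contourPoint Q m t) w

/-! ## Linear algebra of the charges

The rows of `P : ℤ^d → ℤ^n` are the vectors `h_1, …, h_n` in the cocharacter lattice `ℤ^d ⊆ 𝔣`, and
the rows of `Q` are the vectors `h_1^∨, …, h_n^∨` in `ℤ^k ⊆ 𝔤^*`. -/

/-- `0 → ℤ^d → ℤ^n → ℤ^k → 0`, with maps `p^* = P` and `i^* = Qᵀ`, is exact. -/
def IsExactSequence (Q : Matrix (Fin n) (Fin k) ℤ) (P : Matrix (Fin n) (Fin d) ℤ) : Prop :=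
  Function.Injective (fun v : Fin d → ℤ => P *ᵥ v) ∧
    (∀ u : Fin n → ℤ, Qᵀ *ᵥ u = 0 ↔ ∃ v : Fin d → ℤ, P *ᵥ v = u) ∧
    Function.Surjective (fun u : Fin n → ℤ => Qᵀ *ᵥ u)

/-- The rows of `P` indexed by `I` are a basis of the lattice `ℤ^d`; equivalently, `I` has `d`
elements and the corresponding minor of `P` has determinant `±1`. -/
def IsLatticeBasis (P : Matrix (Fin n) (Fin d) ℤ) (I : Finset (Fin n)) : Prop :=
  LinearIndependent ℤ (fun i : I => P i) ∧
    ⊤ ≤ Submodule.span ℤ (Set.range fun i : I => P i)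

/-- Rows of `P` that are a basis of the vector space `ℝ^d` are a basis of the lattice `ℤ^d`. -/
def IsUnimodular (P : Matrix (Fin n) (Fin d) ℤ) : Prop :=
  ∀ I : Finset (Fin n),
    LinearIndependent ℝ (fun (i : I) (a : Fin d) => (P i a : ℝ)) →
    Submodule.span ℝ (Set.range fun (i : I) (a : Fin d) => (P i a : ℝ)) = ⊤ →
    IsLatticeBasis P I

/-- The type of bases `I`. -/
abbrev Bases (P : Matrix (Fin n) (Fin d) ℤ) : Type := {I : Finset (Fin n) // IsLatticeBasis P I}

instance (P : Matrix (Fin n) (Fin d) ℤ) : Fintype (Bases P) := Fintype.ofFinite _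

open Classical in
/-- The matrix `R_I` of coefficients of `h_s = Σ_{i ∈ I} (R_I)_{s i} h_i` (zero if `I` is not a
basis). -/
def expansion (P : Matrix (Fin n) (Fin d) ℤ) (I : Finset (Fin n)) : Matrix (Fin n) I ℤ :=
  fun s i => if h : IsLatticeBasis P I then (Module.Basis.mk h.1 h.2).repr (P s) i else 0

/-- The coefficients `z_i` of `Σ_s m_s h_s = Σ_{i ∈ I} z_i h_i`. -/
def coordZ (P : Matrix (Fin n) (Fin d) ℤ) (I : Finset (Fin n)) (m : Fin n → ℝ) (i : I) : ℝ :=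
  ∑ s, m s * (expansion P I s i : ℝ)

/-- The sign `σ_I(i)` of `z_i`. -/
def sgn (P : Matrix (Fin n) (Fin d) ℤ) (I : Finset (Fin n)) (m : Fin n → ℝ) (i : I) : ℤ :=
  (SignType.sign (coordZ P I m i) : ℤ)

/-- The integer `r_i(I)`: the sum of the entries of the vector `r_i`, that is of the column of
`-R_I · diag(σ_I)` labelled by `i`. -/
def rSum (P : Matrix (Fin n) (Fin d) ℤ) (I : Finset (Fin n)) (m : Fin n → ℝ) (i : I) : ℤ :=
  ∑ s, -(expansion P I s i * sgn P I m i)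

/-! ## Verma modules and their twisted traces -/

/-- A Verma module `Δ_I`: a module over the quantum Higgs branch with a basis `v_c`, `c ∈ ℤ_{≥0}^I`,
of simultaneous eigenvectors of the `h_i`, `i ∈ I`, with eigenvalues `-σ_I(i)(c_i + 1/2)`, generated
by `v_0`. -/
structure VermaModule (Q : Matrix (Fin n) (Fin k) ℤ) (P : Matrix (Fin n) (Fin d) ℤ)
    (m ζ : Fin n → ℝ) (I : Finset (Fin n)) where
  carrier : Type
  [addCommGroup : AddCommGroup carrier]
  [moduleComplex : Module ℂ carrier]
  [moduleHiggs : Module (AHiggs Q ζ) carrier]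
  [isScalarTower : IsScalarTower ℂ (AHiggs Q ζ) carrier]
  basis : Module.Basis (I → ℕ) ℂ carrier
  eigen : ∀ (c : I → ℕ) (i : I),
    higgsH Q ζ i • basis c = (-(sgn P I m i : ℂ) * ((c i : ℂ) + 1 / 2)) • basis c
  cyclic : Submodule.span (AHiggs Q ζ) {basis 0} = ⊤

namespace VermaModule

attribute [instance] VermaModule.addCommGroup VermaModule.moduleComplex VermaModule.moduleHiggs
  VermaModule.isScalarTower

variable {Q : Matrix (Fin n) (Fin k) ℤ} {P : Matrix (Fin n) (Fin d) ℤ}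
  {m ζ : Fin n → ℝ} {I : Finset (Fin n)}

/-- The diagonal matrix coefficient of `a` at `v_c`. -/
def diag (Δ : VermaModule Q P m ζ I) (a : AHiggs Q ζ) (c : I → ℕ) : ℂ :=
  Δ.basis.repr (a • Δ.basis c) c

/-- The diagonal matrix coefficient at `v_c` of `(-1)^F exp(2π μ̂_ζ(m)) a`.  The operator `μ̂_ζ(m)` is
diagonal in the basis `v_c`, and `(-1)^F` acts on `v_c` by `(-1)^{Σ r_i(I) c_i}`. -/
def traceTerm (Δ : VermaModule Q P m ζ I) (a : AHiggs Q ζ) (c : I → ℕ) : ℂ :=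
  (-1) ^ (∑ i, rSum P I m i * (c i : ℤ)) *
    Complex.exp (2 * Real.pi * Δ.diag (higgsMu Q m ζ) c) * Δ.diag a c

/-- The twisted trace `Tr_{Δ_I}(a)`: the trace of `(-1)^F exp(2π μ̂_ζ(m)) a` on `Δ_I`. -/
def trace (Δ : VermaModule Q P m ζ I) (a : AHiggs Q ζ) : ℂ :=
  ∑' c : I → ℕ, Δ.traceTerm a c

end VermaModule

/-! ## The coefficients -/

/-- `CS_r(x)` is `sech x` for odd `r` and `csch x` for even `r`. -/
def CS (r : ℤ) (x : ℝ) : ℝ := if Even r then (Real.sinh x)⁻¹ else (Real.cosh x)⁻¹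

/-- `℘(r)` is `1` for `r ≡ 0, 1` and `-1` for `r ≡ 2, 3` modulo `4`. -/
def wp (r : ℤ) : ℤ := if r % 4 = 0 ∨ r % 4 = 1 then 1 else -1

/-- The fourth root of unity `ϖ(r)` with `sech (x + π i (r - 1) / 2) = ϖ(r) CS_r(x)`. -/
def sechPhase (r : ℤ) : ℂ := (wp r : ℂ) * if Even r then Complex.I else 1

/-- `r̃_i(J) = 1 + Σ_{j ∈ J} (R^!_J)_{i j} σ^!_J(j)`, where `J` is the complement of `I`. -/
def rTilde (Q : Matrix (Fin n) (Fin k) ℤ) (ζ : Fin n → ℝ) (J : Finset (Fin n)) (i : Fin n) : ℤ :=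
  1 + ∑ j : J, expansion Q J i j * sgn Q J ζ j

/-- The coefficient of `Tr_{Δ_I}`.  With `J` the complement of `I`, the objects of the dual theory
(denoted by `!`) are obtained by exchanging `P` with `Q`, `m` with `ζ`, and `I` with `J`. -/
def vermaCoeff (Q : Matrix (Fin n) (Fin k) ℤ) (P : Matrix (Fin n) (Fin d) ℤ)
    (m ζ : Fin n → ℝ) (I : Finset (Fin n)) : ℂ :=
  (∏ i : I, sechPhase (rTilde Q ζ Iᶜ i) * (sgn P I m i : ℂ) ^ (rSum P I m i + 1)) *
    ∏ j : (Iᶜ : Finset (Fin n)), (sgn Q Iᶜ ζ j : ℂ) ^ (rSum Q Iᶜ ζ j + 1) *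
      ((1 / 2 * CS (rSum Q Iᶜ ζ j) (Real.pi * coordZ Q Iᶜ ζ j) : ℝ) : ℂ)

end SphereTrace

end

noncomputable section

namespace SphereTrace

open scoped Matrix

/-! ## Lattice bases and exact sequences -/

section Lattice

variable {n k d : ℕ} {Q : Matrix (Fin n) (Fin k) ℤ} {P : Matrix (Fin n) (Fin d) ℤ}

/-! Reduction to `w = 1`. Gauge invariants are combinations of neutral monomials `x^α ∂^β`. Those
with `α ≠ β` shift weights and have no diagonal part; those with `α = β` are polynomials in the
`h_j`. So an invariant has a symbol: one polynomial whose values at the joint eigenvalues of the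
`h_j` are its diagonal entries in every weight basis (`exists_eval_diag`). Vacuum traces and Verma
traces thereby become sums of this polynomial over ladders of weights. Differentiating a ladder sum
in `m_s` inserts `2π(h_s + iζ_s)` (`hasDerivAt_ladderTrace`), and the same happens under the
integral, while `C_I` depends on `m` only through signs and is locally constant. An induction on the
degree then starts from `w = 1`.

The case `w = 1`. The vacuum trace is a product of factors `e^{2πi b ζ} / (2 cosh πb)`, that is, of
`phi α b = e^{2παb} / (1 + e^{2πb})` at `α = 1/2 + iζ`. For any `S` containing a basis, and any
exponents in the open unit strip that are non-integral on the bases in `S`, the integral of the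
product over `S` is a sum of residue terms over these bases (`residueFormula`). If `S` is a basis,
the coordinates are unimodular and each factor is a Beta integral. Otherwise `S` contains a circuit,
a relation `Σ ε_s Q_s = 0` with `ε_s ∈ {0, ±1}`, so `Σ ε_s b_s` is a constant `z` on the contour,
nonzero by genericity. With `X_s = e^{2πb_s}` the constant `1 - ∏(-X_s^{ε_s})` telescopes into terms
containing `1 + X_j^{ε_j}`, each of which cancels one denominator. Ordering the circuit by the real
parts of its normalized exponents keeps the new exponents in the strip. The identity is algebraic,
so the residue terms obey the same recursion with `X_s` replaced by its value `chi` at the pole.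
Coinciding exponents are handled by perturbation.

Comparison. Bases of `Q` are the complements of bases of `P`, with `R^! = -Rᵀ`. At the basis
complementary to `I` the sines give the dual factors `CS(πz^!_j)`, and the remaining denominators
give the geometric series of the trace of `1` on `Δ_I` (`residueTerm_compl`). What is left is a
count of fourth roots of unity. The Verma modules themselves are cut out of weight modules of the
Weyl algebra on `ℤ^n` (`exists_vermaModule`). -/

theorem IsExactSequence.transpose_mul (h : IsExactSequence Q P) : Qᵀ * P = 0 := by
  ext a b
  have := congrFun ((h.2.1 (P *ᵥ Pi.single b 1)).2 ⟨_, rfl⟩) a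
  rw [Matrix.mulVec_mulVec, Matrix.mulVec_single_one] at this
  exact this

/-- The dual of an exact sequence of lattices `0 → ℤ^d → ℤ^n → ℤ^k → 0` is exact. -/
theorem IsExactSequence.symm (h : IsExactSequence Q P) : IsExactSequence P Q := by
  -- `S` is a section of the surjection `Qᵀ`. Then `1 - S Qᵀ` lands in the kernel and factors as `P
  -- L`; transposing `1 = S Qᵀ + P L` splits the dual sequence.
  choose u hu using fun a : Fin k => h.2.2 (Pi.single a 1)
  set S : Matrix (Fin n) (Fin k) ℤ := Matrix.of fun s a => u a s with hS
  have hQS : Qᵀ * S = 1 := by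
    ext a b
    have := congrFun (hu b) a
    simp only [Matrix.mulVec, dotProduct] at this
    simp [Matrix.mul_apply, hS, Matrix.one_apply, Pi.single_apply] at this ⊢
    exact this
  have hker : ∀ s, ∃ v : Fin d → ℤ, P *ᵥ v = (1 - S * Qᵀ) *ᵥ Pi.single s 1 := by
    intro s
    refine (h.2.1 _).1 ?_
    rw [Matrix.mulVec_mulVec, Matrix.mul_sub, ← Matrix.mul_assoc, hQS]
    simp only [Matrix.mul_one, Matrix.one_mul, sub_self, Matrix.zero_mulVec]
  choose v hv using hker
  set L : Matrix (Fin d) (Fin n) ℤ := Matrix.of fun b s => v s b with hL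
  have hPL : 1 - S * Qᵀ = P * L := by
    ext s s'
    have := congrFun (hv s') s
    rw [Matrix.mulVec_single_one] at this
    simp only [Matrix.col_apply] at this
    rw [← this]
    simp [Matrix.mul_apply, hL, Matrix.mulVec, dotProduct]
  have hinj : ∀ M : Matrix (Fin d) (Fin d) ℤ, P * M = P → M = 1 := by
    intro M hM
    ext a b
    have h1 : M *ᵥ Pi.single b 1 = Pi.single b 1 := h.1 (by
      show P *ᵥ (M *ᵥ _) = P *ᵥ _
      rw [Matrix.mulVec_mulVec, hM])
    have := congrFun h1 a
    simpa [Matrix.one_apply, Pi.single_apply] using this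
  have hLP : L * P = 1 := hinj _ (by
    rw [← Matrix.mul_assoc, ← hPL, Matrix.sub_mul, Matrix.mul_assoc, h.transpose_mul]; simp)
  have hSQ : Sᵀ * Q = 1 := by
    have := congrArg Matrix.transpose hQS
    simpa using this
  have hPL' : (1 : Matrix (Fin n) (Fin n) ℤ) = Q * Sᵀ + Lᵀ * Pᵀ := by
    have := congrArg Matrix.transpose hPL
    simp only [Matrix.transpose_sub, Matrix.transpose_mul, Matrix.transpose_one,
      Matrix.transpose_transpose] at this
    rw [← this]; abel
  have hPQ : Pᵀ * Q = 0 := by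
    have := congrArg Matrix.transpose h.transpose_mul
    simpa using this
  refine ⟨fun v w hvw => ?_, fun u => ⟨fun hu => ⟨Sᵀ *ᵥ u, ?_⟩, ?_⟩, fun w => ⟨Lᵀ *ᵥ w, ?_⟩⟩
  · have : Sᵀ *ᵥ (Q *ᵥ v) = Sᵀ *ᵥ (Q *ᵥ w) := congrArg _ hvw
    simpa [Matrix.mulVec_mulVec, hSQ] using this
  · have := congrArg (· *ᵥ u) hPL'
    simp only [Matrix.one_mulVec, Matrix.add_mulVec, ← Matrix.mulVec_mulVec, hu,
      Matrix.mulVec_zero, add_zero] at this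
    exact this.symm
  · rintro ⟨y, rfl⟩
    simp [Matrix.mulVec_mulVec, hPQ]
  · have := congrArg Matrix.transpose hLP
    simp only [Matrix.transpose_mul, Matrix.transpose_one] at this
    simp [Matrix.mulVec_mulVec, this]

theorem sum_subtype_add_sum_compl {M : Type*} [AddCommMonoid M] (I : Finset (Fin n))
    (f : Fin n → M) : ∑ i : I, f i + ∑ j : (Iᶜ : Finset (Fin n)), f j = ∑ s, f s := by
  rw [Finset.sum_coe_sort I f, Finset.sum_coe_sort Iᶜ f, Finset.sum_add_sum_compl]

variable {I : Finset (Fin n)}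

theorem expansion_sum (hI : IsLatticeBasis P I) (s : Fin n) :
    ∑ i : I, expansion P I s i • P i = P s := by
  have := (Module.Basis.mk hI.1 hI.2).sum_repr (P s)
  simpa [expansion, hI] using this

theorem expansion_unique (hI : IsLatticeBasis P I) {s : Fin n} {c : I → ℤ}
    (h : ∑ i : I, c i • P i = P s) (i : I) : expansion P I s i = c i := by
  have h1 := expansion_sum hI s
  rw [← h] at h1
  have h2 := Fintype.linearIndependent_iff.1 hI.1 (fun i => expansion P I s i - c i)
    (by simp only [sub_smul, Finset.sum_sub_distrib, h1, sub_self]) i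
  linarith

theorem expansion_self (hI : IsLatticeBasis P I) (i i' : I) :
    expansion P I i i' = if i = i' then 1 else 0 := by
  refine expansion_unique hI (c := fun i' => if i = i' then 1 else 0) ?_ i'
  simp

theorem expansion_of_mem (hI : IsLatticeBasis P I) {s : Fin n} (hs : s ∈ I) (i : I) :
    expansion P I s i = if s = i then 1 else 0 := by
  have := expansion_self hI ⟨s, hs⟩ i
  simpa [Subtype.ext_iff] using this

/-- The dual basis of a lattice basis. -/
theorem exists_dual (hI : IsLatticeBasis P I) (u : I → ℤ) :
    ∃ v : Fin d → ℤ, ∀ s, (P *ᵥ v) s = ∑ i : I, expansion P I s i * u i := by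
  let f : (Fin d → ℤ) →ₗ[ℤ] ℤ := (Module.Basis.mk hI.1 hI.2).constr ℤ u
  have hf : ∀ i : I, f (P i) = u i := fun i => by
    have := (Module.Basis.mk hI.1 hI.2).constr_basis ℤ u i
    rwa [Module.Basis.mk_apply] at this
  have hdot : ∀ w, f w = ∑ a, w a * f (Pi.single a 1) := fun w => by
    conv_lhs => rw [pi_eq_sum_univ' w]
    simp only [map_sum, map_smul, smul_eq_mul]
  refine ⟨fun a => f (Pi.single a 1), fun s => ?_⟩
  have : (P *ᵥ fun a => f (Pi.single a 1)) s = f (P s) := by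
    rw [hdot]; rfl
  rw [this, ← expansion_sum hI s, map_sum]
  refine Finset.sum_congr rfl fun i _ => ?_
  rw [map_smul, hf, smul_eq_mul]

theorem transpose_mulVec_expansion (h : IsExactSequence Q P) (hI : IsLatticeBasis P I)
    (u : I → ℤ) : Qᵀ *ᵥ (fun s => ∑ i : I, expansion P I s i * u i) = 0 := by
  obtain ⟨v, hv⟩ := exists_dual hI u
  exact (h.2.1 _).2 ⟨v, funext hv⟩

/-- The kernel of `Qᵀ` is the image of `P`, and the entries of `P v` are pairings of `v` with the
rows, so they obey the same expansion as the rows. A kernel vector is thus determined by its entries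
in `I`. -/
theorem eq_expansion_of_mem_ker (h : IsExactSequence Q P) (hI : IsLatticeBasis P I)
    {u : Fin n → ℤ} (hu : Qᵀ *ᵥ u = 0) (s : Fin n) :
    u s = ∑ i : I, expansion P I s i * u i := by
  obtain ⟨v, rfl⟩ := (h.2.1 _).1 hu
  have := congrArg (· ⬝ᵥ v) (expansion_sum hI s)
  simp only [sum_dotProduct, smul_dotProduct, smul_eq_mul] at this
  exact this.symm

theorem transpose_mulVec_eq_sum (u : Fin n → ℤ) : Qᵀ *ᵥ u = ∑ s, u s • Q s := by
  ext a
  simp [Matrix.mulVec, dotProduct, mul_comm]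

/-- The complement of a lattice basis is a lattice basis of the dual lattice. -/
theorem IsLatticeBasis.compl (h : IsExactSequence Q P) (hI : IsLatticeBasis P I) :
    IsLatticeBasis Q Iᶜ := by
  constructor
  · rw [Fintype.linearIndependent_iff]
    intro c hc j
    -- A relation among the complementary rows, extended by zero, is a kernel vector vanishing on
    -- `I`, hence zero.
    let u : Fin n → ℤ := fun s => if hs : s ∈ Iᶜ then c ⟨s, hs⟩ else 0
    have hu : Qᵀ *ᵥ u = 0 := by
      rw [transpose_mulVec_eq_sum, ← sum_subtype_add_sum_compl I]
      rw [Finset.sum_eq_zero (s := (Finset.univ : Finset I))]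
      · rw [zero_add, ← hc]
        refine Finset.sum_congr rfl fun j _ => ?_
        simp only [u, dif_pos j.2]
      · rintro ⟨i, hi⟩ -
        simp [u, hi]
    have := eq_expansion_of_mem_ker h hI hu j
    rw [Finset.sum_eq_zero] at this
    · simpa only [u, dif_pos j.2] using this
    · rintro ⟨i, hi⟩ -
      simp [u, hi]
  · intro y _
    -- Subtracting the kernel vector with the same entries on `I` leaves `Qᵀ u` unchanged and makes
    -- `u` vanish on `I`.
    obtain ⟨u, rfl⟩ := h.2.2 y
    have h1 := transpose_mulVec_expansion h hI (fun i => u i)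
    have h2 : Qᵀ *ᵥ u = Qᵀ *ᵥ (fun s => u s - ∑ i : I, expansion P I s i * u i) := by
      have : (fun s => u s - ∑ i : I, expansion P I s i * u i) =
        u - (fun s => ∑ i : I, expansion P I s i * u i) := rfl
      rw [this, Matrix.mulVec_sub, h1, sub_zero]
    simp only [h2]
    rw [transpose_mulVec_eq_sum, ← sum_subtype_add_sum_compl I, Finset.sum_eq_zero, zero_add]
    · exact Submodule.sum_mem _ fun j _ => Submodule.smul_mem _ _ (Submodule.subset_span ⟨j, rfl⟩)
    · intro i _
      simp [expansion_self hI i]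

/-- The expansion coefficients of a lattice basis and of the dual lattice basis are negative
transposes of each other. -/
theorem expansion_compl (h : IsExactSequence Q P) (hI : IsLatticeBasis P I) (i : I)
    (j : (Iᶜ : Finset (Fin n))) : expansion Q Iᶜ i j = -expansion P I j i := by
  refine expansion_unique (hI.compl h) (c := fun j => -expansion P I j i) ?_ j
  -- Column `i` of `R_I` is a kernel vector with entry `1` at `i` and `0` on the rest of `I`, so it
  -- expresses `Q i` through the complementary rows.
  have h1 := transpose_mulVec_expansion h hI (Pi.single i 1)
  simp only [Pi.single_apply, mul_ite, mul_one, mul_zero, Finset.sum_ite_eq',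
    Finset.mem_univ, if_true] at h1
  rw [transpose_mulVec_eq_sum, ← sum_subtype_add_sum_compl I] at h1
  simp only [expansion_self hI, ite_smul, one_smul, zero_smul, Finset.sum_ite_eq',
    Finset.mem_univ, if_true] at h1
  simp only [neg_smul, Finset.sum_neg_distrib]
  exact (eq_neg_of_add_eq_zero_left h1).symm

theorem IsLatticeBasis.card_eq (hI : IsLatticeBasis P I) : I.card = d := by
  have := Module.finrank_eq_card_basis (Module.Basis.mk hI.1 hI.2)
  simpa using this.symm

theorem IsLatticeBasis.eq_of_subset {I' : Finset (Fin n)} (hI : IsLatticeBasis P I)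
    (hI' : IsLatticeBasis P I') (hsub : I' ⊆ I) : I' = I :=
  Finset.eq_of_subset_of_card_le hsub (by rw [hI.card_eq, hI'.card_eq])

/-- Casting a row into a real vector. -/
def realRow (P : Matrix (Fin n) (Fin d) ℤ) (s : Fin n) : Fin d → ℝ := fun a => (P s a : ℝ)

theorem realRow_expansion (hI : IsLatticeBasis P I) (s : Fin n) :
    ∑ i : I, (expansion P I s i : ℝ) • realRow P i = realRow P s := by
  ext a
  have := congrFun (expansion_sum hI s) a
  simp only [Finset.sum_apply, Pi.smul_apply, smul_eq_mul, realRow] at this ⊢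
  rw [← this]
  push_cast
  rfl

theorem span_realRow_eq_top {ι : Type*} (f : ι → Fin n)
    (h : ⊤ ≤ Submodule.span ℤ (Set.range fun i => P (f i))) :
    Submodule.span ℝ (Set.range fun i => realRow P (f i)) = ⊤ := by
  have hmap : ∀ w : Fin d → ℤ, (fun a => (w a : ℝ)) ∈
      Submodule.span ℝ (Set.range fun i => realRow P (f i)) := by
    intro w
    have hw : w ∈ Submodule.span ℤ (Set.range fun i => P (f i)) := h trivial
    induction hw using Submodule.span_induction with
    | mem x hx =>
      obtain ⟨i, rfl⟩ := hx
      exact Submodule.subset_span ⟨i, rfl⟩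
    | zero =>
      have : (fun a : Fin d => (((0 : Fin d → ℤ) a : ℤ) : ℝ)) = 0 := by ext; simp
      rw [this]; exact zero_mem _
    | add x y _ _ hx hy =>
      have : (fun a => ((x + y) a : ℝ)) = (fun a => (x a : ℝ)) + fun a => (y a : ℝ) := by
        ext; simp
      rw [this]; exact Submodule.add_mem _ hx hy
    | smul c x _ hx =>
      have : (fun a => ((c • x) a : ℝ)) = (c : ℝ) • fun a => (x a : ℝ) := by
        ext; simp
      rw [this]; exact Submodule.smul_mem _ _ hx
  rw [eq_top_iff]
  intro x _
  rw [pi_eq_sum_univ' x]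
  refine Submodule.sum_mem _ fun a _ => Submodule.smul_mem _ _ ?_
  have := hmap (fun b => if a = b then 1 else 0)
  convert this using 2
  rename_i b
  by_cases hab : a = b
  · subst hab; simp
  · simp [hab, Ne.symm hab]

/-- A spanning family of the right size is automatically independent, so unimodularity applies as
soon as spanning and cardinality are known. -/
theorem isLatticeBasis_of_span (hu : IsUnimodular P) (hcard : I.card = d)
    (h : Submodule.span ℝ (Set.range fun i : I => realRow P i) = ⊤) : IsLatticeBasis P I :=
  hu I (linearIndependent_of_top_le_span_of_card_eq_finrank h.ge (by simp [hcard])) h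

/-- Dual exactness makes the rows of `P` generate `ℤ^d`; a maximal independent subfamily over `ℝ` is
then a lattice basis by unimodularity. -/
theorem exists_isLatticeBasis (h : IsExactSequence Q P) (hu : IsUnimodular P) :
    ∃ I, IsLatticeBasis P I := by
  have hspan : Submodule.span ℝ (Set.range fun s : Fin n => realRow P s) = ⊤ := by
    refine span_realRow_eq_top (P := P) id fun w _ => ?_
    obtain ⟨u, rfl⟩ := h.symm.2.2 w
    simp only [transpose_mulVec_eq_sum]
    exact sum_mem fun s _ => Submodule.smul_mem _ _ (Submodule.subset_span ⟨s, rfl⟩)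
  obtain ⟨κ, a, ha, hsp, hli⟩ := exists_linearIndependent' ℝ (fun s : Fin n => realRow P s)
  have : Finite κ := Finite.of_injective a ha
  have := Fintype.ofFinite κ
  classical
  refine ⟨Finset.univ.image a, isLatticeBasis_of_span hu ?_ ?_⟩
  · rw [Finset.card_image_of_injective _ ha, Finset.card_univ]
    have := Module.finrank_eq_card_basis (Module.Basis.mk hli (by rw [hsp, hspan]))
    simpa using this.symm
  · rw [← hspan, ← hsp]
    congr 1
    ext x
    simp

/-- The exchange property of bases. -/
theorem IsLatticeBasis.exchange (hu : IsUnimodular P) (hI : IsLatticeBasis P I) {j : Fin n}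
    (i : I) (hj : j ∉ I) (hij : expansion P I j i ≠ 0) :
    IsLatticeBasis P (insert j (I.erase i)) := by
  refine isLatticeBasis_of_span hu ?_ ?_
  · rw [Finset.card_insert_of_notMem (by simp [hj]), Finset.card_erase_of_mem i.2, hI.card_eq]
    have : 0 < d := by
      rw [← hI.card_eq]; exact Finset.card_pos.2 ⟨_, i.2⟩
    omega
  · rw [eq_top_iff, ← span_realRow_eq_top (fun i : I => (i : Fin n)) hI.2, Submodule.span_le]
    set V := Submodule.span ℝ (Set.range fun s : (insert j (I.erase i) : Finset (Fin n)) =>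
      realRow P s)
    have hmem : ∀ s, s ∈ insert j (I.erase (i : Fin n)) → realRow P s ∈ V := fun s hs =>
      Submodule.subset_span ⟨⟨s, hs⟩, rfl⟩
    rintro _ ⟨l, rfl⟩
    by_cases hl : l = i
    · subst hl
      -- The coefficient of row `l` is nonzero, so the expansion of row `j` can be solved for row
      -- `l` over `ℝ`.
      have h1 := realRow_expansion hI j
      rw [← Finset.add_sum_erase _ _ (Finset.mem_univ l)] at h1
      have h2 : (expansion P I j l : ℝ) • realRow P l ∈ V := by
        rw [eq_sub_of_add_eq h1]
        refine Submodule.sub_mem _ (hmem _ (by simp))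
          (Submodule.sum_mem _ fun s hs => Submodule.smul_mem _ _ (hmem _ ?_))
        have hsl : (s : Fin n) ≠ l := fun h => (Finset.mem_erase.1 hs).1 (Subtype.ext h)
        simp [hsl]
      exact (Submodule.smul_mem_iff _ (by exact_mod_cast hij)).1 h2
    · have hl' : (l : Fin n) ≠ i := fun h => hl (Subtype.ext h)
      exact hmem _ (Finset.mem_insert_of_mem (Finset.mem_erase.2 ⟨hl', l.2⟩))

/-- For a unimodular arrangement the expansion coefficients are `0` or `±1`. -/
theorem expansion_eq_zero_or (hu : IsUnimodular P) (hI : IsLatticeBasis P I) (j : Fin n) (i : I) :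
    expansion P I j i = 0 ∨ expansion P I j i = 1 ∨ expansion P I j i = -1 := by
  by_cases hj : j ∈ I
  · rw [expansion_of_mem hI hj]; split_ifs <;> simp
  by_cases hij : expansion P I j i = 0
  · exact Or.inl hij
  right
  have hI' := hI.exchange hu i hj hij
  have hjm : j ∈ insert j (I.erase (i : Fin n)) := by simp
  -- Pairing with the dual vector of `i` reads off column `i` of `R_I`. Applied to the expansion of
  -- `P i` in the exchanged basis it leaves `1` as an integer times the entry at `j`, because the
  -- other new basis elements lie in `I` without `i`. The entry is therefore a unit.
  obtain ⟨v, hv⟩ := exists_dual hI (Pi.single i 1)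
  simp only [Pi.single_apply, mul_ite, mul_one, mul_zero, Finset.sum_ite_eq',
    Finset.mem_univ, if_true] at hv
  have h1 := congrArg (· ⬝ᵥ v) (expansion_sum hI' (i : Fin n))
  simp only [sum_dotProduct, smul_dotProduct, smul_eq_mul] at h1
  have h2 : ∀ s, P s ⬝ᵥ v = expansion P I s i := hv
  simp only [h2, expansion_self hI, if_true] at h1
  rw [Finset.sum_eq_single ⟨j, hjm⟩] at h1
  · exact Int.isUnit_iff.1 (IsUnit.of_mul_eq_one_right _ h1)
  · rintro ⟨s, hs⟩ - hsj
    have hs' : s ≠ i ∧ s ∈ I := by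
      have : s ≠ j := fun h => hsj (Subtype.ext h)
      simpa [this] using hs
    rw [expansion_of_mem hI hs'.2, if_neg hs'.1, mul_zero]
  · simp

end Lattice

/-! ## Normal ordering in the Weyl algebra -/

section Weyl

variable {n k d : ℕ}

theorem pi_nat_induction {p : (Fin n → ℕ) → Prop} (zero : p 0)
    (succ : ∀ α j, p α → p (α + Pi.single j 1)) (α : Fin n → ℕ) : p α := by
  induction hN : ∑ j, α j generalizing α with
  | zero =>
    have : α = 0 := by
      ext j
      exact (Finset.sum_eq_zero_iff.1 hN) j (Finset.mem_univ j)
    exact this ▸ zero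
  | succ N ih =>
    have : ∃ j, α j ≠ 0 := by
      by_contra! h
      simp [h] at hN
    obtain ⟨j, hj⟩ := this
    have hα : α = (α - Pi.single j 1) + Pi.single j 1 := by
      ext i
      by_cases hij : i = j
      · subst hij; simp; omega
      · simp [hij]
    have hsum : ∑ i, α i = ∑ i, (α - Pi.single j 1 : Fin n → ℕ) i + 1 := by
      conv_lhs => rw [hα]
      simp [Finset.sum_add_distrib]
    rw [hα]
    exact succ _ _ (ih _ (by omega))

theorem Weyl.commute_x (i j : Fin n) : Commute (Weyl.x i) (Weyl.x j) := Weyl.x_mul_x i j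

theorem Weyl.commute_del (i j : Fin n) : Commute (Weyl.del i) (Weyl.del j) := Weyl.del_mul_del i j

/-- The monomials in the `x_j`, as a monoid homomorphism. -/
def xHom (n : ℕ) : (Fin n → Multiplicative ℕ) →* Weyl n :=
  MonoidHom.noncommPiCoprod (fun j => powersHom (Weyl n) (Weyl.x j)) fun i j _ a b => by
    simp only [powersHom_apply]
    exact (Weyl.commute_x i j).pow_pow _ _

/-- The monomials in the `∂_j`, as a monoid homomorphism. -/
def delHom (n : ℕ) : (Fin n → Multiplicative ℕ) →* Weyl n :=
  MonoidHom.noncommPiCoprod (fun j => powersHom (Weyl n) (Weyl.del j)) fun i j _ a b => by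
    simp only [powersHom_apply]
    exact (Weyl.commute_del i j).pow_pow _ _

/-- The monomial `x^α`. -/
def xMon (α : Fin n → ℕ) : Weyl n := xHom n fun j => Multiplicative.ofAdd (α j)

/-- The monomial `∂^β`. -/
def delMon (β : Fin n → ℕ) : Weyl n := delHom n fun j => Multiplicative.ofAdd (β j)

@[simp] theorem xMon_zero : xMon (0 : Fin n → ℕ) = 1 := map_one (xHom n)

@[simp] theorem delMon_zero : delMon (0 : Fin n → ℕ) = 1 := map_one (delHom n)

theorem xMon_add (α β : Fin n → ℕ) : xMon (α + β) = xMon α * xMon β := map_mul (xHom n) _ _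

theorem delMon_add (α β : Fin n → ℕ) : delMon (α + β) = delMon α * delMon β :=
  map_mul (delHom n) _ _

theorem ofAdd_single (j : Fin n) :
    (fun i => Multiplicative.ofAdd ((Pi.single j 1 : Fin n → ℕ) i)) =
      Pi.mulSingle j (Multiplicative.ofAdd 1) := by
  ext i
  by_cases h : i = j
  · subst h; simp
  · simp [h]

theorem xMon_single (j : Fin n) : xMon (Pi.single j 1) = Weyl.x j := by
  rw [xMon, ofAdd_single]
  exact (MonoidHom.noncommPiCoprod_mulSingle (N := fun _ => Multiplicative ℕ)
    (ϕ := fun j => powersHom (Weyl n) (Weyl.x j)) j (Multiplicative.ofAdd 1)).trans (by simp)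

theorem delMon_single (j : Fin n) : delMon (Pi.single j 1) = Weyl.del j := by
  rw [delMon, ofAdd_single]
  exact (MonoidHom.noncommPiCoprod_mulSingle (N := fun _ => Multiplicative ℕ)
    (ϕ := fun j => powersHom (Weyl n) (Weyl.del j)) j (Multiplicative.ofAdd 1)).trans (by simp)

theorem xMon_add_single (α : Fin n → ℕ) (j : Fin n) :
    xMon (α + Pi.single j 1) = Weyl.x j * xMon α := by
  rw [add_comm, xMon_add, xMon_single]

theorem delMon_add_single (β : Fin n → ℕ) (j : Fin n) :
    delMon (β + Pi.single j 1) = Weyl.del j * delMon β := by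
  rw [add_comm, delMon_add, delMon_single]

theorem Weyl.induction {U : Submodule ℂ (Weyl n)} (one : 1 ∈ U)
    (hx : ∀ j, ∀ w ∈ U, Weyl.x j * w ∈ U) (hd : ∀ j, ∀ w ∈ U, Weyl.del j * w ∈ U) (w : Weyl n) :
    w ∈ U := by
  obtain ⟨f, rfl⟩ := RingQuot.mkAlgHom_surjective ℂ (WeylRel n) w
  suffices h : ∀ u ∈ U, RingQuot.mkAlgHom ℂ (WeylRel n) f * u ∈ U by simpa using h 1 one
  induction f using FreeAlgebra.induction with
  | grade0 r =>
    intro u hu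
    rw [AlgHom.commutes, ← Algebra.smul_def]
    exact U.smul_mem _ hu
  | grade1 g =>
    intro u hu
    rcases g with j | j
    · exact hx j u hu
    · exact hd j u hu
  | mul a b ha hb =>
    intro u hu
    rw [map_mul, mul_assoc]
    exact ha _ (hb _ hu)
  | add a b ha hb =>
    intro u hu
    rw [map_add, add_mul]
    exact U.add_mem (ha _ hu) (hb _ hu)

/-- The normally ordered monomials span the Weyl algebra. -/
theorem span_xMon_mul_delMon :
    Submodule.span ℂ (Set.range fun p : (Fin n → ℕ) × (Fin n → ℕ) => xMon p.1 * delMon p.2) = ⊤ := by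
  set U := Submodule.span ℂ (Set.range fun p : (Fin n → ℕ) × (Fin n → ℕ) => xMon p.1 * delMon p.2)
  have hmon : ∀ α β, xMon α * delMon β ∈ U := fun α β => Submodule.subset_span ⟨(α, β), rfl⟩
  have hext : ∀ y : Weyl n, (∀ α β, y * (xMon α * delMon β) ∈ U) → ∀ w ∈ U, y * w ∈ U := by
    intro y hy w hw
    induction hw using Submodule.span_induction with
    | mem w hw => obtain ⟨p, rfl⟩ := hw; exact hy _ _
    | zero => simp
    | add a b _ _ ha hb => rw [mul_add]; exact U.add_mem ha hb
    | smul c a _ ha => rw [mul_smul_comm]; exact U.smul_mem _ ha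
  have hx : ∀ j, ∀ w ∈ U, Weyl.x j * w ∈ U := fun j => hext _ fun α β => by
    rw [← mul_assoc, ← xMon_add_single]; exact hmon _ _
  rw [eq_top_iff]
  intro w _
  -- Only left multiplication by `∂_j` disturbs the normal order; it is moved past `x^α` one letter
  -- at a time, each commutator being a shorter monomial.
  refine Weyl.induction (by simpa using hmon 0 0) hx (fun j => hext _ fun α β => ?_) w
  induction α using pi_nat_induction with
  | zero => rw [xMon_zero, one_mul, ← delMon_add_single]; simpa using hmon 0 _
  | succ α i ih =>
    rw [xMon_add_single, mul_assoc (Weyl.x i), ← mul_assoc (Weyl.del j), Weyl.del_mul_x, add_mul,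
      mul_assoc]
    refine U.add_mem (hx _ _ ih) ?_
    split_ifs
    · simpa using hmon α β
    · simp

theorem Weyl.h_mul_x (i j : Fin n) :
    Weyl.h i * Weyl.x j = Weyl.x j * Weyl.h i + if i = j then Weyl.x j else 0 := by
  rw [Weyl.h, add_mul, mul_add, mul_assoc, Weyl.del_mul_x, mul_add, ← mul_assoc, Weyl.x_mul_x i j,
    mul_assoc, Algebra.commutes]
  by_cases h : i = j
  · subst h; simp only [if_true, mul_one]; abel
  · simp [h]

theorem Weyl.h_mul_del (i j : Fin n) :
    Weyl.h i * Weyl.del j = Weyl.del j * Weyl.h i - if i = j then Weyl.del j else 0 := by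
  rw [Weyl.h, add_mul, mul_add, ← mul_assoc, Weyl.del_mul_x, add_mul, mul_assoc,
    Weyl.del_mul_del i j, ← mul_assoc, Algebra.commutes]
  by_cases h : i = j
  · subst h; simp only [if_true, one_mul, mul_assoc]; abel
  · simp [h, Ne.symm h, mul_assoc]

theorem h_mul_xMon (α : Fin n → ℕ) (j : Fin n) :
    Weyl.h j * xMon α = xMon α * Weyl.h j + (α j : ℂ) • xMon α := by
  induction α using pi_nat_induction with
  | zero => simp
  | succ α i ih =>
    rw [xMon_add_single, ← mul_assoc, Weyl.h_mul_x, add_mul, mul_assoc, ih, mul_add, ← mul_assoc,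
      add_assoc, mul_smul_comm]
    congr 1
    by_cases h : j = i
    · subst h; simp [add_smul]
    · simp [h]

theorem h_mul_delMon (β : Fin n → ℕ) (j : Fin n) :
    Weyl.h j * delMon β = delMon β * Weyl.h j - (β j : ℂ) • delMon β := by
  induction β using pi_nat_induction with
  | zero => simp
  | succ α i ih =>
    rw [delMon_add_single, ← mul_assoc, Weyl.h_mul_del, sub_mul, mul_assoc, ih, mul_sub,
      ← mul_assoc, sub_sub, mul_smul_comm]
    congr 1
    by_cases h : j = i
    · subst h; simp [add_smul]
    · simp [h]

theorem h_mul_xMon_mul_delMon (α β : Fin n → ℕ) (j : Fin n) :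
    Weyl.h j * (xMon α * delMon β) =
      xMon α * delMon β * Weyl.h j + ((α j : ℂ) - β j) • (xMon α * delMon β) := by
  rw [← mul_assoc, h_mul_xMon, add_mul, mul_assoc, h_mul_delMon, mul_sub, ← mul_assoc,
    smul_mul_assoc, mul_smul_comm]
  module

/-- The subalgebra generated by the `h_j`. -/
abbrev cartan (n : ℕ) : Subalgebra ℂ (Weyl n) := Algebra.adjoin ℂ (Set.range Weyl.h)

theorem h_mem_cartan (j : Fin n) : Weyl.h j ∈ cartan n := Algebra.subset_adjoin ⟨j, rfl⟩

/-- From `x_j h_i = (h_i - δ_{ij}) x_j`: moving `x_j` to the right only shifts the argument of a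
polynomial in the `h_i`. This allows `x^α ∂^α` to be rewritten in the `h_j`. -/
theorem exists_mem_cartan_x_mul {y : Weyl n} (hy : y ∈ cartan n) (j : Fin n) :
    ∃ y' ∈ cartan n, Weyl.x j * y = y' * Weyl.x j := by
  induction hy using Algebra.adjoin_induction with
  | mem y hy =>
    obtain ⟨i, rfl⟩ := hy
    refine ⟨Weyl.h i - if i = j then 1 else 0, ?_, ?_⟩
    · split_ifs
      · exact sub_mem (h_mem_cartan i) (one_mem _)
      · simpa using h_mem_cartan i
    · rw [sub_mul, Weyl.h_mul_x]
      split_ifs <;> simp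
  | algebraMap r => exact ⟨algebraMap ℂ _ r, Subalgebra.algebraMap_mem _ _, (Algebra.commutes _ _).symm⟩
  | add a b _ _ ha hb =>
    obtain ⟨a', ha', ha⟩ := ha
    obtain ⟨b', hb', hb⟩ := hb
    exact ⟨a' + b', add_mem ha' hb', by rw [mul_add, add_mul, ha, hb]⟩
  | mul a b _ _ ha hb =>
    obtain ⟨a', ha', ha⟩ := ha
    obtain ⟨b', hb', hb⟩ := hb
    exact ⟨a' * b', mul_mem ha' hb', by rw [← mul_assoc, ha, mul_assoc, hb, mul_assoc]⟩

theorem xMon_mul_delMon_self (α : Fin n → ℕ) : xMon α * delMon α ∈ cartan n := by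
  induction α using pi_nat_induction with
  | zero => simp
  | succ α j ih =>
    obtain ⟨y, hy, h⟩ := exists_mem_cartan_x_mul ih j
    rw [xMon_add_single, delMon_add, delMon_single, mul_assoc, ← mul_assoc (xMon α), ← mul_assoc, h,
      mul_assoc]
    refine mul_mem hy ?_
    have : Weyl.x j * Weyl.del j = Weyl.h j - algebraMap ℂ _ (1 / 2) := by simp [Weyl.h]
    rw [this]
    exact sub_mem (h_mem_cartan j) (Subalgebra.algebraMap_mem _ _)

/-! ## Gauge invariants -/

variable (Q : Matrix (Fin n) (Fin k) ℤ)

theorem cartan_le_invariants : cartan n ≤ invariants Q :=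
  Algebra.adjoin_le (by rintro _ ⟨j, rfl⟩; exact h_mem_invariants Q j)

theorem gaugeAct_xMon (t : Fin k → Circle) (α : Fin n → ℕ) :
    gaugeAct Q t (xMon α) = ((∏ j, charge Q t j ^ α j : Circle) : ℂ) • xMon α := by
  induction α using pi_nat_induction with
  | zero => simp
  | succ α i ih =>
    rw [xMon_add_single, map_mul, ih, gaugeAct, Weyl.lift_x, smul_mul_smul_comm]
    congr 1
    simp only [Pi.add_apply, pow_add, Finset.prod_mul_distrib, Circle.coe_mul]
    rw [mul_comm, Finset.prod_eq_single i (f := fun j => charge Q t j ^ (Pi.single i 1 : Fin n → ℕ) j)]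
    · simp
    · intro j _ hj; simp [hj]
    · simp

theorem gaugeAct_delMon (t : Fin k → Circle) (β : Fin n → ℕ) :
    gaugeAct Q t (delMon β) = (((∏ j, charge Q t j ^ β j)⁻¹ : Circle) : ℂ) • delMon β := by
  induction β using pi_nat_induction with
  | zero => simp
  | succ α i ih =>
    rw [delMon_add_single, map_mul, ih, gaugeAct, Weyl.lift_del, smul_mul_smul_comm]
    congr 1
    simp only [Pi.add_apply, pow_add, Finset.prod_mul_distrib]
    rw [mul_inv, Circle.coe_mul, mul_comm,
      Finset.prod_eq_single i (f := fun j => charge Q t j ^ (Pi.single i 1 : Fin n → ℕ) j)]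
    · simp
    · intro j _ hj; simp [hj]
    · simp

/-- The charge of the monomial `x^α ∂^β`. -/
def monCharge (p : (Fin n → ℕ) × (Fin n → ℕ)) : Fin k → ℤ :=
  Qᵀ *ᵥ fun j => (p.1 j : ℤ) - p.2 j

theorem prod_zpow_eq_zpow_sum {G ι : Type*} [CommGroup G] (g : G) (s : Finset ι) (f : ι → ℤ) :
    ∏ i ∈ s, g ^ f i = g ^ ∑ i ∈ s, f i := by
  classical
  induction s using Finset.induction_on with
  | empty => simp
  | insert i s hi ih => rw [Finset.prod_insert hi, Finset.sum_insert hi, zpow_add, ih]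

theorem gaugeAct_mon (t : Fin k → Circle) (p : (Fin n → ℕ) × (Fin n → ℕ)) :
    gaugeAct Q t (xMon p.1 * delMon p.2) =
      ((∏ a, t a ^ monCharge Q p a : Circle) : ℂ) • (xMon p.1 * delMon p.2) := by
  rw [map_mul, gaugeAct_xMon, gaugeAct_delMon, smul_mul_smul_comm, ← Circle.coe_mul]
  congr 2
  rw [← Finset.prod_inv_distrib, ← Finset.prod_mul_distrib]
  have : ∀ j, charge Q t j ^ p.1 j * (charge Q t j ^ p.2 j)⁻¹ =
      ∏ a, t a ^ (Q j a * ((p.1 j : ℤ) - p.2 j)) := by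
    intro j
    rw [← zpow_natCast, ← zpow_natCast, ← zpow_neg, ← zpow_add, charge, ← Finset.prod_zpow]
    refine Finset.prod_congr rfl fun a _ => ?_
    rw [← zpow_mul, sub_eq_add_neg]
  simp only [this]
  rw [Finset.prod_comm]
  refine Finset.prod_congr rfl fun a _ => ?_
  simp only [monCharge, Matrix.mulVec, dotProduct, Matrix.transpose_apply]
  exact prod_zpow_eq_zpow_sum (G := Circle) (t a) _ _

theorem exists_circle_zpow_ne {μ : Fin k → ℤ} (hμ : μ ≠ 0) :
    ∃ t : Fin k → Circle, ((∏ a, t a ^ μ a : Circle) : ℂ) ≠ 1 := by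
  obtain ⟨a, ha⟩ := Function.ne_iff.1 hμ
  -- At `t_a = e^{πi/μ_a}`, with all other coordinates `1`, the character takes the value `-1`.
  refine ⟨Pi.mulSingle a (Circle.exp (Real.pi / μ a)), ?_⟩
  rw [Finset.prod_eq_single a]
  · have h0 : (μ a : ℂ) ≠ 0 := by exact_mod_cast ha
    have : (Circle.exp (Real.pi / μ a) ^ μ a : Circle) = Circle.exp Real.pi := by
      rw [← Circle.exp_zsmul]
      congr 1
      have h0 : (μ a : ℝ) ≠ 0 := by exact_mod_cast ha
      simp only [zsmul_eq_mul]
      field_simp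
    rw [Pi.mulSingle_eq_same, this]
    simp only [Circle.coe_exp, Complex.exp_pi_mul_I]
    norm_num
  · intro b _ hb; simp [Pi.mulSingle_eq_of_ne hb]
  · simp

/-- The span of the neutral monomials. -/
def neutral : Submodule ℂ (Weyl n) :=
  Submodule.span ℂ ((fun p : (Fin n → ℕ) × (Fin n → ℕ) => xMon p.1 * delMon p.2) ''
    {p | monCharge Q p = 0})

theorem neutral_le_invariants : neutral Q ≤ Subalgebra.toSubmodule (invariants Q) := by
  refine Submodule.span_le.2 ?_
  rintro _ ⟨p, hp, rfl⟩
  simp only [SetLike.mem_coe, Subalgebra.mem_toSubmodule, mem_invariants]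
  intro t
  rw [gaugeAct_mon, show monCharge Q p = 0 from hp]
  simp

/-- Gauge invariant operators are combinations of neutral monomials. -/
theorem invariants_le_neutral : Subalgebra.toSubmodule (invariants Q) ≤ neutral Q := by
  -- Charged monomials are eliminated one at a time. If `χ_p(t) ≠ 1`, the invariant `w` equals `(t·w
  -- - χ_p(t) w) / (1 - χ_p(t))`, in which the term of `p` has cancelled. Only spanning by monomials
  -- is used, not their independence; `g` collects the neutral terms already passed.
  have key : ∀ (F : Finset ((Fin n → ℕ) × (Fin n → ℕ))) (c : (Fin n → ℕ) × (Fin n → ℕ) → ℂ)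
      (g : Weyl n), g ∈ neutral Q →
      g + ∑ p ∈ F, c p • (xMon p.1 * delMon p.2) ∈ invariants Q →
      g + ∑ p ∈ F, c p • (xMon p.1 * delMon p.2) ∈ neutral Q := by
    intro F
    induction F using Finset.induction_on with
    | empty => intro c g hg _; simpa using hg
    | insert p F hp ih =>
      intro c g hg hinv
      by_cases hc : monCharge Q p = 0
      · rw [Finset.sum_insert hp, ← add_assoc] at hinv ⊢
        exact ih c _ ((neutral Q).add_mem hg
          ((neutral Q).smul_mem _ (Submodule.subset_span ⟨p, hc, rfl⟩))) hinv
      · obtain ⟨t, ht⟩ := exists_circle_zpow_ne hc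
        set χ : (Fin n → ℕ) × (Fin n → ℕ) → ℂ := fun q => ((∏ a, t a ^ monCharge Q q a : Circle) : ℂ)
        have h1 : (1 - χ p) ≠ 0 := sub_ne_zero.2 (Ne.symm ht)
        have hw := (mem_invariants Q _).1 hinv t
        have hgt : gaugeAct Q t g = g := (mem_invariants Q _).1 (neutral_le_invariants Q hg) t
        rw [map_add, hgt, map_sum] at hw
        simp only [map_smul, gaugeAct_mon] at hw
        have : g + ∑ q ∈ insert p F, c q • (xMon q.1 * delMon q.2) =
            g + ∑ q ∈ F, (c q * ((χ q - χ p) / (1 - χ p))) • (xMon q.1 * delMon q.2) := by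
          refine smul_right_injective _ h1 ?_
          show (1 - χ p) • _ = (1 - χ p) • _
          rw [sub_smul, one_smul]
          nth_rewrite 1 [← hw]
          rw [Finset.sum_insert hp, Finset.sum_insert hp, smul_add, smul_add, smul_add,
            Finset.smul_sum, Finset.smul_sum, sub_smul, one_smul]
          have e : ∀ q ∈ F, (1 - χ p) • (c q * ((χ q - χ p) / (1 - χ p))) •
              (xMon q.1 * delMon q.2) = c q • χ q • (xMon q.1 * delMon q.2) -
                χ p • c q • (xMon q.1 * delMon q.2) := by
            intro q _
            simp only [smul_smul, ← sub_smul]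
            congr 1
            field_simp
          rw [Finset.sum_congr rfl e, Finset.sum_sub_distrib, smul_comm (χ p) (c p)]
          simp only [χ]
          abel
        rw [this] at hinv ⊢
        exact ih _ g hg hinv
  intro w hw
  have hmem : w ∈ Submodule.span ℂ (Set.range fun p : (Fin n → ℕ) × (Fin n → ℕ) =>
      xMon p.1 * delMon p.2) := by rw [span_xMon_mul_delMon]; trivial
  obtain ⟨c, rfl⟩ := Finsupp.mem_span_range_iff_exists_finsupp.1 hmem
  simpa [Finsupp.sum] using key c.support c 0 (neutral Q).zero_mem (by simpa [Finsupp.sum] using hw)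

/-! ## Diagonal matrix coefficients -/

/-- The polynomial is chosen before the representation: one and the same symbol has to serve the
vacuum modules for all `b` and all Verma modules. -/
theorem exists_eval_of_mem_cartan {y : Weyl n} (hy : y ∈ cartan n) :
    ∃ p : MvPolynomial (Fin n) ℂ, ∀ (V : Type) [AddCommGroup V] [Module ℂ V]
      (ρ : invariants Q →ₐ[ℂ] Module.End ℂ V) (v : V) (l : Fin n → ℂ),
      (∀ j, ρ ⟨Weyl.h j, h_mem_invariants Q j⟩ v = l j • v) →
      ρ ⟨y, cartan_le_invariants Q hy⟩ v = p.eval l • v := by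
  induction hy using Algebra.adjoin_induction with
  | mem y hy =>
    obtain ⟨i, rfl⟩ := hy
    exact ⟨MvPolynomial.X i, fun V _ _ ρ v l h => by simpa using h i⟩
  | algebraMap r =>
    refine ⟨MvPolynomial.C r, fun V _ _ ρ v l h => ?_⟩
    have := congrArg (· v) (ρ.commutes r)
    simp only [Module.algebraMap_end_apply] at this
    rw [MvPolynomial.eval_C]
    exact this
  | add a b ha' hb' ha hb =>
    obtain ⟨p, hp⟩ := ha
    obtain ⟨q, hq⟩ := hb
    refine ⟨p + q, fun V _ _ ρ v l h => ?_⟩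
    have := congrArg (· v) (map_add ρ ⟨a, cartan_le_invariants Q ha'⟩ ⟨b, cartan_le_invariants Q hb'⟩)
    simp only [LinearMap.add_apply, hp V ρ v l h, hq V ρ v l h] at this
    rw [map_add, add_smul, ← this]
    rfl
  | mul a b ha' hb' ha hb =>
    obtain ⟨p, hp⟩ := ha
    obtain ⟨q, hq⟩ := hb
    refine ⟨p * q, fun V _ _ ρ v l h => ?_⟩
    have := congrArg (· v) (map_mul ρ ⟨a, cartan_le_invariants Q ha'⟩ ⟨b, cartan_le_invariants Q hb'⟩)
    simp only [Module.End.mul_apply, hp V ρ v l h, hq V ρ v l h, map_smul] at this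
    rw [map_mul, mul_comm, mul_smul, ← this]
    rfl

/-- The diagonal matrix coefficients of a gauge invariant operator, in any basis of joint
eigenvectors of the `h_j`, are the values of a polynomial at the eigenvalues. -/
theorem exists_eval_diag (w : invariants Q) :
    ∃ p : MvPolynomial (Fin n) ℂ, ∀ (V : Type) [AddCommGroup V] [Module ℂ V]
      (ρ : invariants Q →ₐ[ℂ] Module.End ℂ V) (ι : Type) (B : Module.Basis ι ℂ V)
      (l : ι → Fin n → ℂ),
      (∀ c j, ρ ⟨Weyl.h j, h_mem_invariants Q j⟩ (B c) = l c j • B c) →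
      ∀ c, B.repr (ρ w (B c)) c = p.eval (l c) := by
  obtain ⟨w, hw⟩ := w
  have hn := invariants_le_neutral Q hw
  -- Membership in the invariants is quantified inside, so that the induction over the span of
  -- neutral monomials applies to `w` alone.
  suffices h : ∃ p : MvPolynomial (Fin n) ℂ, ∀ (hw : w ∈ invariants Q) (V : Type)
      [AddCommGroup V] [Module ℂ V] (ρ : invariants Q →ₐ[ℂ] Module.End ℂ V) (ι : Type)
      (B : Module.Basis ι ℂ V) (l : ι → Fin n → ℂ),
      (∀ c j, ρ ⟨Weyl.h j, h_mem_invariants Q j⟩ (B c) = l c j • B c) →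
      ∀ c, B.repr (ρ ⟨w, hw⟩ (B c)) c = p.eval (l c) by
    obtain ⟨p, hp⟩ := h
    exact ⟨p, hp hw⟩
  clear hw
  induction hn using Submodule.span_induction with
  | mem w hw =>
    obtain ⟨⟨α, β⟩, hp, rfl⟩ := hw
    by_cases hαβ : α = β
    · subst hαβ
      obtain ⟨p, hp⟩ := exists_eval_of_mem_cartan Q (xMon_mul_delMon_self α)
      refine ⟨p, fun hw V _ _ ρ ι B l h c => ?_⟩
      rw [hp V ρ (B c) (l c) (h c)]
      simp
    -- A monomial that shifts the weight has no diagonal: compare the `(c, c)` entries in `H M = M H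
    -- + (α_j - β_j) M`, where `H` is diagonal.
    · obtain ⟨j, hj⟩ := Function.ne_iff.1 hαβ
      refine ⟨0, fun hw V _ _ ρ ι B l h c => ?_⟩
      set M : invariants Q := ⟨xMon α * delMon β, hw⟩
      set H : invariants Q := ⟨Weyl.h j, h_mem_invariants Q j⟩ with hH
      have hcomm : H * M = M * H + ((α j : ℂ) - β j) • M :=
        Subtype.ext (h_mul_xMon_mul_delMon α β j)
      have hdiag : ∀ v c, B.repr (ρ H v) c = l c j * B.repr v c := by
        intro v c
        have : Finsupp.lapply c ∘ₗ B.repr.toLinearMap ∘ₗ ρ H =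
            l c j • (Finsupp.lapply c ∘ₗ B.repr.toLinearMap) := by
          refine B.ext fun c' => ?_
          by_cases hc : c' = c
          · subst hc; simp [hH, h]
          · simp [hH, h, hc]
        simpa using LinearMap.congr_fun this v
      have h1 := congrArg (fun T => B.repr (T (B c)) c) (congrArg ρ hcomm)
      simp only [map_mul, map_add, map_smul, Module.End.mul_apply, LinearMap.add_apply,
        LinearMap.smul_apply, hdiag, Finsupp.add_apply, Finsupp.smul_apply, smul_eq_mul] at h1
      rw [hH, h c j] at h1
      simp only [map_smul, Finsupp.smul_apply, smul_eq_mul, left_eq_add, mul_eq_zero,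
        sub_eq_zero, Nat.cast_inj, hj, false_or] at h1
      simpa using h1
  | zero =>
    refine ⟨0, fun hw V _ _ ρ ι B l h c => ?_⟩
    have : (⟨0, hw⟩ : invariants Q) = 0 := rfl
    simp [this]
  | add a b ha' hb' ha hb =>
    obtain ⟨p, hp⟩ := ha
    obtain ⟨q, hq⟩ := hb
    refine ⟨p + q, fun hw V _ _ ρ ι B l h c => ?_⟩
    have : (⟨a + b, hw⟩ : invariants Q) = ⟨a, neutral_le_invariants Q ha'⟩ +
      ⟨b, neutral_le_invariants Q hb'⟩ := rfl
    rw [this, map_add, LinearMap.add_apply, map_add, Finsupp.add_apply, hp _ V ρ ι B l h c,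
      hq _ V ρ ι B l h c, map_add]
  | smul r a ha' ha =>
    obtain ⟨p, hp⟩ := ha
    refine ⟨MvPolynomial.C r * p, fun hw V _ _ ρ ι B l h c => ?_⟩
    have : (⟨r • a, hw⟩ : invariants Q) = r • ⟨a, neutral_le_invariants Q ha'⟩ := rfl
    rw [this, map_smul, LinearMap.smul_apply, map_smul, Finsupp.smul_apply, hp _ V ρ ι B l h c,
      map_mul, MvPolynomial.eval_C, smul_eq_mul]

end Weyl

/-! ## Existence of Verma modules -/

section Coordinates

variable {n k d : ℕ} {Q : Matrix (Fin n) (Fin k) ℤ} {P : Matrix (Fin n) (Fin d) ℤ}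
  {I : Finset (Fin n)}

theorem sgn_eq_or {m : Fin n → ℝ} {i : I} (h : coordZ P I m i ≠ 0) :
    sgn P I m i = 1 ∨ sgn P I m i = -1 := by
  unfold sgn
  rcases lt_or_gt_of_ne h with h | h
  · right; simp [sign_neg h]
  · left; simp [sign_pos h]

/-- Up to sign this is the imaginary part of the weight of `h_j`, `j ∉ I`, on the Verma module;
through it genericity of `ζ` enters the existence proof. -/
theorem coordZ_compl (h : IsExactSequence Q P) (hI : IsLatticeBasis P I) (ζ : Fin n → ℝ)
    (j : (Iᶜ : Finset (Fin n))) :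
    coordZ Q Iᶜ ζ j = ζ j - ∑ i : I, (expansion P I j i : ℝ) * ζ i := by
  rw [coordZ, ← sum_subtype_add_sum_compl I]
  simp only [expansion_compl h hI, expansion_self (hI.compl h)]
  simp [mul_comm]
  abel

end Coordinates

/-! ### Weight modules of the Weyl algebra on `ℤ^n` -/

section WeightModule

variable {n : ℕ}

/-- The operator `e_a ↦ f(a_j) e_{a + δ ε_j}`. -/
def shiftOp (j : Fin n) (δ : ℤ) (f : ℤ → ℂ) : Module.End ℂ ((Fin n → ℤ) →₀ ℂ) :=
  Finsupp.lsum ℂ fun a => f (a j) • Finsupp.lsingle (a + Pi.single j δ)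

theorem shiftOp_single (j : Fin n) (δ : ℤ) (f : ℤ → ℂ) (a : Fin n → ℤ) (r : ℂ) :
    shiftOp j δ f (Finsupp.single a r) = Finsupp.single (a + Pi.single j δ) (f (a j) * r) := by
  simp [shiftOp]

theorem shiftOp_comm {i j : Fin n} (h : i ≠ j) (δ ε : ℤ) (f g : ℤ → ℂ) :
    shiftOp i δ f * shiftOp j ε g = shiftOp j ε g * shiftOp i δ f := by
  refine Finsupp.lhom_ext fun a r => ?_
  simp only [Module.End.mul_apply, shiftOp_single, Pi.add_apply, Pi.single_eq_of_ne h,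
    Pi.single_eq_of_ne h.symm, add_zero]
  rw [add_right_comm, mul_left_comm]

/-- The coefficient of `x_j` in the weight module. -/
def xCoeff (lam : Fin n → ℂ) (B : Fin n → Prop) (j : Fin n) (z : ℤ) : ℂ :=
  open Classical in if B j then lam j + z + 1 / 2 else 1

/-- The coefficient of `∂_j` in the weight module. -/
def delCoeff (lam : Fin n → ℂ) (B : Fin n → Prop) (j : Fin n) (z : ℤ) : ℂ :=
  open Classical in if B j then 1 else lam j + z - 1 / 2

/-- The weight module with basis `e_a`, `a ∈ ℤ^n`, on which `h_j` acts with eigenvalues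
`lam j + a j`. -/
def weightRep (lam : Fin n → ℂ) (B : Fin n → Prop) :
    Weyl n →ₐ[ℂ] Module.End ℂ ((Fin n → ℤ) →₀ ℂ) :=
  -- The relations fix the eigenvalue of `x_j ∂_j`, the product of the two coefficients along an
  -- edge. The predicate `B` decides whether `x_j` or `∂_j` carries it, hence which of them may kill
  -- a basis vector.
  Weyl.lift (fun j => shiftOp j 1 (xCoeff lam B j)) (fun j => shiftOp j (-1) (delCoeff lam B j))
    (fun i j => by
      by_cases h : i = j
      · rw [h]
      · exact shiftOp_comm h _ _ _ _)
    (fun i j => by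
      by_cases h : i = j
      · rw [h]
      · exact shiftOp_comm h _ _ _ _)
    (fun i j => by
      by_cases h : i = j
      · subst h
        refine Finsupp.lhom_ext fun a r => ?_
        simp only [Module.End.mul_apply, shiftOp_single, if_true, LinearMap.add_apply,
          Module.End.one_apply, add_assoc, ← Pi.single_add, Pi.add_apply, Pi.single_eq_same]
        simp only [add_neg_cancel, neg_add_cancel, Pi.single_zero, add_zero]
        rw [← Finsupp.single_add]
        congr 1
        unfold xCoeff delCoeff
        split_ifs <;> push_cast <;> ring
      · rw [if_neg h, add_zero]
        exact shiftOp_comm h _ _ _ _)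

variable (lam : Fin n → ℂ) (B : Fin n → Prop)

theorem weightRep_x (j : Fin n) (a : Fin n → ℤ) (r : ℂ) :
    weightRep lam B (Weyl.x j) (Finsupp.single a r) =
      Finsupp.single (a + Pi.single j 1) (xCoeff lam B j (a j) * r) := by
  rw [weightRep, Weyl.lift_x, shiftOp_single]

theorem weightRep_del (j : Fin n) (a : Fin n → ℤ) (r : ℂ) :
    weightRep lam B (Weyl.del j) (Finsupp.single a r) =
      Finsupp.single (a + Pi.single j (-1)) (delCoeff lam B j (a j) * r) := by
  rw [weightRep, Weyl.lift_del, shiftOp_single]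

theorem weightRep_h (j : Fin n) (a : Fin n → ℤ) :
    weightRep lam B (Weyl.h j) (Finsupp.single a 1) = (lam j + a j) • Finsupp.single a 1 := by
  rw [Weyl.h, map_add, map_mul, LinearMap.add_apply, Module.End.mul_apply, weightRep_del,
    weightRep_x, add_assoc, ← Pi.single_add, AlgHom.commutes, Module.algebraMap_end_apply]
  simp only [Pi.add_apply, Pi.single_eq_same, Finsupp.smul_single, smul_eq_mul]
  simp only [neg_add_cancel, Pi.single_zero, add_zero]
  rw [← Finsupp.single_add]
  congr 1
  unfold xCoeff delCoeff
  split_ifs <;> push_cast <;> ring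

theorem weightRep_muHat (ζ : Fin n → ℝ) (β : Fin n → ℂ) (a : Fin n → ℤ) :
    weightRep lam B (muHat ζ β) (Finsupp.single a 1) =
      (∑ j, β j * (lam j + a j + Complex.I * ζ j)) • Finsupp.single a 1 := by
  rw [muHat, map_sum, LinearMap.sum_apply, Finset.sum_smul]
  refine Finset.sum_congr rfl fun j _ => ?_
  rw [map_smul, LinearMap.smul_apply, map_add, LinearMap.add_apply, weightRep_h, AlgHom.commutes,
    Module.algebraMap_end_apply, ← add_smul, smul_smul]

theorem weightRep_xMon (α : Fin n → ℕ) (a : Fin n → ℤ) (r : ℂ) :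
    ∃ r', weightRep lam B (xMon α) (Finsupp.single a r) =
      Finsupp.single (a + fun j => (α j : ℤ)) r' ∧ ((∀ j, B j → α j = 0) → r' = r) := by
  induction α using pi_nat_induction with
  | zero => exact ⟨r, by simp [show (fun _ : Fin n => (0 : ℤ)) = 0 from rfl], fun _ => rfl⟩
  | succ α j ih =>
    obtain ⟨r', hr', h⟩ := ih
    refine ⟨xCoeff lam B j ((a + fun j => (α j : ℤ)) j) * r', ?_, fun hB => ?_⟩
    · rw [xMon_add_single, map_mul, Module.End.mul_apply, hr', weightRep_x]
      congr 1
      ext i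
      by_cases hij : i = j
      · subst hij; simp [add_assoc]
      · simp [hij]
    · rw [h fun i hi => by have := hB i hi; simp at this; exact this.1, xCoeff, if_neg, one_mul]
      intro hj
      have := hB j hj
      simp at this

theorem weightRep_delMon (β : Fin n → ℕ) (a : Fin n → ℤ) (r : ℂ) :
    ∃ r', weightRep lam B (delMon β) (Finsupp.single a r) =
      Finsupp.single (a - fun j => (β j : ℤ)) r' ∧
      ((∀ j, ¬ B j → β j ≠ 0 → (lam j).im ≠ 0) → r ≠ 0 → r' ≠ 0) := by
  induction β using pi_nat_induction with
  | zero => exact ⟨r, by simp [show (fun _ : Fin n => (0 : ℤ)) = 0 from rfl], fun _ h => h⟩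
  | succ β j ih =>
    obtain ⟨r', hr', h⟩ := ih
    refine ⟨delCoeff lam B j ((a - fun j => (β j : ℤ)) j) * r', ?_, fun hB hr => mul_ne_zero ?_ ?_⟩
    · rw [delMon_add_single, map_mul, Module.End.mul_apply, hr', weightRep_del]
      congr 1
      ext i
      by_cases hij : i = j
      · subst hij; simp; ring
      · simp [hij]
    · unfold delCoeff
      split_ifs with hj
      · exact one_ne_zero
      · have := hB j hj (by simp)
        intro h0
        have := congrArg Complex.im h0
        simp at this
        contradiction
    · exact h (fun i hi hβ => hB i hi (by simp; omega)) hr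

/-- The nonvanishing clause serves cyclicity: `x_j` is used only where its coefficient is `1`, and
`∂_j` acts either by `1` or by a coefficient with the nonzero imaginary part of `lam j`. -/
theorem weightRep_mon (p : (Fin n → ℕ) × (Fin n → ℕ)) (a : Fin n → ℤ) (r : ℂ) :
    ∃ r', weightRep lam B (xMon p.1 * delMon p.2) (Finsupp.single a r) =
      Finsupp.single (a + fun j => (p.1 j : ℤ) - p.2 j) r' ∧
      ((∀ j, B j → p.1 j = 0) → (∀ j, ¬ B j → p.2 j ≠ 0 → (lam j).im ≠ 0) → r ≠ 0 → r' ≠ 0) := by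
  obtain ⟨r₁, h₁, h₁'⟩ := weightRep_delMon lam B p.2 a r
  obtain ⟨r₂, h₂, h₂'⟩ := weightRep_xMon lam B p.1 (a - fun j => (p.2 j : ℤ)) r₁
  refine ⟨r₂, ?_, fun hx hd hr => ?_⟩
  · rw [map_mul, Module.End.mul_apply, h₁, h₂]
    congr 1
    ext j
    simp only [Pi.add_apply, Pi.sub_apply]
    ring
  · rw [h₂' hx]; exact h₁' hd hr

variable {k : ℕ} (Q : Matrix (Fin n) (Fin k) ℤ)

theorem weightRep_mem_supported_ker {w : Weyl n} (hw : w ∈ invariants Q)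
    {a : Fin n → ℤ} (ha : Qᵀ *ᵥ a = 0) :
    weightRep lam B w (Finsupp.single a 1) ∈ Finsupp.supported ℂ ℂ {b | Qᵀ *ᵥ b = 0} := by
  have hn := invariants_le_neutral Q hw
  clear hw
  induction hn using Submodule.span_induction with
  | mem w hw =>
    obtain ⟨p, hp, rfl⟩ := hw
    obtain ⟨r', h, -⟩ := weightRep_mon lam B p a 1
    simp only [h]
    refine Finsupp.single_mem_supported ℂ _ ?_
    rw [Set.mem_ofPred_eq, Matrix.mulVec_add, ha, zero_add]
    exact hp
  | zero => simp
  | add x y _ _ hx hy => rw [map_add]; exact Submodule.add_mem _ hx hy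
  | smul c x _ hx => rw [map_smul]; exact Submodule.smul_mem _ _ hx

/-- A set of weights spans a submodule as soon as each arrow of a generator leaving the set has
coefficient zero. -/
theorem weightRep_mem_supported {S : Set (Fin n → ℤ)}
    (hx : ∀ j, ∀ a ∈ S, xCoeff lam B j (a j) = 0 ∨ a + Pi.single j 1 ∈ S)
    (hd : ∀ j, ∀ a ∈ S, delCoeff lam B j (a j) = 0 ∨ a + Pi.single j (-1) ∈ S)
    (w : Weyl n) {v : (Fin n → ℤ) →₀ ℂ} (hv : v ∈ Finsupp.supported ℂ ℂ S) :
    weightRep lam B w v ∈ Finsupp.supported ℂ ℂ S := by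
  have key : ∀ (T : Module.End ℂ ((Fin n → ℤ) →₀ ℂ)),
      (∀ a ∈ S, T (Finsupp.single a 1) ∈ Finsupp.supported ℂ ℂ S) →
      ∀ v ∈ Finsupp.supported ℂ ℂ S, T v ∈ Finsupp.supported ℂ ℂ S := by
    intro T hT v hv
    rw [Finsupp.supported_eq_span_single] at hv
    induction hv using Submodule.span_induction with
    | mem v hv => obtain ⟨a, ha, rfl⟩ := hv; exact hT a ha
    | zero => simp
    | add x y _ _ hx hy => rw [map_add]; exact Submodule.add_mem _ hx hy
    | smul c x _ hx => rw [map_smul]; exact Submodule.smul_mem _ _ hx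
  let U : Submodule ℂ (Weyl n) :=
    { carrier := {w | ∀ v ∈ Finsupp.supported ℂ ℂ S, weightRep lam B w v ∈ Finsupp.supported ℂ ℂ S}
      add_mem' := fun {a b} ha hb v hv => by
        rw [map_add]; exact Submodule.add_mem _ (ha v hv) (hb v hv)
      zero_mem' := fun v hv => by simp
      smul_mem' := fun c a ha v hv => by
        rw [map_smul]; exact Submodule.smul_mem _ _ (ha v hv) }
  refine Weyl.induction (U := U) (fun v hv => by simpa using hv) ?_ ?_ w v hv
  · intro j w hw v hv
    rw [map_mul, Module.End.mul_apply]
    refine key _ (fun a ha => ?_) _ (hw v hv)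
    rw [weightRep_x]
    rcases hx j a ha with h | h
    · simp [h]
    · exact Finsupp.single_mem_supported ℂ _ h
  · intro j w hw v hv
    rw [map_mul, Module.End.mul_apply]
    refine key _ (fun a ha => ?_) _ (hw v hv)
    rw [weightRep_del]
    rcases hd j a ha with h | h
    · simp [h]
    · exact Finsupp.single_mem_supported ℂ _ h

/-- On `e_b` the generator for column `a` acts by `Σ_j Q_{ja}(lam_j + iζ_j) + Σ_j Q_{ja} b_j`, and
both sums vanish. A left ideal kills whatever its generators kill. -/
theorem weightRep_eq_zero {ζ : Fin n → ℝ}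
    (hlam : ∀ a, ∑ j, (Q j a : ℂ) * (lam j + Complex.I * ζ j) = 0) {w : Weyl n}
    (hw : w ∈ momentIdeal Q ζ) {b : Fin n → ℤ} (hb : Qᵀ *ᵥ b = 0) :
    weightRep lam B w (Finsupp.single b 1) = 0 := by
  induction hw using Submodule.span_induction with
  | mem w hw =>
    obtain ⟨a, rfl⟩ := hw
    have h1 : ∑ j, (Q j a : ℂ) * (b j : ℂ) = 0 := by
      have := congrFun hb a
      simp only [Matrix.mulVec, dotProduct, Matrix.transpose_apply, Pi.zero_apply] at this
      exact_mod_cast this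
    simp only [weightRep_muHat]
    have h2 : ∑ j, (Q j a : ℂ) * (lam j + b j + Complex.I * ζ j) = 0 := by
      rw [← add_zero (0 : ℂ)]
      nth_rewrite 1 [← hlam a]
      rw [← h1, ← Finset.sum_add_distrib]
      exact Finset.sum_congr rfl fun j _ => by ring
    rw [h2, zero_smul]
  | zero => simp
  | add x y _ _ hx hy => rw [map_add, LinearMap.add_apply, hx, hy, add_zero]
  | smul c x _ hx => rw [smul_eq_mul, map_mul, Module.End.mul_apply, hx, map_zero]

end WeightModule

/-! ### Verma modules inside weight modules -/

section VermaExistence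

variable {n k : ℕ} {Q : Matrix (Fin n) (Fin k) ℤ}

/-- A set of weights stable under the gauge invariant operators gives a module over the quantum
Higgs branch. -/
def higgsRep {κ : Type} (ζ : Fin n → ℝ) (lam : Fin n → ℂ) (B : Fin n → Prop)
    (e : κ → Fin n → ℤ) (he : Function.Injective e) (hker : ∀ c, Qᵀ *ᵥ e c = 0)
    (hlam : ∀ a, ∑ j, (Q j a : ℂ) * (lam j + Complex.I * ζ j) = 0)
    (hstab : ∀ w ∈ invariants Q, ∀ c, weightRep lam B w (Finsupp.single (e c) 1) ∈
      Finsupp.supported ℂ ℂ (Set.range e)) :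
    AHiggs Q ζ →ₐ[ℂ] Module.End ℂ (κ →₀ ℂ) :=
  RingQuot.liftAlgHom ℂ ⟨AlgHom.ofLinearMap
    { toFun := fun w => Finsupp.lcomapDomain e he ∘ₗ weightRep lam B w ∘ₗ Finsupp.lmapDomain ℂ ℂ e
      map_add' := fun a b => by
        rw [Subalgebra.coe_add, map_add, LinearMap.add_comp, LinearMap.comp_add]
      map_smul' := fun c a => by
        rw [Subalgebra.coe_smul, map_smul, LinearMap.smul_comp, LinearMap.comp_smul]; rfl }
    (by
      refine Finsupp.lhom_ext fun c r => ?_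
      simp [Finsupp.lcomapDomain, Finsupp.comapDomain_single])
    (fun x y => by
      refine Finsupp.lhom_ext' fun c => LinearMap.ext_ring ?_
      simp only [LinearMap.coe_mk, AddHom.coe_mk, LinearMap.comp_apply, Module.End.mul_apply,
        Finsupp.lsingle_apply, Finsupp.lmapDomain_apply, Finsupp.mapDomain_single,
        Subalgebra.coe_mul, map_mul, Finsupp.lcomapDomain, AddHom.coe_mk, LinearMap.coe_mk]
      -- Multiplicativity: restricting to the weights `e c` and extending back loses nothing, since
      -- `y e_c` is supported on them.
      rw [Finsupp.mapDomain_comapDomain _ he _ (by simpa [Finsupp.mem_supported] using hstab y y.2 c)]),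
    fun {a b} hab => by
      refine Finsupp.lhom_ext' fun c => LinearMap.ext_ring ?_
      have := weightRep_eq_zero lam B Q hlam hab (hker c)
      rw [map_sub, LinearMap.sub_apply, sub_eq_zero] at this
      simp [this]⟩

theorem higgsRep_toHiggs {κ : Type} {ζ : Fin n → ℝ} {lam : Fin n → ℂ} {B : Fin n → Prop}
    {e : κ → Fin n → ℤ} {he : Function.Injective e} {hker : ∀ c, Qᵀ *ᵥ e c = 0}
    {hlam : ∀ a, ∑ j, (Q j a : ℂ) * (lam j + Complex.I * ζ j) = 0}
    {hstab : ∀ w ∈ invariants Q, ∀ c, weightRep lam B w (Finsupp.single (e c) 1) ∈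
      Finsupp.supported ℂ ℂ (Set.range e)} (w : invariants Q) {c c' : κ} {r : ℂ}
    (h : weightRep lam B w (Finsupp.single (e c) 1) = Finsupp.single (e c') r) :
    higgsRep ζ lam B e he hker hlam hstab (toHiggs Q ζ w) (Finsupp.single c 1) =
      Finsupp.single c' r := by
  simp [higgsRep, toHiggs, Finsupp.lcomapDomain, h, Finsupp.comapDomain_single]

variable {d : ℕ} {P : Matrix (Fin n) (Fin d) ℤ} {I : Finset (Fin n)}

/-- The weight `Σ_i R_{s i} (−σ_i / 2 + i ζ_i) − i ζ_s` of `h_s` on the highest weight vector. -/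
def vermaWeight (P : Matrix (Fin n) (Fin d) ℤ) (m ζ : Fin n → ℝ) (I : Finset (Fin n))
    (s : Fin n) : ℂ :=
  ∑ i : I, (expansion P I s i : ℂ) * (-(sgn P I m i : ℂ) / 2 + Complex.I * ζ i) - Complex.I * ζ s

/-- After adding `iζ` the weight is a combination of the columns of `R_I`, and `Qᵀ` kills these. -/
theorem sum_mul_vermaWeight (h : IsExactSequence Q P) (hI : IsLatticeBasis P I) (m ζ : Fin n → ℝ)
    (a : Fin k) : ∑ j, (Q j a : ℂ) * (vermaWeight P m ζ I j + Complex.I * ζ j) = 0 := by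
  simp only [vermaWeight, sub_add_cancel, Finset.mul_sum]
  rw [Finset.sum_comm]
  refine Finset.sum_eq_zero fun i _ => ?_
  have h1 := congrFun (transpose_mulVec_expansion h hI (Pi.single i 1)) a
  simp only [Pi.single_apply, mul_ite, mul_one, mul_zero, Finset.sum_ite_eq', Finset.mem_univ,
    if_true, Matrix.mulVec, dotProduct, Matrix.transpose_apply, Pi.zero_apply] at h1
  simp only [← mul_assoc, ← Finset.sum_mul]
  have h2 : ∑ j, (Q j a : ℂ) * (expansion P I j i : ℂ) = 0 := by exact_mod_cast h1
  rw [h2, zero_mul]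

theorem vermaWeight_of_mem (hI : IsLatticeBasis P I) (m ζ : Fin n → ℝ) (i : I) :
    vermaWeight P m ζ I i = -(sgn P I m i : ℂ) / 2 := by
  simp [vermaWeight, expansion_self hI]

theorem exists_vermaModule (h : IsExactSequence Q P) (hI : IsLatticeBasis P I) {m ζ : Fin n → ℝ}
    (hm : ∀ i : I, coordZ P I m i ≠ 0) (hζ : ∀ j : (Iᶜ : Finset (Fin n)), coordZ Q Iᶜ ζ j ≠ 0) :
    Nonempty (VermaModule Q P m ζ I) := by
  set lam := vermaWeight P m ζ I with hlam
  -- If `σ_I(i) = 1`, the eigenvalues of `h_i` descend from `-1/2` and `x_i` has to kill the top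
  -- vector; if `σ_I(i) = -1`, they ascend from `1/2` and `∂_i` has to kill the bottom one. Off `I`
  -- nothing may be killed.
  set B : Fin n → Prop := fun j => ∃ hj : j ∈ I, sgn P I m ⟨j, hj⟩ = 1 with hB
  set e : (I → ℕ) → Fin n → ℤ := fun c s => ∑ i : I, expansion P I s i * (-sgn P I m i * c i)
    with he
  have heI : ∀ c (i : I), e c i = -sgn P I m i * c i := fun c i => by
    simp [he, expansion_self hI]
  have hsq : ∀ i : I, sgn P I m i * sgn P I m i = 1 := fun i => by
    rcases sgn_eq_or (hm i) with h | h <;> simp [h]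
  have hinj : Function.Injective e := by
    intro c c' hcc
    ext i
    have h1 := congrFun hcc i
    rw [heI, heI] at h1
    rcases sgn_eq_or (hm i) with h | h <;> rw [h] at h1 <;> omega
  have hker : ∀ c, Qᵀ *ᵥ e c = 0 := fun c => transpose_mulVec_expansion h hI _
  -- The weights `e c` are the intersection of the cone `S` with the kernel of `Qᵀ`. Gauge
  -- invariance preserves the kernel; the vanishing coefficients on the walls preserve the cone.
  set S : Set (Fin n → ℤ) := {b | ∀ i : I, sgn P I m i * b i ≤ 0} with hS
  have hrange : {b | Qᵀ *ᵥ b = 0} ∩ S ⊆ Set.range e := by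
    rintro b ⟨hb, hbS⟩
    refine ⟨fun i => (-sgn P I m i * b i).toNat, ?_⟩
    ext s
    rw [eq_expansion_of_mem_ker h hI hb s]
    refine Finset.sum_congr rfl fun i _ => ?_
    rw [Int.toNat_of_nonneg (by have := hbS i; linarith)]
    congr 1
    linear_combination (b i) * hsq i
  have heS : ∀ c, e c ∈ S := fun c i => by
    rw [heI, ← mul_assoc, mul_neg, hsq]
    simp
  have hstab : ∀ w ∈ invariants Q, ∀ c, weightRep lam B w (Finsupp.single (e c) 1) ∈
      Finsupp.supported ℂ ℂ (Set.range e) := by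
    intro w hw c
    refine Finsupp.supported_mono hrange ?_
    rw [Finsupp.supported_inter]
    refine ⟨weightRep_mem_supported_ker lam B Q hw (hker c),
      weightRep_mem_supported lam B ?_ ?_ w (Finsupp.single_mem_supported ℂ _ (heS c))⟩
    · intro j a ha
      by_cases hj : j ∈ I
      · have h0 := ha ⟨j, hj⟩
        by_cases hs : sgn P I m ⟨j, hj⟩ = 1
        · by_cases ha0 : a j = 0
          · left
            rw [xCoeff, if_pos ⟨hj, hs⟩, hlam, vermaWeight_of_mem hI m ζ ⟨j, hj⟩, hs, ha0]
            norm_num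
          · right
            intro i
            by_cases hij : (i : Fin n) = j
            · have : i = ⟨j, hj⟩ := Subtype.ext hij
              subst this
              rw [hs] at h0 ⊢
              simp only [Pi.add_apply, Pi.single_eq_same] at h0 ⊢
              omega
            · simpa [hij] using ha i
        · right
          intro i
          by_cases hij : (i : Fin n) = j
          · have : i = ⟨j, hj⟩ := Subtype.ext hij
            subst this
            rw [(sgn_eq_or (hm _)).resolve_left hs] at h0 ⊢
            simp only [Pi.add_apply, Pi.single_eq_same] at h0 ⊢
            omega
          · simpa [hij] using ha i
      · right
        intro i
        have hij : (i : Fin n) ≠ j := fun h => hj (h ▸ i.2)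
        simpa [hij] using ha i
    · intro j a ha
      by_cases hj : j ∈ I
      · have h0 := ha ⟨j, hj⟩
        by_cases hs : sgn P I m ⟨j, hj⟩ = 1
        · right
          intro i
          by_cases hij : (i : Fin n) = j
          · have : i = ⟨j, hj⟩ := Subtype.ext hij
            subst this
            rw [hs] at h0 ⊢
            simp only [Pi.add_apply, Pi.single_eq_same] at h0 ⊢
            omega
          · simpa [hij] using ha i
        · by_cases ha0 : a j = 0
          · left
            rw [delCoeff, if_neg (fun h => hs h.2), hlam, vermaWeight_of_mem hI m ζ ⟨j, hj⟩,
              (sgn_eq_or (hm _)).resolve_left hs, ha0]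
            norm_num
          · right
            intro i
            by_cases hij : (i : Fin n) = j
            · have : i = ⟨j, hj⟩ := Subtype.ext hij
              subst this
              rw [(sgn_eq_or (hm _)).resolve_left hs] at h0 ⊢
              simp only [Pi.add_apply, Pi.single_eq_same] at h0 ⊢
              omega
            · simpa [hij] using ha i
      · right
        intro i
        have hij : (i : Fin n) ≠ j := fun h => hj (h ▸ i.2)
        simpa [hij] using ha i
  set φ := higgsRep ζ lam B e hinj hker (sum_mul_vermaWeight h hI m ζ) hstab with hφ
  let _ : Module (AHiggs Q ζ) ((I → ℕ) →₀ ℂ) := Module.compHom _ φ.toRingHom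
  have hsmul : ∀ (a : AHiggs Q ζ) (v : (I → ℕ) →₀ ℂ), a • v = φ a v := fun a v => rfl
  have : IsScalarTower ℂ (AHiggs Q ζ) ((I → ℕ) →₀ ℂ) := ⟨fun r a v => by
    rw [hsmul, hsmul, map_smul]; rfl⟩
  refine ⟨{ carrier := (I → ℕ) →₀ ℂ, basis := Finsupp.basisSingleOne, eigen := ?_, cyclic := ?_ }⟩
  · intro c i
    rw [hsmul, Finsupp.coe_basisSingleOne, higgsH, hφ, higgsRep_toHiggs (c' := c)
      (r := lam i + e c i) _ (by rw [weightRep_h, Finsupp.smul_single, smul_eq_mul, mul_one]),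
      Finsupp.smul_single, smul_eq_mul, mul_one, hlam, vermaWeight_of_mem hI, heI]
    congr 1
    push_cast
    ring
  · have hsingle : ∀ c, Finsupp.single c (1 : ℂ) ∈
        Submodule.span (AHiggs Q ζ) {(Finsupp.single 0 1 : (I → ℕ) →₀ ℂ)} := by
      intro c
      -- With `a = e c`, the monomial `x^{a⁺} ∂^{a⁻}` leads from `e_0` to `e_a`. For each `j` it
      -- uses only one of `x_j`, `∂_j`, and for `j ∈ I` the one pointing away from the wall.
      set p : (Fin n → ℕ) × (Fin n → ℕ) := (fun j => (e c j).toNat, fun j => (-e c j).toNat)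
      have hpe : (fun j => (p.1 j : ℤ) - p.2 j) = e c := by
        ext j
        simp only [p]
        omega
      have he0 : e 0 = 0 := by ext s; simp [he]
      obtain ⟨r, hr, hr'⟩ := weightRep_mon lam B p (e 0) 1
      have hr0 : r ≠ 0 := by
        refine hr' ?_ ?_ one_ne_zero
        · rintro j ⟨hj, hs⟩
          have := heS c ⟨j, hj⟩
          rw [hs] at this
          simp only [p] at this ⊢
          omega
        · intro j hj hp
          have hjI : j ∉ I := by
            intro hjI
            have hs := (sgn_eq_or (hm ⟨j, hjI⟩)).resolve_left (fun hs => hj ⟨hjI, hs⟩)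
            have := heS c ⟨j, hjI⟩
            rw [hs] at this
            simp only [p] at this hp
            omega
          -- Here `Im lam_j = -z^!_j`, which is nonzero by genericity.
          have h1 := hζ ⟨j, by simpa using hjI⟩
          rw [coordZ_compl h hI] at h1
          rw [hlam, vermaWeight]
          intro h2
          apply h1
          simp [Complex.im_sum, Complex.mul_im, -Complex.ofReal_intCast,
            ← Complex.ofReal_intCast] at h2
          rw [Finset.univ_eq_attach]
          simp only
          linarith
      rw [hpe, he0, zero_add, ← he0] at hr
      have hmem : xMon p.1 * delMon p.2 ∈ invariants Q :=
        neutral_le_invariants Q (Submodule.subset_span ⟨p, by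
          show monCharge Q p = 0
          rw [monCharge, hpe]; exact hker c, rfl⟩)
      have h1 := higgsRep_toHiggs (he := hinj) (hker := hker)
        (hlam := sum_mul_vermaWeight h hI m ζ) (hstab := hstab) ⟨_, hmem⟩ hr
      refine Submodule.mem_span_singleton.2 ⟨r⁻¹ • toHiggs Q ζ ⟨_, hmem⟩, ?_⟩
      rw [smul_assoc, hsmul, h1, Finsupp.smul_single, smul_eq_mul, inv_mul_cancel₀ hr0]
    rw [eq_top_iff, Finsupp.coe_basisSingleOne]
    intro v _
    induction v using Finsupp.induction_linear with
    | zero => exact Submodule.zero_mem _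
    | add x y hx hy => exact Submodule.add_mem _ (hx trivial) (hy trivial)
    | single c r =>
      have : Finsupp.single c r = algebraMap ℂ (AHiggs Q ζ) r • Finsupp.single c (1 : ℂ) := by
        rw [algebraMap_smul, Finsupp.smul_single, smul_eq_mul, mul_one]
      rw [this]
      exact Submodule.smul_mem _ _ (hsingle c)

end VermaExistence

/-! ## Integrals over the contour -/

section Contour

open MeasureTheory

variable {n k : ℕ} {Q : Matrix (Fin n) (Fin k) ℤ} {J : Finset (Fin n)}

/-- The function `e^{2παx} / (1 + e^{2πx})`. -/
def phi (α : ℂ) (x : ℝ) : ℂ :=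
  Complex.exp (2 * Real.pi * α * x) / (1 + Complex.exp (2 * Real.pi * x))

theorem one_add_exp_ne_zero (x : ℝ) : 1 + Complex.exp (2 * Real.pi * x) ≠ 0 := by
  have h : (1 + Complex.exp (2 * Real.pi * x) : ℂ) = ((1 + Real.exp (2 * Real.pi * x) : ℝ) : ℂ) := by
    push_cast; rfl
  rw [h]
  exact_mod_cast (by positivity : (0 : ℝ) < 1 + Real.exp (2 * Real.pi * x)).ne'

theorem continuous_phi : Continuous fun p : ℂ × ℝ => phi p.1 p.2 := by
  unfold phi
  refine Continuous.div (by fun_prop) (by fun_prop) fun p => one_add_exp_ne_zero _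

theorem continuous_phi_right (α : ℂ) : Continuous (phi α) :=
  continuous_phi.comp (continuous_const.prodMk continuous_id)

theorem norm_phi_le {r : ℝ} {α : ℂ} (h0 : r ≤ α.re) (h1 : α.re ≤ 1 - r) (x : ℝ) :
    ‖phi α x‖ ≤ Real.exp (-(2 * Real.pi * r) * |x|) := by
  have hden : ‖1 + Complex.exp (2 * Real.pi * x)‖ = 1 + Real.exp (2 * Real.pi * x) := by
    have h : (1 + Complex.exp (2 * Real.pi * x) : ℂ) =
      ((1 + Real.exp (2 * Real.pi * x) : ℝ) : ℂ) := by push_cast; rfl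
    rw [h, Complex.norm_real, Real.norm_of_nonneg (by positivity)]
  have hnum : ‖Complex.exp (2 * Real.pi * α * x)‖ = Real.exp (2 * Real.pi * α.re * x) := by
    rw [Complex.norm_exp]
    congr 1
    simp
  rw [phi, norm_div, hden, hnum, div_le_iff₀ (by positivity), mul_add, mul_one, ← Real.exp_add]
  have hpi := Real.pi_pos
  rcases le_total 0 x with hx | hx
  · rw [abs_of_nonneg hx]
    refine le_trans (Real.exp_le_exp.2 ?_) (le_add_of_nonneg_left (Real.exp_pos _).le)
    nlinarith [mul_nonneg hpi.le hx]
  · rw [abs_of_nonpos hx]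
    refine le_trans (Real.exp_le_exp.2 ?_) (le_add_of_nonneg_right (Real.exp_pos _).le)
    nlinarith [mul_nonneg hpi.le (neg_nonneg.2 hx)]

/-- The substitution `y = e^{2πx} / (1 + e^{2πx})` maps `ℝ` onto `(0, 1)` and turns the integral
into `B(α, 1 - α) / (2π)`; the reflection formula gives the sine. -/
theorem integral_phi {α : ℂ} (h0 : 0 < α.re) (h1 : α.re < 1) :
    ∫ x, phi α x = (2 * Complex.sin (Real.pi * α))⁻¹ := by
  set f : ℝ → ℝ := fun x => Real.exp (2 * Real.pi * x) / (1 + Real.exp (2 * Real.pi * x)) with hf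
  set f' : ℝ → ℝ := fun x => 2 * Real.pi * Real.exp (2 * Real.pi * x) /
    (1 + Real.exp (2 * Real.pi * x)) ^ 2 with hf'
  have hpos : ∀ x : ℝ, 0 < 1 + Real.exp (2 * Real.pi * x) := fun x => by positivity
  have hderiv : ∀ x, HasDerivAt f (f' x) x := by
    intro x
    have he : HasDerivAt (fun x : ℝ => Real.exp (2 * Real.pi * x))
        (Real.exp (2 * Real.pi * x) * (2 * Real.pi)) x := by
      simpa using ((hasDerivAt_id x).const_mul (2 * Real.pi)).exp
    refine (he.div (he.const_add 1) (hpos x).ne').congr_deriv ?_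
    simp only [hf']
    congr 1
    ring
  have h1f : ∀ x, 1 - f x = (1 + Real.exp (2 * Real.pi * x))⁻¹ := fun x => by
    have := (hpos x).ne'
    simp only [hf]
    field_simp
    ring
  have hinj : Set.InjOn f Set.univ := by
    intro x _ y _ hxy
    have : (1 + Real.exp (2 * Real.pi * x))⁻¹ = (1 + Real.exp (2 * Real.pi * y))⁻¹ := by
      rw [← h1f, ← h1f, hxy]
    have := Real.exp_injective (add_left_cancel (inv_injective this))
    exact mul_left_cancel₀ (by positivity) this
  have himage : f '' Set.univ = Set.Ioo 0 1 := by
    ext y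
    constructor
    · rintro ⟨x, -, rfl⟩
      refine ⟨by simp only [hf]; have := hpos x; positivity, ?_⟩
      have : 0 < 1 - f x := by rw [h1f]; exact inv_pos.2 (hpos x)
      linarith
    · rintro ⟨hy0, hy1⟩
      refine ⟨Real.log (y / (1 - y)) / (2 * Real.pi), trivial, ?_⟩
      have hy : 0 < 1 - y := by linarith
      have hexp : Real.exp (2 * Real.pi * (Real.log (y / (1 - y)) / (2 * Real.pi))) = y / (1 - y) := by
        rw [mul_div_cancel₀ _ (by positivity), Real.exp_log (by positivity)]
      simp only [hf, hexp]
      field_simp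
      ring
  have hbeta : Complex.betaIntegral α (1 - α) = Real.pi / Complex.sin (Real.pi * α) := by
    rw [← Complex.Gamma_mul_Gamma_one_sub, Complex.Gamma_mul_Gamma_eq_betaIntegral h0 (by
      rw [Complex.sub_re, Complex.one_re]; linarith)]
    simp
  have hcv := integral_image_eq_integral_abs_deriv_smul MeasurableSet.univ
    (fun x _ => (hderiv x).hasDerivWithinAt) hinj
    (fun x : ℝ => (x : ℂ) ^ (α - 1) * (1 - (x : ℂ)) ^ (1 - α - 1))
  rw [himage, ← integral_Ioc_eq_integral_Ioo, ← intervalIntegral.integral_of_le zero_le_one] at hcv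
  have hbeta' : (∫ x in (0 : ℝ)..1, (x : ℂ) ^ (α - 1) * (1 - (x : ℂ)) ^ (1 - α - 1)) =
    Complex.betaIntegral α (1 - α) := rfl
  rw [hbeta', hbeta, Measure.restrict_univ] at hcv
  have hint : ∀ x, |f' x| • ((f x : ℂ) ^ (α - 1) * (1 - (f x : ℂ)) ^ (1 - α - 1)) =
      (2 * Real.pi : ℂ) * phi α x := by
    intro x
    have hp := hpos x
    -- With `L = log(1 + e^{2πx})` both `f x` and `1 - f x` are real exponentials, so the complex
    -- powers become exponentials.
    set L := Real.log (1 + Real.exp (2 * Real.pi * x))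
    have hL : Real.exp L = 1 + Real.exp (2 * Real.pi * x) := Real.exp_log hp
    have hfx : f x = Real.exp (2 * Real.pi * x - L) := by
      rw [Real.exp_sub, hL]
    have h1fx : 1 - f x = Real.exp (-L) := by
      rw [h1f, Real.exp_neg, hL]
    have hf'x : |f' x| = 2 * Real.pi * Real.exp (2 * Real.pi * x - L - L) := by
      rw [abs_of_pos (by simp only [hf']; positivity)]
      simp only [hf']
      rw [Real.exp_sub, Real.exp_sub, hL]
      field_simp
    have hcpow : ∀ (y : ℝ) (c : ℂ), ((Real.exp y : ℝ) : ℂ) ^ c = Complex.exp (y * c) := by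
      intro y c
      rw [Complex.cpow_def_of_ne_zero (by exact_mod_cast (Real.exp_pos y).ne'),
        ← Complex.ofReal_log (Real.exp_pos y).le, Real.log_exp]
    have h1fc : (1 : ℂ) - (f x : ℂ) = ((1 - f x : ℝ) : ℂ) := by push_cast; rfl
    have hphi : phi α x = Complex.exp (2 * Real.pi * α * x) * Complex.exp (-L) := by
      rw [phi, Complex.exp_neg, ← Complex.ofReal_exp, hL]
      push_cast
      rfl
    rw [h1fc, h1fx, hfx, hf'x, hcpow, hcpow, hphi, Complex.real_smul]
    push_cast
    rw [mul_assoc, ← Complex.exp_add, ← Complex.exp_add, ← Complex.exp_add]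
    congr 2
    ring
  simp only [hint] at hcv
  rw [integral_const_mul] at hcv
  have hpi : (Real.pi : ℂ) ≠ 0 := by exact_mod_cast Real.pi_pos.ne'
  have h2 : (2 * Real.pi : ℂ) ≠ 0 := by simp
  refine mul_left_cancel₀ h2 (hcv.symm.trans ?_)
  rw [mul_inv]
  field_simp

/-- The rows of `Q` in `J` form an integer matrix with integer inverse, of determinant `±1`. The map
is this matrix followed by a translation, so no Jacobian appears. -/
theorem measurePreserving_contourPoint (hJ : IsLatticeBasis Q J) (m : Fin n → ℝ) :
    MeasurePreserving fun (t : Fin k → ℝ) (j : J) => contourPoint Q m t j := by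
  let e : Fin k ≃ J := (Fintype.equivFinOfCardEq (by simp [hJ.card_eq])).symm
  let M : Matrix (Fin k) (Fin k) ℤ := Matrix.of fun a b => Q (e a) b
  choose v hv using fun a : Fin k => exists_dual hJ (Pi.single (e a) 1)
  have hMN : M * (Matrix.of fun b a => v a b) = 1 := by
    ext a a'
    have := hv a' (e a)
    simp only [expansion_self hJ, Pi.single_apply, ite_mul, one_mul, zero_mul,
      Finset.sum_ite_eq, Finset.mem_univ, if_true, EmbeddingLike.apply_eq_iff_eq] at this
    rw [Matrix.one_apply, ← this]
    simp [Matrix.mul_apply, M, Matrix.mulVec, dotProduct]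
  have hdetZ : IsUnit M.det := by
    have := congrArg Matrix.det hMN
    rw [Matrix.det_mul, Matrix.det_one] at this
    exact IsUnit.of_mul_eq_one _ this
  let MR : Matrix (Fin k) (Fin k) ℝ := M.map (Int.castRingHom ℝ)
  have hdet : MR.det = (M.det : ℝ) := (RingHom.map_det (Int.castRingHom ℝ) M).symm
  have habs : |MR.det| = 1 := by
    rw [hdet]
    rcases Int.isUnit_iff.1 hdetZ with h | h <;> simp [h]
  have hdet0 : MR.det ≠ 0 := by
    intro h; rw [h] at habs; simp at habs
  have h1 : MeasurePreserving (Matrix.toLin' MR) := by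
    refine ⟨(LinearMap.continuous_on_pi _).measurable, ?_⟩
    rw [Real.map_matrix_volume_pi_eq_smul_volume_pi hdet0, abs_inv, habs]
    simp
  have h2 : MeasurePreserving (fun x : Fin k → ℝ => (fun a => m (e a)) + x) :=
    measurePreserving_add_left _ _
  have h3 := volume_measurePreserving_piCongrLeft (fun _ : J => ℝ) e
  have := h3.comp (h2.comp h1)
  refine (congrArg (fun f => MeasurePreserving f volume volume) ?_).mp this
  refine funext fun t => funext fun j => ?_
  obtain ⟨a, rfl⟩ := e.surjective j
  simp [MeasurableEquiv.coe_piCongrLeft, Equiv.piCongrLeft_apply_apply, contourPoint, MR, M,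
    Matrix.mulVec, dotProduct]

theorem integrable_prod_contourPoint (hJ : IsLatticeBasis Q J) (m : Fin n → ℝ)
    {f : J → ℝ → ℝ} (hf : ∀ j, Integrable (f j)) :
    Integrable fun t : Fin k → ℝ => ∏ j : J, f j (contourPoint Q m t j) := by
  have h := measurePreserving_contourPoint hJ m
  have hi : Integrable fun x : J → ℝ => ∏ j, f j (x j) := Integrable.fintype_prod hf
  exact h.integrable_comp_of_integrable hi

theorem integrable_exp_neg_mul_abs {r : ℝ} (hr : 0 < r) :
    Integrable fun x : ℝ => Real.exp (-r * |x|) := by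
  rw [← integrableOn_univ, ← Set.Iic_union_Ioi (a := (0 : ℝ))]
  refine IntegrableOn.union ?_ ?_
  · refine (integrableOn_exp_mul_Iic hr 0).congr_fun (fun x hx => ?_) measurableSet_Iic
    simp only [abs_of_nonpos (Set.mem_Iic.1 hx), neg_mul_neg]
  · refine (integrableOn_exp_mul_Ioi (neg_lt_zero.2 hr) 0).congr_fun (fun x hx => ?_)
      measurableSet_Ioi
    simp only [abs_of_pos (Set.mem_Ioi.1 hx)]

/-- The factors of a basis already decay in all directions; the remaining ones are at most `1`. -/
theorem integrable_prod_exp_contourPoint {S : Finset (Fin n)} (hJ : IsLatticeBasis Q J)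
    (hJS : J ⊆ S) (m : Fin n → ℝ) {r : ℝ} (hr : 0 < r) :
    Integrable fun t : Fin k → ℝ => ∏ s ∈ S, Real.exp (-r * |contourPoint Q m t s|) := by
  refine (integrable_prod_contourPoint hJ m (fun _ => integrable_exp_neg_mul_abs hr)).mono'
    ?_ (Filter.Eventually.of_forall fun t => ?_)
  · refine Continuous.aestronglyMeasurable ?_
    unfold contourPoint
    fun_prop
  · rw [Real.norm_of_nonneg (Finset.prod_nonneg fun _ _ => (Real.exp_pos _).le),
      ← Finset.prod_sdiff hJS, Finset.prod_coe_sort J fun s => Real.exp (-r * |contourPoint Q m t s|)]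
    refine mul_le_of_le_one_left (Finset.prod_nonneg fun _ _ => (Real.exp_pos _).le)
      (Finset.prod_le_one (fun _ _ => (Real.exp_pos _).le) fun s _ => Real.exp_le_one_iff.2 ?_)
    have := mul_nonneg hr.le (abs_nonneg (contourPoint Q m t s))
    linarith

theorem continuous_prod_phi (m : Fin n → ℝ) (S : Finset (Fin n)) (α : Fin n → ℂ) :
    Continuous fun t : Fin k → ℝ => ∏ s ∈ S, phi (α s) (contourPoint Q m t s) := by
  refine continuous_finsetProd _ fun s _ => (continuous_phi_right _).comp ?_
  unfold contourPoint
  fun_prop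

theorem norm_prod_phi_le (m : Fin n → ℝ) (S : Finset (Fin n)) {α : Fin n → ℂ} {r : ℝ}
    (h : ∀ s ∈ S, r ≤ (α s).re ∧ (α s).re ≤ 1 - r) (t : Fin k → ℝ) :
    ‖∏ s ∈ S, phi (α s) (contourPoint Q m t s)‖ ≤
      ∏ s ∈ S, Real.exp (-(2 * Real.pi * r) * |contourPoint Q m t s|) := by
  rw [norm_prod]
  exact Finset.prod_le_prod (fun _ _ => norm_nonneg _) fun s hs =>
    norm_phi_le (h s hs).1 (h s hs).2 _

theorem exists_strip {S : Finset (Fin n)} {α : Fin n → ℂ}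
    (h : ∀ s ∈ S, 0 < (α s).re ∧ (α s).re < 1) :
    ∃ r > 0, ∀ s ∈ S, r < (α s).re ∧ (α s).re < 1 - r := by
  have hev : ∀ᶠ r in nhdsWithin (0 : ℝ) (Set.Ioi 0), ∀ s ∈ S, r < (α s).re ∧ (α s).re < 1 - r := by
    refine (Filter.eventually_all_finset S).2 fun s hs => nhdsWithin_le_nhds ?_
    have h1 : ∀ᶠ r : ℝ in nhds 0, r < (α s).re := eventually_lt_nhds (h s hs).1
    have h2 : ∀ᶠ r : ℝ in nhds 0, r < 1 - (α s).re := eventually_lt_nhds (by linarith [(h s hs).2])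
    filter_upwards [h1, h2] with r hr1 hr2
    exact ⟨hr1, by linarith⟩
  obtain ⟨r, hr, hr0⟩ := (hev.and self_mem_nhdsWithin).exists
  exact ⟨r, hr0, hr⟩

theorem integrable_prod_phi {S : Finset (Fin n)} (hJ : IsLatticeBasis Q J) (hJS : J ⊆ S)
    (m : Fin n → ℝ) {α : Fin n → ℂ} (h : ∀ s ∈ S, 0 < (α s).re ∧ (α s).re < 1) :
    Integrable fun t : Fin k → ℝ => ∏ s ∈ S, phi (α s) (contourPoint Q m t s) := by
  obtain ⟨r, hr, hrS⟩ := exists_strip h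
  exact (integrable_prod_exp_contourPoint hJ hJS m (r := 2 * Real.pi * r) (by positivity)).mono'
    (continuous_prod_phi m S α).aestronglyMeasurable (Filter.Eventually.of_forall fun t =>
      norm_prod_phi_le m S (fun s hs => ⟨(hrS s hs).1.le, (hrS s hs).2.le⟩) t)

/-- Continuity of the contour integral in the exponents. -/
theorem tendsto_integral_prod_phi {S : Finset (Fin n)} (hJ : IsLatticeBasis Q J) (hJS : J ⊆ S)
    (m : Fin n → ℝ) {α : ℝ → Fin n → ℂ} (hα : Continuous α)
    (h : ∀ s ∈ S, 0 < (α 0 s).re ∧ (α 0 s).re < 1) :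
    Filter.Tendsto (fun τ => ∫ t : Fin k → ℝ, ∏ s ∈ S, phi (α τ s) (contourPoint Q m t s))
      (nhds 0) (nhds (∫ t : Fin k → ℝ, ∏ s ∈ S, phi (α 0 s) (contourPoint Q m t s))) := by
  obtain ⟨r, hr, hrS⟩ := exists_strip h
  have hcs : ∀ s, Continuous fun τ => (α τ s).re := fun s =>
    Complex.continuous_re.comp ((continuous_apply s).comp hα)
  have hev : ∀ᶠ τ in nhds (0 : ℝ), ∀ s ∈ S, r ≤ (α τ s).re ∧ (α τ s).re ≤ 1 - r := by
    refine (Filter.eventually_all_finset S).2 fun s hs => ?_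
    filter_upwards [(hcs s).continuousAt.eventually_const_lt (hrS s hs).1,
      (hcs s).continuousAt.eventually_lt_const (hrS s hs).2] with τ h1 h2
    exact ⟨h1.le, h2.le⟩
  refine tendsto_integral_filter_of_dominated_convergence _
    (Filter.Eventually.of_forall fun τ => (continuous_prod_phi m S (α τ)).aestronglyMeasurable)
    (hev.mono fun τ hτ => Filter.Eventually.of_forall (norm_prod_phi_le m S hτ))
    (integrable_prod_exp_contourPoint hJ hJS m (by positivity))
    (Filter.Eventually.of_forall fun t => ?_)
  refine Continuous.tendsto (continuous_finsetProd _ fun s _ => ?_) 0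
  exact continuous_phi.comp (((continuous_apply s).comp hα).prodMk continuous_const)

theorem integral_prod_phi_basis (hJ : IsLatticeBasis Q J) (m : Fin n → ℝ) {α : Fin n → ℂ}
    (h : ∀ s ∈ J, 0 < (α s).re ∧ (α s).re < 1) :
    ∫ t : Fin k → ℝ, ∏ s ∈ J, phi (α s) (contourPoint Q m t s) =
      ∏ j : J, (2 * Complex.sin (Real.pi * α j))⁻¹ := by
  have hmp := measurePreserving_contourPoint hJ m
  have hcont : Continuous fun x : J → ℝ => ∏ j : J, phi (α j) (x j) :=
    continuous_finsetProd _ fun j _ => (continuous_phi_right _).comp (continuous_apply j)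
  have h1 := integral_map (μ := (volume : Measure (Fin k → ℝ))) hmp.measurable.aemeasurable
    (f := fun x : J → ℝ => ∏ j : J, phi (α j) (x j)) hcont.aestronglyMeasurable
  rw [hmp.map_eq, integral_fintype_prod_volume_eq_prod] at h1
  rw [Finset.prod_congr rfl fun (j : J) _ => integral_phi (h j j.2).1 (h j j.2).2] at h1
  rw [h1]
  refine integral_congr_ae (Filter.Eventually.of_forall fun t => ?_)
  exact (Finset.prod_coe_sort J fun s => phi (α s) (contourPoint Q m t s)).symm

end Contour

/-! ## Evaluation of the contour integral by partial fractions along circuits -/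

section Circuit

open MeasureTheory

variable {n k : ℕ} {Q : Matrix (Fin n) (Fin k) ℤ} {J S : Finset (Fin n)}

/-- The constant term of `b_s` as an affine function of the `b_j`, `j ∈ J`. -/
def offset (Q : Matrix (Fin n) (Fin k) ℤ) (J : Finset (Fin n)) (m : Fin n → ℝ) (s : Fin n) : ℝ :=
  m s - ∑ j : J, (expansion Q J s j : ℝ) * m j

theorem offset_of_mem (hJ : IsLatticeBasis Q J) (m : Fin n → ℝ) {s : Fin n} (hs : s ∈ J) :
    offset Q J m s = 0 := by
  lift s to J using hs
  simp [offset, expansion_self hJ]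

/-- The value of `e^{2πb_s}` at the point where `e^{2πb_j} = -1` for `j ∈ J`. -/
def chi (Q : Matrix (Fin n) (Fin k) ℤ) (J : Finset (Fin n)) (m : Fin n → ℝ) (s : Fin n) : ℂ :=
  Complex.exp (2 * Real.pi * offset Q J m s) * (-1) ^ (∑ j : J, expansion Q J s j)

theorem chi_of_mem (hJ : IsLatticeBasis Q J) (m : Fin n → ℝ) {s : Fin n} (hs : s ∈ J) :
    chi Q J m s = -1 := by
  rw [chi, offset_of_mem hJ m hs]
  lift s to J using hs
  simp [expansion_self hJ]

theorem chi_ne_zero (m : Fin n → ℝ) (s : Fin n) : chi Q J m s ≠ 0 :=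
  mul_ne_zero (Complex.exp_ne_zero _) (zpow_ne_zero _ (by norm_num))

/-- The exponent of `e^{2πb_j}` after elimination of the `b_s`, `s ∉ J`. -/
def basisExponent (Q : Matrix (Fin n) (Fin k) ℤ) (S J : Finset (Fin n)) (α : Fin n → ℂ)
    (j : J) : ℂ :=
  ∑ s ∈ S, α s * expansion Q J s j

/-- The contribution of a basis `J` to the contour integral. -/
def residueTerm (Q : Matrix (Fin n) (Fin k) ℤ) (m : Fin n → ℝ) (S J : Finset (Fin n))
    (α : Fin n → ℂ) : ℂ :=
  (∏ j : J, (2 * Complex.sin (Real.pi * basisExponent Q S J α j))⁻¹) *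
    ∏ s ∈ S \ J, Complex.exp (2 * Real.pi * α s * offset Q J m s) / (1 + chi Q J m s)

/-- The variable of a circuit exponent normalized to the direction of the circuit. -/
def tilde (ε : Fin n → ℤ) (α : Fin n → ℂ) (s : Fin n) : ℂ := ε s * α s + (1 - ε s) / 2

/-- The exponents after removal of the element `j` of a circuit. -/
def removeExp (ε : Fin n → ℤ) (α : Fin n → ℂ) (j s : Fin n) : ℂ :=
  α s + ε s * ((if (tilde ε α s).re < (tilde ε α j).re then 1 else 0) - tilde ε α j)

/-- The integral part of the change of exponents. -/
def removeShift (ε : Fin n → ℤ) (w : Fin n → ℝ) (j s : Fin n) : ℤ :=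
  (if w s < w j then ε s else 0) + if s = j then (if ε j = 1 then 0 else -1) else 0

/-- The extra shift at `j` is chosen so that `x_j` cancels, which is why the left side omits `j`.
The vector `x` is left arbitrary because the identity is needed for the contour coordinates, for the
offsets, and, with `z = 0`, for the columns of the expansion matrix. -/
theorem sum_removeExp_mul {ε : Fin n → ℤ} (hεS : ∀ s ∉ S, ε s = 0) {j : Fin n} (hjS : j ∈ S)
    (hj : ε j = 1 ∨ ε j = -1) (α x : Fin n → ℂ) {z : ℂ} (hx : ∑ s, (ε s : ℂ) * x s = z) :
    ∑ s ∈ S.erase j, removeExp ε α j s * x s =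
      ∑ s ∈ S, α s * x s + ∑ s ∈ S, (removeShift ε (fun s => (tilde ε α s).re) j s : ℂ) * x s -
        tilde ε α j * z := by
  have hxS : ∑ s ∈ S, (ε s : ℂ) * x s = z := by
    rw [← hx]
    refine Finset.sum_subset (Finset.subset_univ S) fun s _ hs => ?_
    rw [hεS s hs]; simp
  rw [← hxS, Finset.mul_sum, ← Finset.sum_add_distrib, ← Finset.sum_sub_distrib,
    ← Finset.add_sum_erase S _ hjS]
  have hjj : α j * x j + (removeShift ε (fun s => (tilde ε α s).re) j j : ℂ) * x j -
      tilde ε α j * ((ε j : ℂ) * x j) = 0 := by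
    rcases hj with hj | hj
    · simp [removeShift, tilde, hj]
    · simp [removeShift, tilde, hj]; ring
  rw [hjj, zero_add]
  refine Finset.sum_congr rfl fun s hs => ?_
  have hsj : s ≠ j := (Finset.mem_erase.1 hs).1
  simp only [removeExp, removeShift, if_neg hsj, add_zero]
  split_ifs <;> push_cast <;> ring

/-- Listed by increasing `w`, each summand is the difference of two consecutive partial products.
Injectivity makes the order strict; the induction peels off the maximum. -/
theorem telescoping (C : Finset (Fin n)) {w : Fin n → ℝ} (hw : Set.InjOn w C) (Y : Fin n → ℂ) :
    ∑ j ∈ C, (1 - Y j) * ∏ l ∈ C with w l < w j, Y l = 1 - ∏ l ∈ C, Y l := by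
  induction C using Finset.induction_on_max_value w with
  | empty => simp
  | insert a C ha hmax ih =>
    have hlt : ∀ l ∈ C, w l < w a := fun l hl => lt_of_le_of_ne (hmax l hl) fun h => by
      have := hw (by simp [hl]) (by simp) h
      exact ha (this ▸ hl)
    rw [Finset.sum_insert ha, Finset.prod_insert ha]
    have h1 : {l ∈ insert a C | w l < w a} = C := by
      ext l
      simp only [Finset.mem_filter, Finset.mem_insert]
      constructor
      · rintro ⟨rfl | h, h'⟩
        · exact absurd h' (lt_irrefl _)
        · exact h
      · exact fun h => ⟨Or.inr h, hlt l h⟩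
    have h2 : ∀ j ∈ C, (1 - Y j) * ∏ l ∈ insert a C with w l < w j, Y l =
        (1 - Y j) * ∏ l ∈ C with w l < w j, Y l := by
      intro j hj
      rw [Finset.filter_insert, if_neg (not_lt.2 (hmax j hj))]
    rw [h1, Finset.sum_congr rfl h2, ih (hw.mono (by simp))]
    ring

/-- This is `telescoping` for `Y_l = -X_l^{ε_l}`. For `ε_j = -1` the factor is `1 + X_j⁻¹ = X_j⁻¹(1
+ X_j)`, which accounts for the extra `-1` in `removeShift`. -/
theorem telescoping_removeShift {ε : Fin n → ℤ} (hεS : ∀ s ∉ S, ε s = 0)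
    (hε : ∀ s, ε s = 0 ∨ ε s = 1 ∨ ε s = -1) {w : Fin n → ℝ}
    (hw : Set.InjOn w (Finset.univ.filter fun s => ε s ≠ 0)) {X : Fin n → ℂ} (hX : ∀ s, X s ≠ 0) :
    ∑ j ∈ Finset.univ.filter (fun s => ε s ≠ 0),
      (-1) ^ (Finset.card {l ∈ Finset.univ.filter (fun s => ε s ≠ 0) | w l < w j}) *
        ((∏ s ∈ S, X s ^ removeShift ε w j s) * (1 + X j)) =
      1 - (-1) ^ (Finset.card (Finset.univ.filter fun s => ε s ≠ 0)) * ∏ s ∈ S, X s ^ ε s := by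
  set C := Finset.univ.filter fun s => ε s ≠ 0 with hC
  have hCS : C ⊆ S := fun s hs => by
    by_contra h
    exact (Finset.mem_filter.1 hs).2 (hεS s h)
  have h := telescoping C hw fun l => -(X l ^ ε l)
  rw [Finset.prod_neg] at h
  have h3 : ∏ l ∈ C, X l ^ ε l = ∏ s ∈ S, X s ^ ε s :=
    Finset.prod_subset hCS fun s _ hs => by
      have : ε s = 0 := by simpa [hC] using hs
      rw [this, zpow_zero]
  rw [h3] at h
  rw [← h]
  refine Finset.sum_congr rfl fun j hj => ?_
  have hjS := hCS hj
  have hεj : ε j = 1 ∨ ε j = -1 := (hε j).resolve_left (Finset.mem_filter.1 hj).2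
  rw [Finset.prod_neg]
  have h4 : ∏ s ∈ S, X s ^ removeShift ε w j s =
      (∏ l ∈ C with w l < w j, X l ^ ε l) * X j ^ (if ε j = 1 then (0 : ℤ) else -1) := by
    simp only [removeShift, zpow_add₀ (hX _), Finset.prod_mul_distrib]
    congr 1
    · rw [Finset.prod_filter]
      refine (Finset.prod_subset_one_on_sdiff hCS (fun s hs => ?_) fun s _ => ?_).symm
      · have : ε s = 0 := by simpa [hC] using (Finset.mem_sdiff.1 hs).2
        simp [this]
      · split_ifs <;> simp
    · rw [Finset.prod_eq_single j]
      · simp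
      · intro s _ hs; simp [hs]
      · exact fun h => absurd hjS h
  rw [h4]
  rcases hεj with h5 | h5
  · simp [h5]; ring
  · have := hX j
    simp [h5]
    field_simp
    ring

variable (m : Fin n → ℝ)

/-- The factor `1 + X_j` cancels the denominator at `j`, and the relation `Σ ε_s x_s = z` trades the
constant `e^{-2π z tilde_j}` for a shift of all exponents along the circuit. -/
theorem prod_phi_removeExp {ε : Fin n → ℤ} (hεS : ∀ s ∉ S, ε s = 0) {j : Fin n} (hjS : j ∈ S)
    (hj : ε j = 1 ∨ ε j = -1) (α : Fin n → ℂ) (x : Fin n → ℝ) {z : ℝ}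
    (hx : ∑ s, (ε s : ℝ) * x s = z) :
    ∏ s ∈ S.erase j, phi (removeExp ε α j s) (x s) =
      (∏ s ∈ S, phi (α s) (x s)) * Complex.exp (-(2 * Real.pi * tilde ε α j * z)) *
        ((∏ s ∈ S, Complex.exp (2 * Real.pi * x s) ^
          removeShift ε (fun s => (tilde ε α s).re) j s) * (1 + Complex.exp (2 * Real.pi * x j))) := by
  have hxc : ∑ s, (ε s : ℂ) * (x s : ℂ) = z := by exact_mod_cast congrArg (fun r : ℝ => (r : ℂ)) hx
  have h := sum_removeExp_mul hεS hjS hj α (fun s => (x s : ℂ)) hxc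
  simp only [phi, Finset.prod_div_distrib, ← Complex.exp_int_mul]
  rw [← Finset.mul_prod_erase S (fun s => 1 + Complex.exp (2 * Real.pi * x s)) hjS]
  have h1 : ∀ (T : Finset (Fin n)) (β : Fin n → ℂ),
      ∏ s ∈ T, Complex.exp (2 * Real.pi * β s * x s) =
        Complex.exp (2 * Real.pi * ∑ s ∈ T, β s * x s) := by
    intro T β
    rw [← Complex.exp_sum, Finset.mul_sum]
    simp only [mul_assoc]
  have h2 : ∏ s ∈ S, Complex.exp ((removeShift ε (fun s => (tilde ε α s).re) j s : ℂ) *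
      (2 * Real.pi * x s)) = Complex.exp (2 * Real.pi *
        ∑ s ∈ S, (removeShift ε (fun s => (tilde ε α s).re) j s : ℂ) * x s) := by
    rw [← h1]
    exact Finset.prod_congr rfl fun s _ => by congr 1; ring
  rw [h1, h1, h2, h]
  have h3 := one_add_exp_ne_zero (x j)
  have h4 : ∏ s ∈ S.erase j, (1 + Complex.exp (2 * Real.pi * x s)) ≠ 0 :=
    Finset.prod_ne_zero_iff.2 fun s _ => one_add_exp_ne_zero _
  field_simp
  rw [← Complex.exp_add, ← Complex.exp_add]
  congr 1
  ring

theorem sum_mul_expansion_eq_zero (hJ : IsLatticeBasis Q J) {ε : Fin n → ℤ}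
    (hεQ : ∑ s, ε s • Q s = 0) (j : J) : ∑ s, ε s * expansion Q J s j = 0 := by
  have h1 : ∑ j : J, (∑ s, ε s * expansion Q J s j) • Q j = 0 := by
    rw [← hεQ]
    simp only [Finset.sum_smul]
    rw [Finset.sum_comm]
    refine Finset.sum_congr rfl fun s _ => ?_
    rw [← expansion_sum hJ s, Finset.smul_sum]
    refine Finset.sum_congr rfl fun j _ => ?_
    rw [smul_smul]
  exact Fintype.linearIndependent_iff.1 hJ.1 _ h1 j

theorem sum_mul_offset (hJ : IsLatticeBasis Q J) {ε : Fin n → ℤ} (hεQ : ∑ s, ε s • Q s = 0) :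
    ∑ s, (ε s : ℝ) * offset Q J m s = ∑ s, (ε s : ℝ) * m s := by
  simp only [offset, mul_sub, Finset.sum_sub_distrib, Finset.mul_sum]
  rw [Finset.sum_comm, sub_eq_self]
  refine Finset.sum_eq_zero fun j _ => ?_
  simp only [← mul_assoc, ← Finset.sum_mul]
  have : ∑ s, (ε s : ℝ) * (expansion Q J s j : ℝ) = 0 := by
    exact_mod_cast sum_mul_expansion_eq_zero hJ hεQ j
  rw [this, zero_mul]

theorem sum_mul_contourPoint {ε : Fin n → ℤ} (hεQ : ∑ s, ε s • Q s = 0) (t : Fin k → ℝ) :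
    ∑ s, (ε s : ℝ) * contourPoint Q m t s = ∑ s, (ε s : ℝ) * m s := by
  simp only [contourPoint, mul_add, Finset.sum_add_distrib, Finset.mul_sum]
  rw [Finset.sum_comm, add_eq_left]
  refine Finset.sum_eq_zero fun a _ => ?_
  simp only [← mul_assoc, ← Finset.sum_mul]
  have h := congrFun hεQ a
  simp only [Finset.sum_apply, Pi.smul_apply, smul_eq_mul, Pi.zero_apply] at h
  have : ∑ s, (ε s : ℝ) * (Q s a : ℝ) = 0 := by exact_mod_cast h
  rw [this, zero_mul]

/-- A column of the expansion matrix pairs to zero with the circuit, so only the integral shift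
survives. The sines therefore change by signs alone and acquire no zeros. -/
theorem basisExponent_removeExp (hJ : IsLatticeBasis Q J) {ε : Fin n → ℤ}
    (hεS : ∀ s ∉ S, ε s = 0) (hεQ : ∑ s, ε s • Q s = 0) {j : Fin n} (hjS : j ∈ S)
    (hj : ε j = 1 ∨ ε j = -1) (α : Fin n → ℂ) (i : J) :
    basisExponent Q (S.erase j) J (removeExp ε α j) i = basisExponent Q S J α i +
      ((∑ s ∈ S, removeShift ε (fun s => (tilde ε α s).re) j s * expansion Q J s i : ℤ) : ℂ) := by
  have h0 : ∑ s, (ε s : ℂ) * (expansion Q J s i : ℂ) = 0 := by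
    exact_mod_cast sum_mul_expansion_eq_zero hJ hεQ i
  have h := sum_removeExp_mul hεS hjS hj α (fun s => (expansion Q J s i : ℂ)) h0
  rw [mul_zero, sub_zero] at h
  push_cast
  exact h

theorem sin_pi_mul_add_int (a : ℂ) (N : ℤ) :
    Complex.sin (Real.pi * (a + N)) = (-1) ^ N * Complex.sin (Real.pi * a) := by
  rw [mul_add, mul_comm (Real.pi : ℂ) N]
  have := Complex.sin_antiperiodic.add_int_mul_eq (x := (Real.pi : ℂ) * a) N
  rwa [Int.cast_negOnePow] at this

theorem prod_zpow_eq_zpow_sum₀ {G ι : Type*} [CommGroupWithZero G] {g : G} (hg : g ≠ 0)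
    (s : Finset ι) (f : ι → ℤ) : ∏ i ∈ s, g ^ f i = g ^ ∑ i ∈ s, f i := by
  classical
  induction s using Finset.induction_on with
  | empty => simp
  | insert i s hi ih => rw [Finset.prod_insert hi, Finset.sum_insert hi, zpow_add₀ hg, ih]

/-- The counterpart of `prod_phi_removeExp` at the pole. If `j ∈ J`, then `J` is no longer available
after the removal, and the right side vanishes because `chi` equals `-1` at `j`. -/
theorem residueTerm_removeExp (hJ : IsLatticeBasis Q J) (hJS : J ⊆ S) {ε : Fin n → ℤ}
    (hεS : ∀ s ∉ S, ε s = 0) (hεQ : ∑ s, ε s • Q s = 0) {j : Fin n} (hjS : j ∈ S)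
    (hj : ε j = 1 ∨ ε j = -1) (hχ : ∀ s ∈ S \ J, 1 + chi Q J m s ≠ 0) (α : Fin n → ℂ) :
    (if J ⊆ S.erase j then residueTerm Q m (S.erase j) J (removeExp ε α j) else 0) =
      residueTerm Q m S J α *
        Complex.exp (-(2 * Real.pi * tilde ε α j * (∑ s, (ε s : ℝ) * m s : ℝ))) *
        ((∏ s ∈ S, chi Q J m s ^ removeShift ε (fun s => (tilde ε α s).re) j s) *
          (1 + chi Q J m j)) := by
  by_cases hjJ : j ∈ J
  · rw [if_neg fun h => by simpa using h hjJ, chi_of_mem hJ m hjJ]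
    simp
  rw [if_pos (Finset.subset_erase.2 ⟨hJS, hjJ⟩)]
  set δ := removeShift ε (fun s => (tilde ε α s).re) j with hδ
  have h1 : ∏ i : J, (2 * Complex.sin (Real.pi *
      basisExponent Q (S.erase j) J (removeExp ε α j) i))⁻¹ =
      (∏ i : J, (2 * Complex.sin (Real.pi * basisExponent Q S J α i))⁻¹) *
        (-1) ^ (∑ i : J, ∑ s ∈ S, δ s * expansion Q J s i) := by
    rw [← prod_zpow_eq_zpow_sum₀ (by norm_num : (-1 : ℂ) ≠ 0), ← Finset.prod_mul_distrib]
    refine Finset.prod_congr rfl fun i _ => ?_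
    rw [basisExponent_removeExp hJ hεS hεQ hjS hj, sin_pi_mul_add_int, mul_left_comm, mul_inv,
      mul_comm, ← zpow_neg, ← inv_zpow', inv_neg, inv_one]
  have hoff : ∑ s, (ε s : ℂ) * (offset Q J m s : ℂ) = ((∑ s, (ε s : ℝ) * m s : ℝ) : ℂ) := by
    exact_mod_cast congrArg (fun r : ℝ => (r : ℂ)) (sum_mul_offset m hJ hεQ)
  have h2 := sum_removeExp_mul hεS hjS hj α (fun s => (offset Q J m s : ℂ)) hoff
  have h3 : ∀ (T : Finset (Fin n)) (β : Fin n → ℂ),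
      ∏ s ∈ T \ J, Complex.exp (2 * Real.pi * β s * offset Q J m s) =
        Complex.exp (2 * Real.pi * ∑ s ∈ T, β s * offset Q J m s) := by
    intro T β
    rw [← Complex.exp_sum, Finset.mul_sum]
    congr 1
    rw [← Finset.sum_subset (Finset.sdiff_subset (s := T) (t := J))]
    · simp only [mul_assoc]
    · intro s hs hsJ
      have : s ∈ J := by
        by_contra h; exact hsJ (Finset.mem_sdiff.2 ⟨hs, h⟩)
      rw [offset_of_mem hJ m this]; simp
  have h4 : ∏ s ∈ S, chi Q J m s ^ δ s =
      Complex.exp (2 * Real.pi * ∑ s ∈ S, (δ s : ℂ) * offset Q J m s) *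
        (-1) ^ (∑ i : J, ∑ s ∈ S, δ s * expansion Q J s i) := by
    simp only [chi, mul_zpow, Finset.prod_mul_distrib]
    congr 1
    · rw [Finset.mul_sum, Complex.exp_sum]
      refine Finset.prod_congr rfl fun s _ => ?_
      rw [← Complex.exp_int_mul]
      congr 1; ring
    · rw [Finset.sum_comm, ← prod_zpow_eq_zpow_sum₀ (by norm_num : (-1 : ℂ) ≠ 0)]
      refine Finset.prod_congr rfl fun s _ => ?_
      rw [← zpow_mul, Finset.sum_mul]
      congr 1
      exact Finset.sum_congr rfl fun i _ => mul_comm _ _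
  have hjSJ : j ∈ S \ J := Finset.mem_sdiff.2 ⟨hjS, hjJ⟩
  rw [residueTerm, residueTerm, h1, Finset.prod_div_distrib, Finset.prod_div_distrib, h3, h3, h2, h4,
    Finset.erase_sdiff_comm, ← Finset.mul_prod_erase (S \ J) (fun s => 1 + chi Q J m s) hjSJ]
  have h5 := hχ j hjSJ
  have h6 : ∏ s ∈ (S \ J).erase j, (1 + chi Q J m s) ≠ 0 :=
    Finset.prod_ne_zero_iff.2 fun s hs => hχ s (Finset.mem_of_mem_erase hs)
  have h7 : Complex.exp (2 * Real.pi * (∑ s ∈ S, α s * offset Q J m s +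
      ∑ s ∈ S, (δ s : ℂ) * offset Q J m s - tilde ε α j * (∑ s, (ε s : ℝ) * m s : ℝ))) =
      Complex.exp (2 * Real.pi * ∑ s ∈ S, α s * offset Q J m s) *
      Complex.exp (2 * Real.pi * ∑ s ∈ S, (δ s : ℂ) * offset Q J m s) *
      Complex.exp (-(2 * Real.pi * tilde ε α j * (∑ s, (ε s : ℝ) * m s : ℝ))) := by
    rw [← Complex.exp_add, ← Complex.exp_add]
    congr 1; ring
  rw [h7]
  field_simp

end Circuit

/-! ### The residue formula by induction on circuits -/

section CircuitInduction

open MeasureTheory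

variable {n k : ℕ} {Q : Matrix (Fin n) (Fin k) ℤ} {S : Finset (Fin n)} {m : Fin n → ℝ}

open Classical in
/-- The bases contained in `S`. -/
def basesIn (Q : Matrix (Fin n) (Fin k) ℤ) (S : Finset (Fin n)) : Finset (Finset (Fin n)) :=
  Finset.univ.filter fun J => IsLatticeBasis Q J ∧ J ⊆ S

theorem mem_basesIn {J : Finset (Fin n)} : J ∈ basesIn Q S ↔ IsLatticeBasis Q J ∧ J ⊆ S := by
  simp [basesIn]

/-- The exponents lie in the open unit strip. -/
def InStrip (S : Finset (Fin n)) (α : Fin n → ℂ) : Prop := ∀ s ∈ S, 0 < (α s).re ∧ (α s).re < 1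

/-- No exponent of a basis is an integer. -/
def NonIntegral (Q : Matrix (Fin n) (Fin k) ℤ) (S : Finset (Fin n)) (α : Fin n → ℂ) : Prop :=
  ∀ J ∈ basesIn Q S, ∀ j : J, Complex.sin (Real.pi * basisExponent Q S J α j) ≠ 0

/-- The contour integral is the sum of the contributions of the bases. -/
def ResidueFormula (Q : Matrix (Fin n) (Fin k) ℤ) (m : Fin n → ℝ) (S : Finset (Fin n))
    (α : Fin n → ℂ) : Prop :=
  ∫ t : Fin k → ℝ, ∏ s ∈ S, phi (α s) (contourPoint Q m t s) =
    ∑ J ∈ basesIn Q S, residueTerm Q m S J α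

/-- In normalized variables the real part of the new exponent at `s` on the circuit is the
fractional part of the difference of the old ones at `s` and `j`. Distinctness excludes the value
`0`. -/
theorem inStrip_removeExp {ε : Fin n → ℤ} (hε : ∀ s, ε s = 0 ∨ ε s = 1 ∨ ε s = -1)
    {α : Fin n → ℂ} (hα : InStrip S α)
    (hw : Set.InjOn (fun s => (tilde ε α s).re) (Finset.univ.filter fun s => ε s ≠ 0))
    {j : Fin n} (hjS : j ∈ S) (hj : ε j ≠ 0) : InStrip (S.erase j) (removeExp ε α j) := by
  intro s hs
  obtain ⟨hsj, hsS⟩ := Finset.mem_erase.1 hs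
  obtain ⟨h1, h2⟩ := hα s hsS
  obtain ⟨h3, h4⟩ := hα j hjS
  have htj : 0 < (tilde ε α j).re ∧ (tilde ε α j).re < 1 := by
    rcases (hε j).resolve_left hj with h | h <;> simp [tilde, h] <;> constructor <;> linarith
  by_cases hs0 : ε s = 0
  · simpa [removeExp, hs0] using And.intro h1 h2
  have hne : (tilde ε α s).re ≠ (tilde ε α j).re := fun h =>
    hsj (hw (by simp [hs0]) (by simp [hj]) h)
  have hts : (tilde ε α s).re = ε s * (α s).re + (1 - ε s) / 2 := by
    rcases (hε s).resolve_left hs0 with h | h <;> simp [tilde, h]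
  rcases lt_or_gt_of_ne hne with hlt | hlt
  · have hre : (removeExp ε α j s).re = (α s).re + ε s * (1 - (tilde ε α j).re) := by
      rw [removeExp, if_pos hlt]
      rcases (hε s).resolve_left hs0 with h | h <;> simp [h]
    rw [hre]
    rw [hts] at hlt
    rcases (hε s).resolve_left hs0 with h | h <;> simp [h] at hlt ⊢ <;> constructor <;> linarith
  · have hre : (removeExp ε α j s).re = (α s).re - ε s * (tilde ε α j).re := by
      rw [removeExp, if_neg (not_lt.2 hlt.le)]
      rcases (hε s).resolve_left hs0 with h | h <;> simp [h]
      rfl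
    rw [hre]
    rw [hts] at hlt
    rcases (hε s).resolve_left hs0 with h | h <;> simp [h] at hlt ⊢ <;> constructor <;> linarith

theorem nonIntegral_removeExp {ε : Fin n → ℤ} (hεS : ∀ s ∉ S, ε s = 0)
    (hε : ∀ s, ε s = 0 ∨ ε s = 1 ∨ ε s = -1) (hεQ : ∑ s, ε s • Q s = 0) {α : Fin n → ℂ}
    (hα : NonIntegral Q S α) {j : Fin n} (hjS : j ∈ S) (hj : ε j ≠ 0) :
    NonIntegral Q (S.erase j) (removeExp ε α j) := by
  intro J hJ i
  obtain ⟨hJ, hJS⟩ := mem_basesIn.1 hJ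
  rw [basisExponent_removeExp hJ hεS hεQ hjS ((hε j).resolve_left hj), sin_pi_mul_add_int]
  exact mul_ne_zero (zpow_ne_zero _ (by norm_num))
    (hα J (mem_basesIn.2 ⟨hJ, hJS.trans (Finset.erase_subset _ _)⟩) i)

theorem one_sub_sign_mul_exp_ne_zero {z : ℝ} (hz : z ≠ 0) (N : ℕ) :
    1 - (-1) ^ N * Complex.exp (2 * Real.pi * z) ≠ 0 := by
  intro h
  have h1 := congrArg norm (sub_eq_zero.1 h)
  rw [norm_one, norm_mul, norm_pow, norm_neg, norm_one, one_pow, one_mul] at h1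
  have h2 : Complex.exp (2 * Real.pi * z) = ((Real.exp (2 * Real.pi * z) : ℝ) : ℂ) := by
    push_cast; rfl
  rw [h2, Complex.norm_real, Real.norm_of_nonneg (Real.exp_pos _).le, eq_comm,
    Real.exp_eq_one_iff] at h1
  have := Real.pi_pos.ne'
  simp_all

/-- The modulus of `chi` is `e^{2π · offset}`, which differs from `1`. -/
theorem one_add_chi_ne_zero {J : Finset (Fin n)} {s : Fin n} (hz : offset Q J m s ≠ 0) :
    1 + chi Q J m s ≠ 0 := by
  intro h
  have h1 := congrArg norm (eq_neg_of_add_eq_zero_right h)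
  rw [chi, norm_mul, norm_zpow, norm_neg, norm_one, one_zpow, mul_one] at h1
  have h2 : Complex.exp (2 * Real.pi * offset Q J m s) =
      ((Real.exp (2 * Real.pi * offset Q J m s) : ℝ) : ℂ) := by
    push_cast; rfl
  rw [h2, Complex.norm_real, Real.norm_of_nonneg (Real.exp_pos _).le, Real.exp_eq_one_iff] at h1
  have := Real.pi_pos.ne'
  simp_all

/-- The residue formula for `S` follows from the residue formulas for the complements of the
elements of a circuit, when the exponents along the circuit are distinct. -/
theorem residueFormula_of_circuit {ε : Fin n → ℤ} (hεS : ∀ s ∉ S, ε s = 0)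
    (hε : ∀ s, ε s = 0 ∨ ε s = 1 ∨ ε s = -1) (hεQ : ∑ s, ε s • Q s = 0)
    (hz : ∑ s, (ε s : ℝ) * m s ≠ 0)
    (hχ : ∀ J ∈ basesIn Q S, ∀ s ∈ S \ J, offset Q J m s ≠ 0)
    (hdel : ∀ j ∈ S, ε j ≠ 0 → ∃ J, J ∈ basesIn Q (S.erase j))
    (ih : ∀ j ∈ S, ε j ≠ 0 → ∀ α, InStrip (S.erase j) α → NonIntegral Q (S.erase j) α →
      ResidueFormula Q m (S.erase j) α)
    {α : Fin n → ℂ} (hα : InStrip S α) (hα' : NonIntegral Q S α)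
    (hw : Set.InjOn (fun s => (tilde ε α s).re) (Finset.univ.filter fun s => ε s ≠ 0)) :
    ResidueFormula Q m S α := by
  set z := ∑ s, (ε s : ℝ) * m s with hzdef
  set w := fun s => (tilde ε α s).re with hwdef
  set C := Finset.univ.filter fun s => ε s ≠ 0 with hC
  have hCε : ∀ j ∈ C, ε j ≠ 0 := fun j hj => (Finset.mem_filter.1 hj).2
  have hCS : ∀ j ∈ C, j ∈ S := fun j hj => by
    by_contra h
    exact hCε j hj (hεS j h)
  have hsumS : ∀ x : Fin n → ℂ, ∑ s ∈ S, (ε s : ℂ) * x s = ∑ s, (ε s : ℂ) * x s := fun x =>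
    Finset.sum_subset (Finset.subset_univ S) fun s _ hs => by rw [hεS s hs]; simp
  -- `A j` carries the sign of the telescoping term and cancels the factor `e^{-2π z tilde_j}`
  -- created by removing `j`.
  set A : Fin n → ℂ := fun j => (-1) ^ (Finset.card {l ∈ C | w l < w j}) *
    Complex.exp (2 * Real.pi * tilde ε α j * z) with hA
  set κ : ℂ := (-1) ^ C.card * Complex.exp (2 * Real.pi * z) with hκ
  have hκ1 : 1 - κ ≠ 0 := one_sub_sign_mul_exp_ne_zero hz _
  have hexp : ∀ j, Complex.exp (2 * Real.pi * tilde ε α j * z) *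
      Complex.exp (-(2 * Real.pi * tilde ε α j * z)) = 1 := fun j => by
    rw [← Complex.exp_add, add_neg_cancel, Complex.exp_zero]
  -- The integrand and, in `hres`, every residue term satisfy the same linear recursion with the
  -- same weights `A j` and the same constant `1 - κ ≠ 0`. Integrating the first and summing the
  -- second over bases reduces the claim to `S.erase j`.
  have hpt : ∀ t : Fin k → ℝ, ∑ j ∈ C, A j * ∏ s ∈ S.erase j,
      phi (removeExp ε α j s) (contourPoint Q m t s) =
      (∏ s ∈ S, phi (α s) (contourPoint Q m t s)) * (1 - κ) := by
    intro t
    have hb := sum_mul_contourPoint m hεQ t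
    have htel := telescoping_removeShift hεS hε hw
      (X := fun s => Complex.exp (2 * Real.pi * contourPoint Q m t s))
      (fun s => Complex.exp_ne_zero _)
    have hX : ∏ s ∈ S, Complex.exp (2 * Real.pi * contourPoint Q m t s) ^ ε s =
        Complex.exp (2 * Real.pi * z) := by
      simp only [← Complex.exp_int_mul]
      rw [← Complex.exp_sum]
      congr 1
      rw [hzdef, ← hb]
      push_cast
      rw [← hsumS, Finset.mul_sum]
      exact Finset.sum_congr rfl fun s _ => by ring
    rw [hX] at htel
    rw [hκ, ← htel, Finset.mul_sum]
    refine Finset.sum_congr rfl fun j hj => ?_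
    rw [prod_phi_removeExp hεS (hCS j hj) ((hε j).resolve_left (hCε j hj)) α _ hb, hA]
    linear_combination (-1) ^ (Finset.card {l ∈ C | w l < w j}) *
      (∏ s ∈ S, phi (α s) (contourPoint Q m t s)) *
      ((∏ s ∈ S, Complex.exp (2 * Real.pi * contourPoint Q m t s) ^ removeShift ε w j s) *
        (1 + Complex.exp (2 * Real.pi * contourPoint Q m t j))) * hexp j
  have hres : ∀ J ∈ basesIn Q S, ∑ j ∈ C, A j *
      (if J ⊆ S.erase j then residueTerm Q m (S.erase j) J (removeExp ε α j) else 0) =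
      residueTerm Q m S J α * (1 - κ) := by
    intro J hJmem
    obtain ⟨hJ, hJS⟩ := mem_basesIn.1 hJmem
    have htel := telescoping_removeShift hεS hε hw (X := chi Q J m) (chi_ne_zero m)
    have hX : ∏ s ∈ S, chi Q J m s ^ ε s = Complex.exp (2 * Real.pi * z) := by
      simp only [chi, mul_zpow, Finset.prod_mul_distrib, ← Complex.exp_int_mul, ← zpow_mul]
      rw [← Complex.exp_sum, prod_zpow_eq_zpow_sum₀ (by norm_num : (-1 : ℂ) ≠ 0)]
      have h0 : ∑ s ∈ S, (∑ j : J, expansion Q J s j) * ε s = 0 := by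
        rw [Finset.sum_subset (Finset.subset_univ S) fun s _ hs => by rw [hεS s hs, mul_zero]]
        simp only [Finset.sum_mul]
        rw [Finset.sum_comm]
        refine Finset.sum_eq_zero fun j _ => ?_
        rw [← sum_mul_expansion_eq_zero hJ hεQ j]
        exact Finset.sum_congr rfl fun s _ => mul_comm _ _
      rw [h0, zpow_zero, mul_one]
      congr 1
      rw [hzdef, ← sum_mul_offset m hJ hεQ]
      push_cast
      rw [← hsumS, Finset.mul_sum]
      exact Finset.sum_congr rfl fun s _ => by ring
    rw [hX] at htel
    rw [hκ, ← htel, Finset.mul_sum]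
    refine Finset.sum_congr rfl fun j hj => ?_
    rw [residueTerm_removeExp m hJ hJS hεS hεQ (hCS j hj) ((hε j).resolve_left (hCε j hj))
      (fun s hs => one_add_chi_ne_zero (hχ J hJmem s hs)) α, hA]
    linear_combination (-1) ^ (Finset.card {l ∈ C | w l < w j}) *
      residueTerm Q m S J α *
      ((∏ s ∈ S, chi Q J m s ^ removeShift ε w j s) * (1 + chi Q J m j)) * hexp j
  have hstrip : ∀ j ∈ C, InStrip (S.erase j) (removeExp ε α j) := fun j hj =>
    inStrip_removeExp hε hα hw (hCS j hj) (hCε j hj)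
  have hint : ∀ j ∈ C, Integrable fun t : Fin k → ℝ => A j * ∏ s ∈ S.erase j,
      phi (removeExp ε α j s) (contourPoint Q m t s) := fun j hj => by
    obtain ⟨J, hJ⟩ := hdel j (hCS j hj) (hCε j hj)
    obtain ⟨hJ, hJS⟩ := mem_basesIn.1 hJ
    exact (integrable_prod_phi hJ hJS m (hstrip j hj)).const_mul _
  refine mul_right_cancel₀ hκ1 ?_
  rw [Finset.sum_mul, ← Finset.sum_congr rfl hres, Finset.sum_comm, ← integral_mul_const]
  simp only [← hpt]
  rw [integral_finsetSum _ hint]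
  refine Finset.sum_congr rfl fun j hj => ?_
  rw [integral_const_mul, ih j (hCS j hj) (hCε j hj) _ (hstrip j hj)
    (nonIntegral_removeExp hεS hε hεQ hα' (hCS j hj) (hCε j hj)), ← Finset.mul_sum,
    ← Finset.sum_filter]
  congr 1
  refine Finset.sum_congr ?_ fun _ _ => rfl
  ext J
  simp only [Finset.mem_filter, mem_basesIn]
  exact ⟨fun h => ⟨⟨h.1, h.2.trans (Finset.erase_subset _ _)⟩, h.2⟩, fun h => ⟨h.1.1, h.2⟩⟩

/-- The exponents along a circuit may be assumed to be distinct. -/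
theorem residueFormula_of_forall_injOn {ε : Fin n → ℤ} (hε : ∀ s, ε s = 0 ∨ ε s = 1 ∨ ε s = -1)
    {J : Finset (Fin n)} (hJ : IsLatticeBasis Q J) (hJS : J ⊆ S)
    (h : ∀ α, InStrip S α → NonIntegral Q S α →
      Set.InjOn (fun s => (tilde ε α s).re) (Finset.univ.filter fun s => ε s ≠ 0) →
      ResidueFormula Q m S α)
    {α : Fin n → ℂ} (hα : InStrip S α) (hα' : NonIntegral Q S α) : ResidueFormula Q m S α := by
  -- As `ε_s² = 1` on the circuit, the normalized exponent at `s` moves with speed equal to the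
  -- index `s`. Two of them then coincide for at most one `τ`, and both sides of the formula are
  -- continuous at `τ = 0`.
  set a : ℝ → Fin n → ℂ := fun τ s => α s + τ * (ε s * ((s : ℕ) : ℂ)) with ha
  have ha0 : a 0 = α := by ext s; simp [ha]
  have hac : Continuous a := by
    refine continuous_pi fun s => ?_
    simp only [ha]
    fun_prop
  have hacs : ∀ s, Continuous fun τ => a τ s := fun s => (continuous_apply s).comp hac
  have hbc : ∀ (J : Finset (Fin n)) (j : J), Continuous fun τ => basisExponent Q S J (a τ) j := by
    intro J j
    unfold basisExponent
    exact continuous_finsetSum _ fun s _ => (hacs s).mul continuous_const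
  have hsc : ∀ (J : Finset (Fin n)) (j : J), Continuous fun τ =>
      Complex.sin (Real.pi * basisExponent Q S J (a τ) j) := fun J j =>
    Complex.continuous_sin.comp (continuous_const.mul (hbc J j))
  have hstrip : ∀ᶠ τ in nhds (0 : ℝ), InStrip S (a τ) := by
    refine (Filter.eventually_all_finset S).2 fun s hs => ?_
    have hre : ContinuousAt (fun τ => (a τ s).re) 0 :=
      (Complex.continuous_re.comp (hacs s)).continuousAt
    have h0 := hα s hs
    rw [← ha0] at h0
    exact (hre.eventually_const_lt h0.1).and (hre.eventually_lt_const h0.2)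
  have hnon : ∀ᶠ τ in nhds (0 : ℝ), NonIntegral Q S (a τ) := by
    refine (Filter.eventually_all_finset _).2 fun J hJ => Filter.eventually_all.2 fun j => ?_
    refine (hsc J j).continuousAt.eventually_ne ?_
    have := hα' J hJ j
    rwa [← ha0] at this
  have hinj : ∀ᶠ τ in nhdsWithin (0 : ℝ) {0}ᶜ, ∀ s l : Fin n, ε s ≠ 0 → ε l ≠ 0 → s ≠ l →
      (tilde ε (a τ) s).re ≠ (tilde ε (a τ) l).re := by
    refine Filter.eventually_all.2 fun s => Filter.eventually_all.2 fun l => ?_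
    by_cases hcond : ε s ≠ 0 ∧ ε l ≠ 0 ∧ s ≠ l
    · obtain ⟨hs, hl, hsl⟩ := hcond
      have htilde : ∀ s, ε s ≠ 0 → ∀ τ, (tilde ε (a τ) s).re = (tilde ε α s).re + τ * (s : ℕ) := by
        intro s hs τ
        rcases (hε s).resolve_left hs with h | h <;> simp [tilde, ha, h] ; ring
      have hsl' : ((s : ℕ) : ℝ) - ((l : ℕ) : ℝ) ≠ 0 :=
        sub_ne_zero.2 fun h => hsl (Fin.ext (by exact_mod_cast h))
      set c := ((tilde ε α l).re - (tilde ε α s).re) / (((s : ℕ) : ℝ) - ((l : ℕ) : ℝ)) with hc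
      have hne : ∀ᶠ τ in nhdsWithin (0 : ℝ) {0}ᶜ, τ ≠ c := by
        by_cases hc0 : c = 0
        · rw [hc0]; exact self_mem_nhdsWithin
        · exact nhdsWithin_le_nhds (eventually_ne_nhds (Ne.symm hc0))
      filter_upwards [hne] with τ hτ _ _ _ heq
      rw [htilde s hs, htilde l hl] at heq
      apply hτ
      rw [hc, eq_div_iff hsl']
      linarith
    · exact Filter.Eventually.of_forall fun τ hs hl hsl => absurd ⟨hs, hl, hsl⟩ hcond
  have hev : ∀ᶠ τ in nhdsWithin (0 : ℝ) {0}ᶜ, ResidueFormula Q m S (a τ) := by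
    filter_upwards [nhdsWithin_le_nhds hstrip, nhdsWithin_le_nhds hnon, hinj] with τ h1 h2 h3
    refine h _ h1 h2 fun s hs l hl heq => ?_
    by_contra hsl
    exact h3 s l (by simpa using hs) (by simpa using hl) hsl heq
  have hlim1 := (tendsto_integral_prod_phi hJ hJS m hac (by rw [ha0]; exact hα)).mono_left
    (nhdsWithin_le_nhds (s := {0}ᶜ))
  have hlim2 : Filter.Tendsto (fun τ => ∑ J ∈ basesIn Q S, residueTerm Q m S J (a τ))
      (nhdsWithin (0 : ℝ) {0}ᶜ) (nhds (∑ J ∈ basesIn Q S, residueTerm Q m S J (a 0))) := by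
    refine tendsto_finsetSum _ fun J hJ => Filter.Tendsto.mono_left ?_ nhdsWithin_le_nhds
    unfold residueTerm
    refine Filter.Tendsto.mul (tendsto_finsetProd _ fun j _ => ?_) (tendsto_finsetProd _ fun s _ => ?_)
    · refine Filter.Tendsto.inv₀ (((hsc J j).const_mul 2).tendsto 0) ?_
      have := hα' J hJ j
      rw [← ha0] at this
      exact mul_ne_zero two_ne_zero this
    · refine Continuous.tendsto ?_ 0
      exact Continuous.div_const (Complex.continuous_exp.comp
        (((continuous_const.mul (hacs s))).mul continuous_const)) _
  have := tendsto_nhds_unique (hlim1.congr' hev) hlim2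
  rw [ha0] at this
  exact this

theorem residueFormula_basis {J : Finset (Fin n)} (hJ : IsLatticeBasis Q J) {α : Fin n → ℂ}
    (hα : InStrip J α) : ResidueFormula Q m J α := by
  have hb : basesIn Q J = {J} := by
    ext J'
    rw [mem_basesIn, Finset.mem_singleton]
    exact ⟨fun h => hJ.eq_of_subset h.1 h.2, fun h => by rw [h]; exact ⟨hJ, subset_rfl⟩⟩
  rw [ResidueFormula, hb, Finset.sum_singleton, integral_prod_phi_basis hJ m hα, residueTerm,
    Finset.sdiff_self, Finset.prod_empty, mul_one]
  refine Finset.prod_congr rfl fun j _ => ?_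
  congr 4
  rw [basisExponent, ← Finset.sum_coe_sort J (fun s => α s * (expansion Q J s j : ℂ))]
  simp [expansion_self hJ]

/-- The contour integral as a sum over bases. -/
theorem residueFormula
    (hex : ∀ J, IsLatticeBasis Q J → ∀ i ∉ J, ∀ j : J, expansion Q J i j ≠ 0 →
      IsLatticeBasis Q (insert i (J.erase j)))
    (hR : ∀ J, IsLatticeBasis Q J → ∀ i ∉ J, ∀ j : J,
      expansion Q J i j = 0 ∨ expansion Q J i j = 1 ∨ expansion Q J i j = -1)
    (hz : ∀ J, IsLatticeBasis Q J → ∀ i ∉ J, offset Q J m i ≠ 0)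
    (S : Finset (Fin n)) (hS : ∃ J, J ∈ basesIn Q S) (α : Fin n → ℂ) (hα : InStrip S α)
    (hα' : NonIntegral Q S α) : ResidueFormula Q m S α := by
  induction S using Finset.strongInduction generalizing α with
  | H S ih =>
    obtain ⟨J, hJmem⟩ := hS
    obtain ⟨hJ, hJS⟩ := mem_basesIn.1 hJmem
    by_cases hSJ : S ⊆ J
    · obtain rfl := Finset.Subset.antisymm hSJ hJS
      exact residueFormula_basis hJ hα
    obtain ⟨i, hiS, hiJ⟩ := Finset.not_subset.1 hSJ
    -- The fundamental circuit of `i` with respect to `J`, from `Q_i - Σ_j R_{ij} Q_j = 0`. Its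
    -- constant `z` is the offset of `i`, nonzero by `hz`.
    set ε : Fin n → ℤ := fun s =>
      if s = i then 1 else if h : s ∈ J then -expansion Q J i ⟨s, h⟩ else 0 with hεdef
    have hεi : ε i = 1 := by simp [hεdef]
    have hεJ : ∀ j : J, ε j = -expansion Q J i j := fun j => by
      have : (j : Fin n) ≠ i := fun h => hiJ (h ▸ j.2)
      simp [hεdef, this]
    have hε0 : ∀ s, s ≠ i → s ∉ J → ε s = 0 := fun s h1 h2 => by simp [hεdef, h1, h2]
    have hsum : ∀ {M : Type} [AddCommGroup M] (f : Fin n → M),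
        ∑ s, ε s • f s = f i - ∑ j : J, expansion Q J i j • f j := by
      intro M _ f
      have h1 : ∑ s, ε s • f s = ∑ s ∈ insert i J, ε s • f s := by
        refine (Finset.sum_subset (Finset.subset_univ _) fun s _ hs => ?_).symm
        rw [Finset.mem_insert, not_or] at hs
        rw [hε0 s hs.1 hs.2, zero_smul]
      rw [h1, Finset.sum_insert hiJ, hεi, one_smul, sub_eq_add_neg,
        ← Finset.sum_coe_sort J (fun s => ε s • f s), ← Finset.sum_neg_distrib]
      congr 1
      exact Finset.sum_congr rfl fun j _ => by rw [hεJ, neg_smul]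
    have hεS : ∀ s ∉ S, ε s = 0 := fun s hs => hε0 s (fun h => hs (h ▸ hiS)) fun h => hs (hJS h)
    have hε : ∀ s, ε s = 0 ∨ ε s = 1 ∨ ε s = -1 := by
      intro s
      by_cases hs : s = i
      · rw [hs, hεi]; simp
      by_cases hsJ : s ∈ J
      · rw [hεJ ⟨s, hsJ⟩]
        rcases hR J hJ i hiJ ⟨s, hsJ⟩ with h | h | h <;> simp [h]
      · exact Or.inl (hε0 s hs hsJ)
    have hεQ : ∑ s, ε s • Q s = 0 := by
      rw [hsum (fun s => Q s), expansion_sum hJ, sub_self]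
    have hzε : ∑ s, (ε s : ℝ) * m s ≠ 0 := by
      have := hsum m
      simp only [zsmul_eq_mul] at this
      rw [this]
      exact hz J hJ i hiJ
    -- Deleting a circuit element leaves a basis: `J` itself if the element is `i`, and otherwise
    -- `J` with the element exchanged for `i`.
    have hdel : ∀ j ∈ S, ε j ≠ 0 → ∃ J', J' ∈ basesIn Q (S.erase j) := by
      intro j hjS hj
      by_cases hji : j = i
      · exact ⟨J, mem_basesIn.2 ⟨hJ, Finset.subset_erase.2 ⟨hJS, hji ▸ hiJ⟩⟩⟩
      · have hjJ : j ∈ J := by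
          by_contra h
          exact hj (hε0 j hji h)
        have hne : expansion Q J i ⟨j, hjJ⟩ ≠ 0 := by
          rw [hεJ ⟨j, hjJ⟩] at hj
          exact neg_ne_zero.1 hj
        refine ⟨_, mem_basesIn.2 ⟨hex J hJ i hiJ ⟨j, hjJ⟩ hne, ?_⟩⟩
        refine Finset.insert_subset (Finset.mem_erase.2 ⟨Ne.symm hji, hiS⟩)
          (Finset.erase_subset_erase _ hJS)
    refine residueFormula_of_forall_injOn hε hJ hJS (fun β hβ hβ' hinj => ?_) hα hα'
    refine residueFormula_of_circuit hεS hε hεQ hzε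
      (fun J' hJ' s hs => hz J' (mem_basesIn.1 hJ').1 s (Finset.mem_sdiff.1 hs).2) hdel
      (fun j hjS hj γ hγ hγ' => ih _ (Finset.erase_ssubset hjS) (hdel j hjS hj) γ hγ hγ') hβ hβ' hinj

end CircuitInduction

/-! ## Traces over products of ladders -/

section PiSums

theorem summable_and_tsum_mul_prod {N : ℕ} (f₀ : ℕ → ℂ) (f : Fin N → ℕ → ℂ)
    (hf : Summable fun u : ℕ => ‖f₀ u‖)
    (h : Summable fun c : Fin N → ℕ => ‖∏ i, f i (c i)‖) :
    (Summable fun q : ℕ × (Fin N → ℕ) => ‖f₀ q.1 * ∏ i, f i (q.2 i)‖) ∧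
      ∑' q : ℕ × (Fin N → ℕ), f₀ q.1 * ∏ i, f i (q.2 i) =
        (∑' u, f₀ u) * ∑' c : Fin N → ℕ, ∏ i, f i (c i) :=
  ⟨Summable.mul_norm (g := fun c : Fin N → ℕ => ∏ i, f i (c i)) hf h,
    (tsum_mul_tsum_of_summable_norm (g := fun c : Fin N → ℕ => ∏ i, f i (c i)) hf h).symm⟩

theorem summable_and_tsum_prod_cons {N : ℕ} (f : Fin (N + 1) → ℕ → ℂ)
    (hf : Summable fun u : ℕ => ‖f 0 u‖)
    (h : Summable fun c : Fin N → ℕ => ‖∏ i, f i.succ (c i)‖) :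
    (Summable fun c : Fin (N + 1) → ℕ => ‖∏ i, f i (c i)‖) ∧
      ∑' c : Fin (N + 1) → ℕ, ∏ i, f i (c i) =
        (∑' u, f 0 u) * ∑' c : Fin N → ℕ, ∏ i, f i.succ (c i) := by
  obtain ⟨h1, h2⟩ := summable_and_tsum_mul_prod (f 0) (fun i => f i.succ) hf h
  have hE : ∀ q : ℕ × (Fin N → ℕ), ∏ o, f o (Fin.consEquiv (fun _ => ℕ) q o) =
      f 0 q.1 * ∏ a, f a.succ (q.2 a) := by
    intro q
    rw [Fin.prod_univ_succ]
    simp [Fin.consEquiv]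
  constructor
  · rw [← (Fin.consEquiv fun _ : Fin (N + 1) => ℕ).summable_iff]
    simp only [Function.comp_def, hE]
    exact h1
  · rw [← (Fin.consEquiv fun _ : Fin (N + 1) => ℕ).tsum_eq fun c => ∏ i, f i (c i)]
    simp only [hE]
    exact h2

theorem summable_and_tsum_prod_fin (N : ℕ) (f : Fin N → ℕ → ℂ)
    (hf : ∀ i, Summable fun u => ‖f i u‖) :
    (Summable fun c : Fin N → ℕ => ‖∏ i, f i (c i)‖) ∧
      ∑' c : Fin N → ℕ, ∏ i, f i (c i) = ∏ i, ∑' u, f i u := by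
  induction N with
  | zero =>
    refine ⟨(hasSum_fintype _).summable, ?_⟩
    simp [tsum_fintype]
  | succ N ih =>
    obtain ⟨h1, h2⟩ := ih (fun a => f a.succ) fun a => hf a.succ
    obtain ⟨h3, h4⟩ := summable_and_tsum_prod_cons f (hf 0) h1
    exact ⟨h3, by rw [h4, h2, Fin.prod_univ_succ]⟩

theorem summable_and_tsum_prod_pi {ι : Type} [Fintype ι] (f : ι → ℕ → ℂ)
    (hf : ∀ i, Summable fun u => ‖f i u‖) :
    (Summable fun c : ι → ℕ => ‖∏ i, f i (c i)‖) ∧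
      ∑' c : ι → ℕ, ∏ i, f i (c i) = ∏ i, ∑' u, f i u := by
  have e := (Fintype.equivFin ι).symm
  obtain ⟨h1, h2⟩ := summable_and_tsum_prod_fin _ (fun a => f (e a)) fun a => hf (e a)
  let E : (Fin (Fintype.card ι) → ℕ) ≃ (ι → ℕ) := e.arrowCongr (Equiv.refl ℕ)
  have hE : ∀ c, ∏ b, f b (E c b) = ∏ a, f (e a) (c a) := by
    intro c
    rw [← e.prod_comp]
    simp [E]
  rw [← E.summable_iff, ← E.tsum_eq, ← e.prod_comp]
  simp only [Function.comp_def, hE]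
  exact ⟨h1, h2⟩

end PiSums

/-! ### Ladder sums, common to vacuum modules and Verma modules -/

section Ladder

variable {ι : Type} [Fintype ι] {n : ℕ} (R : Fin n → ι → ℝ) (θ : ι → ℝ) (ζ : Fin n → ℝ)
  (σ : ι → ℝ) (sg : ι → ℂ)

/-- The total level. -/
def level (c : ι → ℕ) : ℝ := ∑ i, ((c i : ℝ) + 1 / 2)

/-- The eigenvalues on a ladder. -/
def ladder (c : ι → ℕ) (i : ι) : ℂ := -(σ i : ℂ) * ((c i : ℂ) + 1 / 2) + Complex.I * θ i

/-- The weights of the `h_s`. -/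
def ladderWeight (c : ι → ℕ) (s : Fin n) : ℂ :=
  ∑ i, (R s i : ℂ) * ladder θ σ c i - Complex.I * ζ s

/-- The terms of the trace of a polynomial in the `h_s`. -/
def ladderTerm (p : MvPolynomial (Fin n) ℂ) (z : ι → ℝ) (c : ι → ℕ) : ℂ :=
  (∏ i, sg i ^ c i) * Complex.exp (2 * Real.pi * ∑ i, (z i : ℂ) * ladder θ σ c i) *
    p.eval (ladderWeight R θ ζ σ c)

/-- The trace of a polynomial in the `h_s`. -/
def ladderTrace (p : MvPolynomial (Fin n) ℂ) (z : ι → ℝ) : ℂ :=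
  ∑' c, ladderTerm R θ ζ σ sg p z c

theorem half_le_level (c : ι → ℕ) (i : ι) : (c i : ℝ) + 1 / 2 ≤ level c :=
  Finset.single_le_sum (f := fun i => (c i : ℝ) + 1 / 2) (fun _ _ => by positivity)
    (Finset.mem_univ i)

theorem level_nonneg (c : ι → ℕ) : 0 ≤ level c := Finset.sum_nonneg fun _ _ => by positivity

theorem summable_exp_neg_mul_level {η : ℝ} (hη : 0 < η) :
    Summable fun c : ι → ℕ => Real.exp (-η * level c) := by
  have h1 : ∀ i : ι, Summable fun u : ℕ =>
      ‖((Real.exp (-η * ((u : ℝ) + 1 / 2)) : ℝ) : ℂ)‖ := by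
    intro i
    have : ∀ u : ℕ, ‖((Real.exp (-η * ((u : ℝ) + 1 / 2)) : ℝ) : ℂ)‖ =
        Real.exp (-η / 2) * Real.exp (-η) ^ u := by
      intro u
      rw [Complex.norm_real, Real.norm_of_nonneg (Real.exp_pos _).le, ← Real.exp_nat_mul,
        ← Real.exp_add]
      congr 1; ring
    simp only [this]
    exact (summable_geometric_of_lt_one (Real.exp_pos _).le
      (by rw [Real.exp_lt_one_iff]; linarith)).mul_left _
  refine (summable_and_tsum_prod_pi _ h1).1.congr fun c => ?_
  rw [norm_prod]
  simp only [Complex.norm_real, Real.norm_of_nonneg (Real.exp_pos _).le]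
  rw [← Real.exp_sum, level, Finset.mul_sum]

theorem exists_norm_ladder_le (hσ : ∀ i, |σ i| = 1) (s : Fin n) :
    ∃ K : ℝ, 0 ≤ K ∧ ∀ c, ‖∑ i, (R s i : ℂ) * ladder θ σ c i‖ ≤ K * (level c + 1) := by
  refine ⟨∑ i, |R s i| * (1 + |θ i|), Finset.sum_nonneg fun i _ => by positivity, fun c => ?_⟩
  refine (norm_sum_le _ _).trans ?_
  rw [Finset.sum_mul]
  refine Finset.sum_le_sum fun i _ => ?_
  rw [norm_mul, Complex.norm_real, Real.norm_eq_abs, mul_assoc]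
  refine mul_le_mul_of_nonneg_left ?_ (abs_nonneg _)
  have h1 : ‖ladder θ σ c i‖ ≤ ((c i : ℝ) + 1 / 2) + |θ i| := by
    refine (norm_add_le _ _).trans (add_le_add ?_ ?_)
    · rw [norm_mul, norm_neg, Complex.norm_real, Real.norm_eq_abs, hσ i, one_mul]
      have : ((c i : ℂ) + 1 / 2) = (((c i : ℝ) + 1 / 2 : ℝ) : ℂ) := by push_cast; rfl
      rw [this, Complex.norm_real, Real.norm_of_nonneg (by positivity)]
    · rw [norm_mul, Complex.norm_I, one_mul, Complex.norm_real, Real.norm_eq_abs]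
  have h2 := half_le_level c i
  nlinarith [abs_nonneg (θ i), level_nonneg c]

theorem level_add_one_le {ε : ℝ} (hε : 0 < ε) (c : ι → ℕ) :
    level c + 1 ≤ (1 + ε⁻¹) * Real.exp (ε * level c) := by
  have h1 := Real.add_one_le_exp (ε * level c)
  have h2 := level_nonneg c
  have h3 : 0 ≤ ε⁻¹ := by positivity
  have h4 : (1 + ε⁻¹) * (ε * level c + 1) ≤ (1 + ε⁻¹) * Real.exp (ε * level c) :=
    mul_le_mul_of_nonneg_left h1 (by positivity)
  have h5 : ε⁻¹ * ε = 1 := inv_mul_cancel₀ hε.ne'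
  nlinarith [mul_nonneg hε.le h2]

/-- Weights grow linearly in the level, so any small exponential dominates a polynomial in them;
each new variable takes half of the exponent `ε`. -/
theorem exists_norm_eval_le (hσ : ∀ i, |σ i| = 1) (p : MvPolynomial (Fin n) ℂ) :
    ∀ ε > 0, ∃ K : ℝ, 0 ≤ K ∧ ∀ c, ‖p.eval (ladderWeight R θ ζ σ c)‖ ≤
      K * Real.exp (ε * level c) := by
  induction p using MvPolynomial.induction_on with
  | C a =>
    intro ε hε
    refine ⟨‖a‖, norm_nonneg a, fun c => ?_⟩
    rw [MvPolynomial.eval_C]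
    refine le_mul_of_one_le_right (norm_nonneg a) (Real.one_le_exp ?_)
    exact mul_nonneg hε.le (level_nonneg c)
  | add p q hp hq =>
    intro ε hε
    obtain ⟨K, hK, hp⟩ := hp ε hε
    obtain ⟨L, hL, hq⟩ := hq ε hε
    refine ⟨K + L, by positivity, fun c => ?_⟩
    rw [map_add, add_mul]
    exact (norm_add_le _ _).trans (add_le_add (hp c) (hq c))
  | mul_X p s hp =>
    intro ε hε
    obtain ⟨K, hK, hp⟩ := hp (ε / 2) (by positivity)
    obtain ⟨L, hL, hs⟩ := exists_norm_ladder_le R θ σ hσ s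
    refine ⟨K * ((L + |ζ s|) * (1 + (ε / 2)⁻¹)), by positivity, fun c => ?_⟩
    rw [map_mul, MvPolynomial.eval_X, norm_mul]
    have h1 : ‖ladderWeight R θ ζ σ c s‖ ≤ (L + |ζ s|) * (level c + 1) := by
      refine (norm_sub_le _ _).trans ?_
      rw [norm_mul, Complex.norm_I, one_mul, Complex.norm_real, Real.norm_eq_abs, add_mul]
      refine add_le_add (hs c) (le_mul_of_one_le_right (abs_nonneg _) ?_)
      linarith [level_nonneg c]
    have h2 : ‖ladderWeight R θ ζ σ c s‖ ≤
        (L + |ζ s|) * (1 + (ε / 2)⁻¹) * Real.exp (ε / 2 * level c) := by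
      rw [mul_assoc]
      exact h1.trans (mul_le_mul_of_nonneg_left (level_add_one_le (by positivity) c) (by positivity))
    calc _ ≤ (K * Real.exp (ε / 2 * level c)) *
        ((L + |ζ s|) * (1 + (ε / 2)⁻¹) * Real.exp (ε / 2 * level c)) :=
          mul_le_mul (hp c) h2 (norm_nonneg _) (by positivity)
      _ = K * ((L + |ζ s|) * (1 + (ε / 2)⁻¹)) *
        (Real.exp (ε / 2 * level c) * Real.exp (ε / 2 * level c)) := by ring
      _ = _ := by
        rw [← Real.exp_add]
        congr 2; ring

theorem re_sum_mul_ladder (z : ι → ℝ) (c : ι → ℕ) :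
    (∑ i, (z i : ℂ) * ladder θ σ c i).re = -∑ i, σ i * z i * ((c i : ℝ) + 1 / 2) := by
  rw [Complex.re_sum, ← Finset.sum_neg_distrib]
  refine Finset.sum_congr rfl fun i _ => ?_
  have h : ladder θ σ c i = ((-(σ i) * ((c i : ℝ) + 1 / 2) : ℝ) : ℂ) + ((θ i : ℝ) : ℂ) * Complex.I := by
    unfold ladder; push_cast; ring
  rw [h, Complex.re_ofReal_mul]
  simp
  ring

theorem norm_ladderTerm (hsg : ∀ i, ‖sg i‖ = 1) (p : MvPolynomial (Fin n) ℂ) (z : ι → ℝ)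
    (c : ι → ℕ) : ‖ladderTerm R θ ζ σ sg p z c‖ =
      Real.exp (-(2 * Real.pi) * ∑ i, σ i * z i * ((c i : ℝ) + 1 / 2)) *
        ‖p.eval (ladderWeight R θ ζ σ c)‖ := by
  rw [ladderTerm, norm_mul, norm_mul, norm_prod, Complex.norm_exp]
  simp only [norm_pow, hsg, one_pow, Finset.prod_const_one, one_mul]
  congr 2
  have h : (2 * Real.pi : ℂ) = ((2 * Real.pi : ℝ) : ℂ) := by push_cast; rfl
  rw [h, Complex.re_ofReal_mul, re_sum_mul_ladder]
  ring

/-- Half of the decay rate `2πη` is spent on the polynomial. The constant does not depend on `z`,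
which allows differentiation under the sum. -/
theorem exists_norm_ladderTerm_le (hσ : ∀ i, |σ i| = 1) (hsg : ∀ i, ‖sg i‖ = 1)
    (p : MvPolynomial (Fin n) ℂ) {η : ℝ} (hη : 0 < η) :
    ∃ K : ℝ, 0 ≤ K ∧ ∀ z : ι → ℝ, (∀ i, η ≤ σ i * z i) → ∀ c,
      ‖ladderTerm R θ ζ σ sg p z c‖ ≤ K * Real.exp (-(Real.pi * η) * level c) := by
  have hpi := Real.pi_pos
  obtain ⟨K, hK, h⟩ := exists_norm_eval_le R θ ζ σ hσ p (Real.pi * η) (by positivity)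
  refine ⟨K, hK, fun z hz c => ?_⟩
  rw [norm_ladderTerm R θ ζ σ sg hsg]
  have h1 : η * level c ≤ ∑ i, σ i * z i * ((c i : ℝ) + 1 / 2) := by
    rw [level, Finset.mul_sum]
    exact Finset.sum_le_sum fun i _ => mul_le_mul_of_nonneg_right (hz i) (by positivity)
  calc _ ≤ Real.exp (-(2 * Real.pi) * (η * level c)) * (K * Real.exp (Real.pi * η * level c)) := by
        refine mul_le_mul (Real.exp_le_exp.2 ?_) (h c) (norm_nonneg _) (Real.exp_pos _).le
        nlinarith
    _ = K * (Real.exp (-(2 * Real.pi) * (η * level c)) * Real.exp (Real.pi * η * level c)) := by ring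
    _ = _ := by
      rw [← Real.exp_add]
      congr 2; ring

theorem exists_pos_le {κ : Type*} [Finite κ] {z : κ → ℝ} (hz : ∀ i, 0 < z i) : ∃ η > 0, ∀ i, η < z i := by
  have hev : ∀ᶠ η in nhdsWithin (0 : ℝ) (Set.Ioi 0), ∀ i, η < z i :=
    Filter.eventually_all.2 fun i => nhdsWithin_le_nhds (eventually_lt_nhds (hz i))
  obtain ⟨η, h, h0⟩ := (hev.and self_mem_nhdsWithin).exists
  exact ⟨η, h0, h⟩

variable {R θ ζ σ sg}

theorem summable_ladderTerm (hσ : ∀ i, |σ i| = 1) (hsg : ∀ i, ‖sg i‖ = 1)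
    (p : MvPolynomial (Fin n) ℂ) {z : ι → ℝ} (hz : ∀ i, 0 < σ i * z i) :
    Summable (ladderTerm R θ ζ σ sg p z) := by
  obtain ⟨η, hη, hηz⟩ := exists_pos_le hz
  obtain ⟨K, hK, h⟩ := exists_norm_ladderTerm_le R θ ζ σ sg hσ hsg p hη
  have hpi := Real.pi_pos
  exact Summable.of_norm_bounded ((summable_exp_neg_mul_level (by positivity)).mul_left K)
    (h z fun i => (hηz i).le)

theorem ladderTerm_mul_X (p : MvPolynomial (Fin n) ℂ) (s : Fin n) (z : ι → ℝ) (c : ι → ℕ) :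
    ladderTerm R θ ζ σ sg (p * MvPolynomial.X s) z c =
      ladderTerm R θ ζ σ sg p z c * (∑ i, (R s i : ℂ) * ladder θ σ c i) -
        Complex.I * ζ s * ladderTerm R θ ζ σ sg p z c := by
  simp only [ladderTerm, map_mul, MvPolynomial.eval_X, ladderWeight]
  ring

/-- The derivative of a trace in a direction `R_s` inserts `h_s + i ζ_s`. -/
theorem hasDerivAt_ladderTrace (hσ : ∀ i, |σ i| = 1) (hsg : ∀ i, ‖sg i‖ = 1)
    (p : MvPolynomial (Fin n) ℂ) {z : ι → ℝ} (hz : ∀ i, 0 < σ i * z i) (s : Fin n) :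
    HasDerivAt (fun τ : ℝ => ladderTrace R θ ζ σ sg p fun i => z i + τ * R s i)
      (2 * Real.pi * (ladderTrace R θ ζ σ sg (p * MvPolynomial.X s) z +
        Complex.I * ζ s * ladderTrace R θ ζ σ sg p z)) 0 := by
  obtain ⟨η, hη, hηz⟩ := exists_pos_le hz
  -- The signs `σ` stay fixed while `z` moves; on a small ball every `σ_i z_i` remains above `η`,
  -- giving one summable bound for all terms.
  obtain ⟨δ, hδ, hball⟩ : ∃ δ > 0, ∀ τ ∈ Metric.ball (0 : ℝ) δ, ∀ i, η ≤ σ i * (z i + τ * R s i) := by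
    have hev : ∀ᶠ τ in nhds (0 : ℝ), ∀ i, η < σ i * (z i + τ * R s i) := by
      refine Filter.eventually_all.2 fun i => ?_
      have hc : ContinuousAt (fun τ : ℝ => σ i * (z i + τ * R s i)) 0 := by fun_prop
      refine hc.eventually_const_lt ?_
      simpa using hηz i
    obtain ⟨δ, hδ, h⟩ := Metric.eventually_nhds_iff_ball.1 hev
    exact ⟨δ, hδ, fun τ hτ i => (h τ hτ i).le⟩
  obtain ⟨K, hK, hKb⟩ := exists_norm_ladderTerm_le R θ ζ σ sg hσ hsg p hη
  obtain ⟨L, hL, hLb⟩ := exists_norm_ladderTerm_le R θ ζ σ sg hσ hsg (p * MvPolynomial.X s) hη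
  have hpi := Real.pi_pos
  set v : (ι → ℕ) → ℂ := fun c => ∑ i, (R s i : ℂ) * ladder θ σ c i with hv
  have hterm : ∀ c, ∀ τ : ℝ, HasDerivAt
      (fun τ : ℝ => ladderTerm R θ ζ σ sg p (fun i => z i + τ * R s i) c)
      (2 * Real.pi * (ladderTerm R θ ζ σ sg p (fun i => z i + τ * R s i) c * v c)) τ := by
    intro c τ
    have h1 : ∀ τ : ℝ, 2 * Real.pi * ∑ i, ((z i + τ * R s i : ℝ) : ℂ) * ladder θ σ c i =
        2 * Real.pi * ∑ i, (z i : ℂ) * ladder θ σ c i + (τ : ℂ) * (2 * Real.pi * v c) := by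
      intro τ
      simp only [hv, Finset.mul_sum]
      rw [← Finset.sum_add_distrib]
      refine Finset.sum_congr rfl fun i _ => ?_
      push_cast; ring
    have h2 : HasDerivAt (fun τ : ℝ => 2 * Real.pi * ∑ i, ((z i + τ * R s i : ℝ) : ℂ) * ladder θ σ c i)
        (2 * Real.pi * v c) τ := by
      simp only [h1]
      have := (Complex.ofRealCLM.hasDerivAt (x := τ)).mul_const (2 * Real.pi * v c)
      simpa using this.const_add (2 * Real.pi * ∑ i, (z i : ℂ) * ladder θ σ c i)
    have h3 := ((h2.cexp).const_mul (∏ i, sg i ^ c i)).mul_const (p.eval (ladderWeight R θ ζ σ c))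
    refine h3.congr_deriv ?_
    simp only [ladderTerm]
    ring
  have hbound : ∀ c, ∀ τ ∈ Metric.ball (0 : ℝ) δ,
      ‖2 * Real.pi * (ladderTerm R θ ζ σ sg p (fun i => z i + τ * R s i) c * v c)‖ ≤
        2 * Real.pi * (L + |ζ s| * K) * Real.exp (-(Real.pi * η) * level c) := by
    intro c τ hτ
    have h1 : ladderTerm R θ ζ σ sg p (fun i => z i + τ * R s i) c * v c =
        ladderTerm R θ ζ σ sg (p * MvPolynomial.X s) (fun i => z i + τ * R s i) c +
          Complex.I * ζ s * ladderTerm R θ ζ σ sg p (fun i => z i + τ * R s i) c := by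
      rw [ladderTerm_mul_X]; ring
    have h2 : ‖(2 * Real.pi : ℂ)‖ = 2 * Real.pi := by
      simp [abs_of_pos hpi]
    rw [norm_mul, h1, h2, mul_assoc (2 * Real.pi)]
    refine mul_le_mul_of_nonneg_left ((norm_add_le _ _).trans ?_) (by positivity)
    rw [norm_mul, norm_mul, Complex.norm_I, one_mul, Complex.norm_real, Real.norm_eq_abs, add_mul,
      mul_assoc]
    exact add_le_add (hLb _ (hball τ hτ) c)
      (mul_le_mul_of_nonneg_left (hKb _ (hball τ hτ) c) (abs_nonneg _))
  have hz0 : (fun i => z i + (0 : ℝ) * R s i) = z := by ext; simp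
  have hder := hasDerivAt_tsum_of_isPreconnected
    ((summable_exp_neg_mul_level (ι := ι) (η := Real.pi * η) (by positivity)).mul_left
      (2 * Real.pi * (L + |ζ s| * K))) Metric.isOpen_ball (convex_ball (0 : ℝ) δ).isPreconnected
    (fun c τ _ => hterm c τ) hbound (Metric.mem_ball_self hδ)
    (by rw [hz0]; exact summable_ladderTerm hσ hsg p hz) (Metric.mem_ball_self hδ)
  refine hder.congr_deriv ?_
  rw [hz0, ladderTrace, ladderTrace, ← tsum_mul_left, ← (summable_ladderTerm hσ hsg _ hz).tsum_add
    ((summable_ladderTerm hσ hsg p hz).mul_left _), ← tsum_mul_left]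
  refine tsum_congr fun c => ?_
  rw [ladderTerm_mul_X]
  ring

/-- A product of geometric series, one for each ladder; the shift by `1/2` makes the denominators
symmetric in `±πσz`. -/
theorem ladderTrace_one (hsg : ∀ i, ‖sg i‖ = 1)
    {z : ι → ℝ} (hz : ∀ i, 0 < σ i * z i) :
    ladderTrace R θ ζ σ sg 1 z = ∏ i, (Complex.exp (2 * Real.pi * (z i * (Complex.I * θ i))) *
      (Complex.exp (Real.pi * (σ i * z i)) - sg i * Complex.exp (-(Real.pi * (σ i * z i))))⁻¹) := by
  have hpi := Real.pi_pos
  set f : ι → ℕ → ℂ := fun i u => Complex.exp (2 * Real.pi * (z i * (Complex.I * θ i))) *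
    Complex.exp (-(Real.pi * (σ i * z i))) *
      (sg i * Complex.exp (-(2 * Real.pi * (σ i * z i)))) ^ u with hf
  have hq : ∀ i, ‖sg i * Complex.exp (-(2 * Real.pi * (σ i * z i)))‖ < 1 := by
    intro i
    have h : Complex.exp (-(2 * Real.pi * (σ i * z i))) =
        ((Real.exp (-(2 * Real.pi * (σ i * z i))) : ℝ) : ℂ) := by push_cast; rfl
    rw [norm_mul, hsg, one_mul, h, Complex.norm_real, Real.norm_of_nonneg (Real.exp_pos _).le,
      Real.exp_lt_one_iff]
    have := mul_pos hpi (hz i)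
    linarith
  have hfs : ∀ i, Summable fun u => ‖f i u‖ := by
    intro i
    simp only [hf, norm_mul, norm_pow]
    refine (summable_geometric_of_lt_one (by positivity) ?_).mul_left _
    rw [← norm_mul]; exact hq i
  have h1 := (summable_and_tsum_prod_pi f hfs).2
  have h2 : ladderTrace R θ ζ σ sg 1 z = ∑' c : ι → ℕ, ∏ i, f i (c i) := by
    refine tsum_congr fun c => ?_
    simp only [ladderTerm, map_one, mul_one, hf, Finset.mul_sum, Complex.exp_sum]
    rw [← Finset.prod_mul_distrib]
    refine Finset.prod_congr rfl fun i _ => ?_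
    rw [mul_pow, ← Complex.exp_nat_mul, mul_left_comm (Complex.exp _ * Complex.exp _) (sg i ^ c i),
      ← Complex.exp_add, ← Complex.exp_add]
    congr 2
    simp only [ladder]
    ring
  rw [h2, h1]
  refine Finset.prod_congr rfl fun i _ => ?_
  simp only [hf]
  rw [tsum_mul_left, tsum_geometric_of_norm_lt_one (hq i), mul_assoc]
  congr 1
  have h3 : Complex.exp (Real.pi * (σ i * z i)) - sg i * Complex.exp (-(Real.pi * (σ i * z i))) =
      Complex.exp (Real.pi * (σ i * z i)) *
        (1 - sg i * Complex.exp (-(2 * Real.pi * (σ i * z i)))) := by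
    rw [mul_sub, mul_one, mul_left_comm (Complex.exp _), ← Complex.exp_add]
    congr 3; ring
  rw [h3, mul_inv, ← Complex.exp_neg]

end Ladder

open MeasureTheory

/-! ## Integrands of monomials and their derivatives -/

/-- The polynomials `q_a` with `(d/dx)^a sech x = 2 ^ a q_a(tanh x) sech x`. -/
def tanhPoly : ℕ → Polynomial ℝ
  | 0 => 1
  | a + 1 => Polynomial.C (1 / 2) *
      (Polynomial.derivative (tanhPoly a) * (1 - Polynomial.X ^ 2) - Polynomial.X * tanhPoly a)

/-- The function `(1 / (2π) d/db)^a (1 / (2 cosh (π b)))`. -/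
def sechDeriv (a : ℕ) (b : ℝ) : ℝ :=
  (tanhPoly a).eval (Real.tanh (Real.pi * b)) * (2 * Real.cosh (Real.pi * b))⁻¹

theorem hasDerivAt_tanh (x : ℝ) : HasDerivAt Real.tanh (1 - Real.tanh x ^ 2) x := by
  have h : Real.tanh = fun x => Real.sinh x / Real.cosh x := by
    ext x; exact Real.tanh_eq_sinh_div_cosh x
  have hc := (Real.cosh_pos x).ne'
  rw [h]
  refine ((Real.hasDerivAt_sinh x).div (Real.hasDerivAt_cosh x) hc).congr_deriv ?_
  field_simp

theorem hasDerivAt_sechDeriv (a : ℕ) (b : ℝ) :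
    HasDerivAt (sechDeriv a) (2 * Real.pi * sechDeriv (a + 1) b) b := by
  have hc := (Real.cosh_pos (Real.pi * b)).ne'
  have h0 : HasDerivAt (fun b : ℝ => Real.pi * b) Real.pi b := by
    simpa using (hasDerivAt_id b).const_mul Real.pi
  have h1 := ((tanhPoly a).hasDerivAt (Real.tanh (Real.pi * b))).comp b
    ((hasDerivAt_tanh (Real.pi * b)).comp b h0)
  have h2 := (((((Real.hasDerivAt_cosh (Real.pi * b)).comp b h0).const_mul 2)).inv
    (mul_ne_zero two_ne_zero hc) :
      HasDerivAt (fun b : ℝ => (2 * Real.cosh (Real.pi * b))⁻¹) _ b)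
  refine (h1.mul h2).congr_deriv ?_
  simp only [sechDeriv, tanhPoly, Polynomial.eval_mul, Polynomial.eval_sub, Polynomial.eval_C,
    Polynomial.eval_X, Polynomial.eval_one, Polynomial.eval_pow, Function.comp_apply, Function.comp_def,
    Pi.inv_apply, Real.tanh_eq_sinh_div_cosh]
  field_simp
  ring

theorem continuous_sechDeriv (a : ℕ) : Continuous (sechDeriv a) :=
  continuous_iff_continuousAt.2 fun b => (hasDerivAt_sechDeriv a b).continuousAt

theorem exists_abs_eval_le (q : Polynomial ℝ) :
    ∃ K : ℝ, 0 ≤ K ∧ ∀ x, |x| < 1 → |q.eval x| ≤ K := by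
  obtain ⟨K, hK⟩ := (isCompact_Icc (a := (-1 : ℝ)) (b := 1)).exists_bound_of_continuousOn
    q.continuous.continuousOn
  refine ⟨K, (norm_nonneg _).trans (hK 0 (by norm_num)), fun x hx => ?_⟩
  exact hK x ⟨(abs_lt.1 hx).1.le, (abs_lt.1 hx).2.le⟩

theorem exists_abs_sechDeriv_le (a : ℕ) :
    ∃ K : ℝ, 0 ≤ K ∧ ∀ b, |sechDeriv a b| ≤ K * Real.exp (-Real.pi * |b|) := by
  obtain ⟨K, hK, h⟩ := exists_abs_eval_le (tanhPoly a)
  refine ⟨K, hK, fun b => ?_⟩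
  have hpos : 0 < 2 * Real.cosh (Real.pi * b) := by have := Real.cosh_pos (Real.pi * b); positivity
  rw [sechDeriv, abs_mul, abs_inv, abs_of_pos hpos]
  refine mul_le_mul (h _ (Real.abs_tanh_lt_one _)) ?_ (by positivity) hK
  rw [neg_mul, Real.exp_neg]
  refine inv_anti₀ (Real.exp_pos _) ?_
  rw [← Real.cosh_abs, abs_mul, abs_of_pos Real.pi_pos, Real.cosh_eq]
  have := Real.exp_pos (-(Real.pi * |b|))
  linarith

variable {n k d : ℕ} (ζ : Fin n → ℝ)

/-- The integrand of the sphere trace of the monomial `∏ h_j ^ a_j`. -/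
def hyperIntegrand (a : Fin n → ℕ) (b : Fin n → ℝ) : ℂ :=
  ∏ j, Complex.exp (2 * Real.pi * Complex.I * (b j * ζ j)) * (sechDeriv (a j) (b j) : ℂ)

theorem exists_norm_hyperIntegrand_le (a : Fin n → ℕ) :
    ∃ K : ℝ, 0 ≤ K ∧ ∀ b, ‖hyperIntegrand ζ a b‖ ≤ K * ∏ j, Real.exp (-Real.pi * |b j|) := by
  choose K hK h using fun j => exists_abs_sechDeriv_le (a j)
  refine ⟨∏ j, K j, Finset.prod_nonneg fun j _ => hK j, fun b => ?_⟩
  rw [hyperIntegrand, norm_prod, ← Finset.prod_mul_distrib]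
  refine Finset.prod_le_prod (fun _ _ => norm_nonneg _) fun j _ => ?_
  have h1 : ‖Complex.exp (2 * Real.pi * Complex.I * (b j * ζ j))‖ = 1 := by
    have : 2 * Real.pi * Complex.I * (b j * ζ j) =
        ((2 * Real.pi * (b j * ζ j) : ℝ) : ℂ) * Complex.I := by push_cast; ring
    rw [this, Complex.norm_exp_ofReal_mul_I]
  rw [norm_mul, h1, one_mul, Complex.norm_real]
  exact h j (b j)

theorem continuous_hyperIntegrand (a : Fin n → ℕ) : Continuous (hyperIntegrand ζ a) := by
  refine continuous_finsetProd _ fun j _ => ?_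
  have h : Continuous fun b : Fin n → ℝ => ((sechDeriv (a j) (b j) : ℝ) : ℂ) :=
    Complex.continuous_ofReal.comp ((continuous_sechDeriv (a j)).comp (continuous_apply j))
  refine Continuous.mul ?_ h
  fun_prop

theorem hasDerivAt_hyperIntegrand (a : Fin n → ℕ) (b : Fin n → ℝ) (s : Fin n) (τ : ℝ) :
    HasDerivAt (fun τ : ℝ => hyperIntegrand ζ a (b + Pi.single s τ))
      (2 * Real.pi * (hyperIntegrand ζ (a + Pi.single s 1) (b + Pi.single s τ) +
        Complex.I * ζ s * hyperIntegrand ζ a (b + Pi.single s τ))) τ := by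
  have hsplit : ∀ a' : Fin n → ℕ, (∀ j ≠ s, a' j = a j) → ∀ τ : ℝ,
      hyperIntegrand ζ a' (b + Pi.single s τ) =
      (Complex.exp (2 * Real.pi * Complex.I * ((b s + τ : ℝ) * ζ s)) *
        (sechDeriv (a' s) (b s + τ) : ℂ)) *
      ∏ j ∈ Finset.univ.erase s, Complex.exp (2 * Real.pi * Complex.I * (b j * ζ j)) *
        (sechDeriv (a j) (b j) : ℂ) := by
    intro a' ha' τ
    rw [hyperIntegrand, ← Finset.mul_prod_erase _ _ (Finset.mem_univ s)]
    congr 1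
    · simp
    · refine Finset.prod_congr rfl fun j hj => ?_
      have hjs := Finset.ne_of_mem_erase hj
      simp [hjs, ha' j hjs]
  rw [hsplit (a + Pi.single s 1) (fun j hj => by simp [hj])]
  simp only [hsplit a fun _ _ => rfl]
  have h0 : HasDerivAt (fun τ : ℝ => b s + τ) 1 τ := (hasDerivAt_id τ).const_add (b s)
  have h1 : HasDerivAt (fun τ : ℝ => ((sechDeriv (a s) (b s + τ) : ℝ) : ℂ))
      ((2 * Real.pi * sechDeriv (a s + 1) (b s + τ) : ℝ) : ℂ) τ := by
    have := ((hasDerivAt_sechDeriv (a s) (b s + τ)).comp τ h0).ofReal_comp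
    simpa using this
  have h2 : HasDerivAt (fun τ : ℝ => 2 * Real.pi * Complex.I * (((b s + τ : ℝ) : ℂ) * ζ s))
      (2 * Real.pi * Complex.I * ζ s) τ := by
    have := (h0.ofReal_comp.mul_const (ζ s : ℂ)).const_mul (2 * Real.pi * Complex.I)
    simpa using this
  refine ((h2.cexp.mul h1).mul_const _).congr_deriv ?_
  simp only [Pi.add_apply, Pi.single_eq_same]
  push_cast
  ring

theorem contourPoint_add_single (Q : Matrix (Fin n) (Fin k) ℤ) (m : Fin n → ℝ) (s : Fin n) (τ : ℝ)
    (t : Fin k → ℝ) :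
    contourPoint Q (m + Pi.single s τ) t = contourPoint Q m t + Pi.single s τ := by
  ext j
  simp only [contourPoint, Pi.add_apply]
  ring

theorem continuous_contourPoint (Q : Matrix (Fin n) (Fin k) ℤ) (m : Fin n → ℝ) :
    Continuous (contourPoint Q m) := by
  unfold contourPoint
  fun_prop

theorem integrable_hyperIntegrand {Q : Matrix (Fin n) (Fin k) ℤ} {J : Finset (Fin n)}
    (hJ : IsLatticeBasis Q J) (m : Fin n → ℝ) (a : Fin n → ℕ) :
    Integrable fun t : Fin k → ℝ => hyperIntegrand ζ a (contourPoint Q m t) := by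
  obtain ⟨K, hK, h⟩ := exists_norm_hyperIntegrand_le ζ a
  refine ((integrable_prod_exp_contourPoint hJ (Finset.subset_univ J) m Real.pi_pos).const_mul K).mono'
    ((continuous_hyperIntegrand ζ a).comp (continuous_contourPoint Q m)).aestronglyMeasurable ?_
  exact Filter.Eventually.of_forall fun t => h _

theorem prod_exp_add_single_le (b : Fin n → ℝ) (s : Fin n) {τ : ℝ} (hτ : |τ| < 1) :
    ∏ j, Real.exp (-Real.pi * |(b + Pi.single s τ : Fin n → ℝ) j|) ≤
      Real.exp Real.pi * ∏ j, Real.exp (-Real.pi * |b j|) := by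
  have hpi := Real.pi_pos
  rw [← Finset.mul_prod_erase _ _ (Finset.mem_univ s),
    ← Finset.mul_prod_erase Finset.univ (fun j => Real.exp (-Real.pi * |b j|)) (Finset.mem_univ s),
    ← mul_assoc, ← Real.exp_add]
  have h1 : ∏ j ∈ Finset.univ.erase s, Real.exp (-Real.pi * |(b + Pi.single s τ : Fin n → ℝ) j|) =
      ∏ j ∈ Finset.univ.erase s, Real.exp (-Real.pi * |b j|) :=
    Finset.prod_congr rfl fun j hj => by simp [Finset.ne_of_mem_erase hj]
  rw [h1]
  refine mul_le_mul_of_nonneg_right (Real.exp_le_exp.2 ?_)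
    (Finset.prod_nonneg fun _ _ => (Real.exp_pos _).le)
  have h3 : |b s| ≤ |b s + τ| + |τ| := by
    have := abs_sub (b s + τ) τ
    simpa using this
  simp only [Pi.add_apply, Pi.single_eq_same]
  nlinarith

/-- The derivative of `hyperIntegrand` in the direction of `m_s`. -/
def hyperDeriv (a : Fin n → ℕ) (s : Fin n) (b : Fin n → ℝ) : ℂ :=
  2 * Real.pi * (hyperIntegrand ζ (a + Pi.single s 1) b + Complex.I * ζ s * hyperIntegrand ζ a b)

theorem exists_norm_hyperDeriv_le (a : Fin n → ℕ) (s : Fin n) :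
    ∃ K : ℝ, ∀ b : Fin n → ℝ, ∀ τ ∈ Metric.ball (0 : ℝ) 1,
      ‖hyperDeriv ζ a s (b + Pi.single s τ)‖ ≤ K * ∏ j, Real.exp (-Real.pi * |b j|) := by
  obtain ⟨K, hK, hKb⟩ := exists_norm_hyperIntegrand_le ζ a
  obtain ⟨L, hL, hLb⟩ := exists_norm_hyperIntegrand_le ζ (a + Pi.single s 1)
  have hpi := Real.pi_pos
  refine ⟨2 * Real.pi * (L + |ζ s| * K) * Real.exp Real.pi, fun b τ hτ => ?_⟩
  have h1 : ‖(2 * Real.pi : ℂ)‖ = 2 * Real.pi := by simp [abs_of_pos hpi]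
  have h2 := prod_exp_add_single_le b s (by simpa using hτ)
  set c := b + Pi.single s τ
  have h3 := (hLb c).trans (mul_le_mul_of_nonneg_left h2 hL)
  have h4 := (hKb c).trans (mul_le_mul_of_nonneg_left h2 hK)
  have h5 := norm_add_le (hyperIntegrand ζ (a + Pi.single s 1) c)
    (Complex.I * ζ s * hyperIntegrand ζ a c)
  rw [norm_mul (Complex.I * ζ s), norm_mul, Complex.norm_I, one_mul, Complex.norm_real,
    Real.norm_eq_abs] at h5
  have h6 := mul_le_mul_of_nonneg_left h4 (abs_nonneg (ζ s))
  rw [hyperDeriv, norm_mul, h1, mul_assoc (2 * Real.pi), mul_assoc (2 * Real.pi)]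
  refine mul_le_mul_of_nonneg_left ?_ (by positivity)
  refine h5.trans ((add_le_add h3 h6).trans (le_of_eq ?_))
  ring

theorem integrable_hyperDeriv {Q : Matrix (Fin n) (Fin k) ℤ} {J : Finset (Fin n)}
    (hJ : IsLatticeBasis Q J) (m : Fin n → ℝ) (a : Fin n → ℕ) (s : Fin n) :
    Integrable fun t : Fin k → ℝ => hyperDeriv ζ a s (contourPoint Q m t) := by
  have h1 := integrable_hyperIntegrand ζ hJ m (a + Pi.single s 1)
  have h2 := (integrable_hyperIntegrand ζ hJ m a).const_mul (Complex.I * ζ s)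
  exact (h1.add h2).const_mul (2 * Real.pi)

/-- Changing `m_s` translates the contour in direction `s`. For `|τ| < 1` the derivative is
dominated by a multiple of the integrable product of the `e^{-π|b_j|}`, so it passes under the
integral. -/
theorem hasDerivAt_integral_hyperIntegrand {Q : Matrix (Fin n) (Fin k) ℤ} {J : Finset (Fin n)}
    (hJ : IsLatticeBasis Q J) (m : Fin n → ℝ) (a : Fin n → ℕ) (s : Fin n) :
    HasDerivAt (fun τ : ℝ => ∫ t : Fin k → ℝ, hyperIntegrand ζ a (contourPoint Q (m + Pi.single s τ) t))
      (2 * Real.pi * ((∫ t : Fin k → ℝ, hyperIntegrand ζ (a + Pi.single s 1) (contourPoint Q m t)) +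
        Complex.I * ζ s * ∫ t : Fin k → ℝ, hyperIntegrand ζ a (contourPoint Q m t))) 0 := by
  obtain ⟨K, hK⟩ := exists_norm_hyperDeriv_le ζ a s
  have hint : Integrable fun t : Fin k → ℝ =>
      hyperDeriv ζ a s (contourPoint Q m t + Pi.single s (0 : ℝ)) := by
    simpa only [Pi.single_zero, add_zero] using integrable_hyperDeriv ζ hJ m a s
  have hbd : ∀ t : Fin k → ℝ, ∀ τ ∈ Metric.ball (0 : ℝ) 1,
      ‖hyperDeriv ζ a s (contourPoint Q m t + Pi.single s τ)‖ ≤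
        K * ∏ j, Real.exp (-Real.pi * |contourPoint Q m t j|) := fun t τ hτ => hK _ τ hτ
  have hbi : Integrable fun t : Fin k → ℝ =>
      K * ∏ j, Real.exp (-Real.pi * |contourPoint Q m t j|) :=
    (integrable_prod_exp_contourPoint hJ (Finset.subset_univ J) m Real.pi_pos).const_mul K
  have hd : ∀ t : Fin k → ℝ, ∀ τ ∈ Metric.ball (0 : ℝ) 1,
      HasDerivAt (fun τ : ℝ => hyperIntegrand ζ a (contourPoint Q (m + Pi.single s τ) t))
        (hyperDeriv ζ a s (contourPoint Q m t + Pi.single s τ)) τ := fun t τ _ => by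
    simp only [contourPoint_add_single]
    exact hasDerivAt_hyperIntegrand ζ a _ s τ
  have hi : ∀ τ : ℝ, Integrable fun t : Fin k → ℝ =>
      hyperIntegrand ζ a (contourPoint Q (m + Pi.single s τ) t) :=
    fun τ => integrable_hyperIntegrand ζ hJ _ a
  generalize hF : (fun (τ : ℝ) (t : Fin k → ℝ) =>
    hyperIntegrand ζ a (contourPoint Q (m + Pi.single s τ) t)) = F at *
  have hF' : ∀ τ t, hyperIntegrand ζ a (contourPoint Q (m + Pi.single s τ) t) = F τ t :=
    fun τ t => by rw [← hF]
  generalize hG : (fun (τ : ℝ) (t : Fin k → ℝ) =>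
    hyperDeriv ζ a s (contourPoint Q m t + Pi.single s τ)) = G at *
  have hG' : ∀ τ t, hyperDeriv ζ a s (contourPoint Q m t + Pi.single s τ) = G τ t :=
    fun τ t => by rw [← hG]
  simp only [hF', hG'] at hi hint hbd hd ⊢
  have h := (hasDerivAt_integral_of_dominated_loc_of_deriv_le (μ := volume) (F := F) (F' := G)
    (Metric.ball_mem_nhds (0 : ℝ) one_pos) (Filter.Eventually.of_forall fun τ => (hi τ).aestronglyMeasurable)
    (hi 0)    hint.aestronglyMeasurable (Filter.Eventually.of_forall hbd) hbi
    (Filter.Eventually.of_forall hd)).2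
  simp only [← hG'] at h
  refine h.congr_deriv ?_
  have h1 := integrable_hyperIntegrand ζ hJ m (a + Pi.single s 1)
  have h2 := (integrable_hyperIntegrand ζ hJ m a).const_mul (Complex.I * ζ s)
  simp only [Pi.single_zero, add_zero, hyperDeriv]
  rw [integral_const_mul, integral_add h1 h2, integral_const_mul]

/-- The monomial `∏ h_j ^ a_j`. -/
def hMon (a : Fin n → ℕ) : MvPolynomial (Fin n) ℂ :=
  MvPolynomial.monomial (Finsupp.equivFunOnFinite.symm a) 1

theorem hMon_zero : hMon (0 : Fin n → ℕ) = 1 := by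
  have : (Finsupp.equivFunOnFinite.symm (0 : Fin n → ℕ)) = 0 := by ext; simp
  rw [hMon, this]; rfl

theorem hMon_add_single (a : Fin n → ℕ) (s : Fin n) :
    hMon (a + Pi.single s 1) = hMon a * MvPolynomial.X s := by
  have : (Finsupp.equivFunOnFinite.symm (a + Pi.single s 1)) =
      Finsupp.equivFunOnFinite.symm a + Finsupp.single s 1 := by
    ext j; simp [Finsupp.single_eq_pi_single]
  rw [hMon, hMon, this, MvPolynomial.X, MvPolynomial.monomial_mul, mul_one]

/-- The trace of a polynomial in the `h_j` over the vacuum module of `b`. -/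
def fockTrace (b : Fin n → ℝ) (p : MvPolynomial (Fin n) ℂ) : ℂ :=
  ladderTrace (fun s i => if s = i then (1 : ℝ) else 0) ζ ζ (fun j => (SignType.sign (b j) : ℝ))
    (fun _ => -1) p b

theorem abs_sign_eq_one {x : ℝ} (hx : x ≠ 0) : |(SignType.sign x : ℝ)| = 1 := by
  rcases lt_or_gt_of_ne hx with h | h <;> simp [h]

theorem sign_mul_pos {x : ℝ} (hx : x ≠ 0) : 0 < (SignType.sign x : ℝ) * x := by
  rw [sign_mul_self]; exact abs_pos.2 hx

theorem eventually_sign_eq {f : ℝ → ℝ} (hf : ContinuousAt f 0) (h0 : f 0 ≠ 0) :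
    ∀ᶠ τ in nhds (0 : ℝ), SignType.sign (f τ) = SignType.sign (f 0) := by
  rcases lt_or_gt_of_ne h0 with h | h
  · filter_upwards [hf.eventually_lt_const h] with τ hτ
    rw [sign_neg hτ, sign_neg h]
  · filter_upwards [hf.eventually_const_lt h] with τ hτ
    rw [sign_pos hτ, sign_pos h]

/-- Near `b` the signs, and so the module, do not change. Differentiating the formula for `a` in
`b_s` inserts `h_s + iζ_s` on one side and raises the order of the derivative on the other, which
gives the formula for the next monomial. -/
theorem fockTrace_hMon (a : Fin n → ℕ) : ∀ b : Fin n → ℝ, (∀ j, b j ≠ 0) →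
    fockTrace ζ b (hMon a) = hyperIntegrand ζ a b := by
  induction a using pi_nat_induction with
  | zero =>
    intro b hb
    rw [fockTrace, hMon_zero, ladderTrace_one (fun _ => by simp) fun j => sign_mul_pos (hb j),
      hyperIntegrand]
    refine Finset.prod_congr rfl fun j _ => ?_
    congr 1
    · congr 1; ring
    · have h1 : ((SignType.sign (b j) : ℝ) : ℂ) * (b j : ℂ) = ((|b j| : ℝ) : ℂ) := by
        rw [← sign_mul_self]; push_cast; rfl
      rw [h1]
      simp only [sechDeriv, tanhPoly, Polynomial.eval_one, one_mul]
      rw [← Real.cosh_abs, abs_mul, abs_of_pos Real.pi_pos]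
      push_cast
      rw [Complex.cosh]
      congr 1
      ring
  | succ a s ih =>
    intro b hb
    have hev : ∀ᶠ τ in nhds (0 : ℝ), ∀ j, SignType.sign ((b + Pi.single s τ : Fin n → ℝ) j) = SignType.sign (b j) := by
      refine Filter.eventually_all.2 fun j => ?_
      have := eventually_sign_eq (f := fun τ => (b + Pi.single s τ : Fin n → ℝ) j) (by
        by_cases h : j = s
        · subst h; simp only [Pi.add_apply, Pi.single_eq_same]; fun_prop
        · simp only [Pi.add_apply, Pi.single_eq_of_ne h]; fun_prop) (by simpa using hb j)
      simpa using this
    have h1 := hasDerivAt_ladderTrace (R := fun s i => if s = i then (1 : ℝ) else 0) (θ := ζ) (ζ := ζ)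
      (sg := fun _ => -1) (fun j => abs_sign_eq_one (hb j)) (fun _ => by simp) (hMon a)
      (fun j => sign_mul_pos (hb j)) s
    have h2 := hasDerivAt_hyperIntegrand ζ a b s 0
    have h3 : (fun τ : ℝ => hyperIntegrand ζ a (b + Pi.single s τ)) =ᶠ[nhds 0]
        fun τ : ℝ => ladderTrace (fun s i => if s = i then (1 : ℝ) else 0) ζ ζ
          (fun j => (SignType.sign (b j) : ℝ)) (fun _ => -1) (hMon a)
          fun i => b i + τ * (if s = i then (1 : ℝ) else 0) := by
      filter_upwards [hev] with τ hτ
      have hb' : ∀ j, (b + Pi.single s τ : Fin n → ℝ) j ≠ 0 := fun j => by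
        rw [← sign_ne_zero, hτ j, sign_ne_zero]; exact hb j
      rw [← ih _ hb', fockTrace]
      simp only [hτ]
      congr 1
      ext i
      by_cases h : s = i
      · subst h; simp
      · simp [h, Ne.symm h]
    have h4 := (h1.congr_of_eventuallyEq h3).unique h2
    simp only [Pi.single_zero, add_zero] at h4
    have hpi : (2 * Real.pi : ℂ) ≠ 0 := by simp [Real.pi_ne_zero]
    have h5 := mul_left_cancel₀ hpi h4
    rw [← ih b hb, fockTrace] at h5
    rw [fockTrace, hMon_add_single]
    exact add_right_cancel h5

/-! ## Phases -/

/-- As powers of `i` the phases multiply by adding exponents. -/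
theorem sechPhase_eq (r : ℤ) : sechPhase r = Complex.I ^ (1 - r) := by
  obtain ⟨q, s, hs, rfl⟩ : ∃ q s : ℤ, (s = 0 ∨ s = 1 ∨ s = 2 ∨ s = 3) ∧ r = 4 * q + s :=
    ⟨r / 4, r % 4, by omega, by omega⟩
  have h4 : Complex.I ^ (4 : ℤ) = 1 := by
    rw [show (4 : ℤ) = ((4 : ℕ) : ℤ) from rfl, zpow_natCast, Complex.I_pow_four]
  have h : Complex.I ^ (1 - (4 * q + s)) = Complex.I ^ (1 - s) := by
    rw [show 1 - (4 * q + s) = 4 * (-q) + (1 - s) by ring, zpow_add₀ Complex.I_ne_zero, zpow_mul, h4,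
      one_zpow, one_mul]
  have h2 : Complex.I ^ (-1 : ℤ) = -Complex.I := by
    rw [zpow_neg_one, Complex.inv_I]
  have h3 : Complex.I ^ (-2 : ℤ) = -1 := by
    rw [show (-2 : ℤ) = -1 + -1 by norm_num, zpow_add₀ Complex.I_ne_zero, h2]
    simp
  rw [h, sechPhase, wp]
  rcases hs with rfl | rfl | rfl | rfl
  · have he : Even (4 * q + 0) := ⟨2 * q, by ring⟩
    rw [if_pos (by omega), if_pos he]
    simp
  · have he : ¬Even (4 * q + 1) := by rw [Int.not_even_iff_odd]; exact ⟨2 * q, by ring⟩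
    rw [if_pos (by omega), if_neg he]
    simp
  · have he : Even (4 * q + 2) := ⟨2 * q + 1, by ring⟩
    rw [if_neg (by omega), if_pos he, show (1 - 2 : ℤ) = -1 by norm_num, h2]
    simp
  · have he : ¬Even (4 * q + 3) := by rw [Int.not_even_iff_odd]; exact ⟨2 * q + 1, by ring⟩
    rw [if_neg (by omega), if_neg he, show (1 - 3 : ℤ) = -2 by norm_num, h3]
    simp

theorem half_CS (r : ℤ) (x : ℝ) : ((1 / 2 * CS r x : ℝ) : ℂ) =
    (Complex.exp x - (-1) ^ r * Complex.exp (-x))⁻¹ := by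
  unfold CS
  split_ifs with hr
  · rw [hr.neg_one_zpow, Real.sinh_eq]
    push_cast
    rw [← one_div, ← one_div, div_div_eq_mul_div]
    ring
  · rw [(Int.not_even_iff_odd.1 hr).neg_one_zpow, Real.cosh_eq]
    push_cast
    rw [neg_one_mul, sub_neg_eq_add, ← one_div, ← one_div, div_div_eq_mul_div]
    ring

theorem CS_congr {r s : ℤ} (h : Even (r - s)) (x : ℝ) : CS r x = CS s x := by
  have : Even r ↔ Even s := by
    rw [Int.even_sub] at h; exact h
  simp [CS, this]

/-- In the exponential form of the sine the real part `r/2` contributes powers of `i`, and the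
imaginary part leaves the real exponentials of `half_CS`. -/
theorem inv_two_sin (r : ℤ) (y : ℝ) :
    (2 * Complex.sin (Real.pi * ((r : ℂ) / 2 + Complex.I * y)))⁻¹ =
      Complex.I ^ (r - 1) * ((1 / 2 * CS r (Real.pi * y) : ℝ) : ℂ) := by
  have hI : ∀ r : ℤ, Complex.I ^ r = Complex.exp (r * (Real.pi / 2 * Complex.I)) := fun r => by
    rw [Complex.exp_int_mul, Complex.exp_pi_div_two_mul_I]
  have h1 : Complex.exp (-(Real.pi * ((r : ℂ) / 2 + Complex.I * y)) * Complex.I) =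
      Complex.I ^ (-r) * Complex.exp (Real.pi * y) := by
    rw [hI, ← Complex.exp_add]
    congr 1
    push_cast
    linear_combination (-(Real.pi : ℂ) * y) * Complex.I_sq
  have h2 : Complex.exp (Real.pi * ((r : ℂ) / 2 + Complex.I * y) * Complex.I) =
      Complex.I ^ r * Complex.exp (-(Real.pi * y)) := by
    rw [hI, ← Complex.exp_add]
    congr 1
    linear_combination ((Real.pi : ℂ) * y) * Complex.I_sq
  have h3 : Complex.I ^ r = Complex.I ^ (-r) * (-1) ^ r := by
    rw [← Complex.I_mul_I, mul_zpow, ← zpow_add₀ Complex.I_ne_zero, ← zpow_add₀ Complex.I_ne_zero]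
    congr 1; ring
  rw [half_CS, Complex.sin, h1, h2]
  push_cast
  rw [← inv_inv (Complex.I ^ (r - 1)), ← mul_inv, ← zpow_neg]
  congr 1
  rw [neg_sub, show (1 : ℤ) - r = -r + 1 by ring, zpow_add_one₀ Complex.I_ne_zero]
  linear_combination (-Complex.I * Complex.exp (-(Real.pi * y))) * h3

/-- For `s = -1` the two exponentials are interchanged at the cost of `(-1)^{r+1}`, which the
prefactor compensates. -/
theorem sign_zpow_mul_inv {s : ℤ} (hs : s = 1 ∨ s = -1) (r : ℤ) (z : ℝ) :
    (s : ℂ) ^ (r + 1) * (Complex.exp (Real.pi * (s * z)) -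
      (-1) ^ r * Complex.exp (-(Real.pi * (s * z))))⁻¹ = ((1 / 2 * CS r (Real.pi * z) : ℝ) : ℂ) := by
  rw [half_CS]
  rcases hs with rfl | rfl
  · simp
  · have h : (((-1 : ℤ) : ℂ)) ^ (r + 1) = ((-1) ^ (r + 1))⁻¹ := by
      rw [← inv_zpow]; norm_num
    have h2 : ((-1 : ℂ)) ^ r * (-1) ^ r = 1 := by rw [← mul_zpow]; simp
    rw [h, ← mul_inv]
    congr 1
    rw [zpow_add_one₀ (by norm_num)]
    push_cast
    rw [neg_one_mul, mul_neg (Real.pi : ℂ), neg_neg]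
    linear_combination (Complex.exp (Real.pi * z)) * h2

/-- Extracting `e^{πz}` makes the denominator symmetric. The index `1 - ρ` is the column sum of
`R_I` when `ρ` is the row sum of `R^!`, by `sum_expansion_eq`. -/
theorem exp_div_one_add (ρ : ℤ) (θ z : ℝ) :
    Complex.exp (2 * Real.pi * (1 / 2 + Complex.I * θ) * z) /
      (1 + Complex.exp (2 * Real.pi * z) * (-1) ^ ρ) =
    (-1) ^ ρ * (Complex.exp (2 * Real.pi * (z * (Complex.I * θ))) *
      ((1 / 2 * CS (1 - ρ) (Real.pi * z) : ℝ) : ℂ)) := by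
  have h2 : ((-1 : ℂ)) ^ ρ * (-1) ^ ρ = 1 := by rw [← mul_zpow]; simp
  have h3 : ((-1 : ℂ)) ^ (1 - ρ) = -(-1) ^ ρ := by
    rw [zpow_sub₀ (by norm_num), zpow_one]
    field_simp
    linear_combination h2
  have h4 : (1 : ℂ) + Complex.exp (2 * Real.pi * z) * (-1) ^ ρ = Complex.exp (Real.pi * z) *
      ((-1) ^ ρ * (Complex.exp (Real.pi * z) + (-1) ^ ρ * Complex.exp (-(Real.pi * z)))) := by
    have h5 : Complex.exp (Real.pi * z) * Complex.exp (-(Real.pi * z)) = 1 := by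
      rw [← Complex.exp_add]; simp
    have h6 : Complex.exp (2 * Real.pi * z) = Complex.exp (Real.pi * z) * Complex.exp (Real.pi * z) := by
      rw [← Complex.exp_add]; congr 1; ring
    rw [h6]
    linear_combination (-(-1) ^ ρ * (-1) ^ ρ) * h5 - h2
  have h7 : Complex.exp (2 * Real.pi * (1 / 2 + Complex.I * θ) * z) =
      Complex.exp (Real.pi * z) * Complex.exp (2 * Real.pi * (z * (Complex.I * θ))) := by
    rw [← Complex.exp_add]; congr 1; ring
  rw [half_CS, h4, h7, mul_div_mul_left _ _ (Complex.exp_ne_zero _), h3, div_eq_mul_inv, mul_inv]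
  push_cast
  have h8 : ((-1 : ℂ) ^ ρ)⁻¹ = (-1) ^ ρ := (eq_inv_of_mul_eq_one_left h2).symm
  rw [h8, neg_mul, sub_neg_eq_add]
  ring

/-! ## The contribution of a basis -/

variable {n k d : ℕ} {Q : Matrix (Fin n) (Fin k) ℤ} {P : Matrix (Fin n) (Fin d) ℤ}
  {I : Finset (Fin n)}

/-- The link between residues and modules: by `R^! = -Rᵀ`, the values of `b_i` at the pole of the
complementary basis are governed by the `z_i` of the Verma module. -/
theorem offset_compl (h : IsExactSequence Q P) (hI : IsLatticeBasis P I) (m : Fin n → ℝ) (i : I) :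
    offset Q Iᶜ m i = coordZ P I m i := by
  rw [coordZ, ← sum_subtype_add_sum_compl I, offset]
  simp only [expansion_compl h hI, expansion_self hI]
  push_cast
  simp [sub_eq_add_neg, ← Finset.sum_neg_distrib, mul_comm]

theorem sum_expansion_eq (h : IsExactSequence Q P) (hI : IsLatticeBasis P I) (i : I) :
    ∑ s, expansion P I s i = 1 - ∑ j : (Iᶜ : Finset (Fin n)), expansion Q Iᶜ i j := by
  rw [← sum_subtype_add_sum_compl I]
  simp only [expansion_compl h hI, expansion_self hI]
  simp

theorem sum_expansion_compl_eq (h : IsExactSequence Q P) (hI : IsLatticeBasis P I)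
    (j : (Iᶜ : Finset (Fin n))) :
    ∑ s, expansion Q Iᶜ s j - 1 = ∑ i : I, expansion Q Iᶜ i j := by
  rw [← sum_subtype_add_sum_compl I]
  simp only [expansion_self (hI.compl h)]
  simp

theorem rSum_eq (m : Fin n → ℝ) (i : I) :
    rSum P I m i = -(sgn P I m i * ∑ s, expansion P I s i) := by
  rw [rSum, Finset.mul_sum, ← Finset.sum_neg_distrib]
  exact Finset.sum_congr rfl fun s _ => by ring

/-- Signs do not affect parity, and `CS` depends on parity only. -/
theorem even_rSum_sub {m : Fin n → ℝ} {i : I} (hm : coordZ P I m i ≠ 0) :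
    Even (rSum P I m i - ∑ s, expansion P I s i) := by
  rw [rSum_eq]
  rcases sgn_eq_or hm with h | h <;> rw [h]
  · exact ⟨-∑ s, expansion P I s i, by ring⟩
  · exact ⟨0, by ring⟩

theorem sgn_cast (m : Fin n → ℝ) (i : I) :
    (sgn P I m i : ℝ) = (SignType.sign (coordZ P I m i) : ℝ) := by
  rw [sgn]
  rcases SignType.sign (coordZ P I m i) with _ | _ | _ <;> simp

/-- The trace of a polynomial in the `h_j` over the Verma module of `I`. -/
def higgsTrace (P : Matrix (Fin n) (Fin d) ℤ) (I : Finset (Fin n)) (m ζ : Fin n → ℝ)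
    (p : MvPolynomial (Fin n) ℂ) : ℂ :=
  ladderTrace (fun s (i : I) => (expansion P I s i : ℝ)) (fun i => ζ i) ζ
    (fun i => (sgn P I m i : ℝ)) (fun i => (-1) ^ rSum P I m i) p (coordZ P I m)

theorem norm_neg_one_zpow (r : ℤ) : ‖((-1 : ℂ)) ^ r‖ = 1 := by simp

theorem abs_sgn {m : Fin n → ℝ} (hm : ∀ i : I, coordZ P I m i ≠ 0) (i : I) :
    |(sgn P I m i : ℝ)| = 1 := by
  rw [sgn_cast]; exact abs_sign_eq_one (hm i)

theorem sgn_mul_coordZ_pos {m : Fin n → ℝ} (hm : ∀ i : I, coordZ P I m i ≠ 0) (i : I) :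
    0 < (sgn P I m i : ℝ) * coordZ P I m i := by
  rw [sgn_cast]; exact sign_mul_pos (hm i)

theorem prod_sgn_mul_higgsTrace_one {m : Fin n → ℝ} (ζ : Fin n → ℝ)
    (hm : ∀ i : I, coordZ P I m i ≠ 0) :
    (∏ i : I, (sgn P I m i : ℂ) ^ (rSum P I m i + 1)) * higgsTrace P I m ζ 1 =
      ∏ i : I, Complex.exp (2 * Real.pi * (coordZ P I m i * (Complex.I * ζ i))) *
        ((1 / 2 * CS (rSum P I m i) (Real.pi * coordZ P I m i) : ℝ) : ℂ) := by
  rw [higgsTrace, ladderTrace_one (fun _ => norm_neg_one_zpow _) (sgn_mul_coordZ_pos hm),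
    ← Finset.prod_mul_distrib]
  refine Finset.prod_congr rfl fun i _ => ?_
  rw [← sign_zpow_mul_inv (sgn_eq_or (hm i))]
  push_cast
  ring

theorem phase_identity (s : ℤ) (hs : s = 1 ∨ s = -1) (n : ℤ) :
    Complex.I ^ (n - 1) * (-1) ^ (n - 1) =
      Complex.I ^ (-(s * (n - 1))) * (s : ℂ) ^ (-(s * n) + 1) := by
  have h2 : ((-1 : ℂ)) ^ (n - 1) * (-1) ^ (n - 1) = 1 := by rw [← mul_zpow]; simp
  rcases hs with rfl | rfl
  · rw [← Complex.I_mul_I, mul_zpow, one_mul, zpow_neg]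
    have h3 : Complex.I ^ (n - 1) ≠ 0 := zpow_ne_zero _ Complex.I_ne_zero
    have h4 : (Complex.I ^ (n - 1) * Complex.I ^ (n - 1)) *
        (Complex.I ^ (n - 1) * Complex.I ^ (n - 1)) = 1 := by
      rw [← mul_zpow, ← mul_zpow]; simp
    simp only [Int.cast_one, one_zpow, mul_one]
    field_simp
    linear_combination h4
  · have h5 : (-1 : ℂ) ^ (n + 1) = (-1) ^ (n - 1) := by
      rw [show n + 1 = n - 1 + 2 by ring, zpow_add₀ (by norm_num)]
      norm_num
    rw [show -(-1 * (n - 1)) = n - 1 by ring, show -(-1 * n) + 1 = n + 1 by ring]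
    push_cast
    rw [h5]

/-- All phases become products over `j ∉ I`. The exponents attached to `i` are row sums over the
off-diagonal block of `R^!`; exchanging the sums gives column sums minus one, as `R^!` is the
identity on the complement. The factors at a single `j` are then compared by `phase_identity`. -/
theorem prod_phase (h : IsExactSequence Q P) (hI : IsLatticeBasis P I) {ζ : Fin n → ℝ}
    (hζ : ∀ j : (Iᶜ : Finset (Fin n)), coordZ Q Iᶜ ζ j ≠ 0) :
    (∏ j : (Iᶜ : Finset (Fin n)), Complex.I ^ (∑ s, expansion Q Iᶜ s j - 1)) *
      ∏ i : I, (-1 : ℂ) ^ (∑ j : (Iᶜ : Finset (Fin n)), expansion Q Iᶜ i j) =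
    (∏ i : I, sechPhase (rTilde Q ζ Iᶜ i)) *
      ∏ j : (Iᶜ : Finset (Fin n)), (sgn Q Iᶜ ζ j : ℂ) ^ (rSum Q Iᶜ ζ j + 1) := by
  have h1 : ∏ i : I, (-1 : ℂ) ^ (∑ j : (Iᶜ : Finset (Fin n)), expansion Q Iᶜ i j) =
      ∏ j : (Iᶜ : Finset (Fin n)), (-1 : ℂ) ^ (∑ s, expansion Q Iᶜ s j - 1) := by
    rw [prod_zpow_eq_zpow_sum₀ (by norm_num), prod_zpow_eq_zpow_sum₀ (by norm_num),
      Finset.sum_comm]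
    simp only [sum_expansion_compl_eq h hI]
  have h2 : ∏ i : I, sechPhase (rTilde Q ζ Iᶜ i) = ∏ j : (Iᶜ : Finset (Fin n)),
      Complex.I ^ (-(sgn Q Iᶜ ζ j * (∑ s, expansion Q Iᶜ s j - 1))) := by
    simp only [sechPhase_eq, rTilde, sum_expansion_compl_eq h hI]
    rw [prod_zpow_eq_zpow_sum₀ Complex.I_ne_zero, prod_zpow_eq_zpow_sum₀ Complex.I_ne_zero]
    congr 1
    simp only [sub_add_cancel_left, Finset.mul_sum, ← Finset.sum_neg_distrib]
    rw [Finset.sum_comm]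
    refine Finset.sum_congr rfl fun j _ => Finset.sum_congr rfl fun i _ => ?_
    ring
  rw [h1, h2, ← Finset.prod_mul_distrib, ← Finset.prod_mul_distrib]
  refine Finset.prod_congr rfl fun j _ => ?_
  rw [phase_identity _ (sgn_eq_or (hζ j)), rSum_eq]

theorem basisExponent_univ (J : Finset (Fin n)) (ζ : Fin n → ℝ) (j : J) :
    basisExponent Q Finset.univ J (fun s => 1 / 2 + Complex.I * ζ s) j =
      ((∑ s, expansion Q J s j : ℤ) : ℂ) / 2 + Complex.I * coordZ Q J ζ j := by
  rw [basisExponent, coordZ]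
  push_cast
  rw [Finset.mul_sum, Finset.sum_div, ← Finset.sum_add_distrib]
  exact Finset.sum_congr rfl fun s _ => by ring

/-- The sines over the complement of `I` give the dual `CS` factors; the quotients over `I` are, up
to signs, the geometric series of the trace of `1` on the Verma module. -/
theorem residueTerm_compl (h : IsExactSequence Q P) (hI : IsLatticeBasis P I) {m ζ : Fin n → ℝ}
    (hm : ∀ i : I, coordZ P I m i ≠ 0)
    (hζ : ∀ j : (Iᶜ : Finset (Fin n)), coordZ Q Iᶜ ζ j ≠ 0) :
    residueTerm Q m Finset.univ Iᶜ (fun s => 1 / 2 + Complex.I * ζ s) =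
      vermaCoeff Q P m ζ I * higgsTrace P I m ζ 1 := by
  have hA : ∀ j : (Iᶜ : Finset (Fin n)), (2 * Complex.sin (Real.pi *
      basisExponent Q Finset.univ Iᶜ (fun s => 1 / 2 + Complex.I * ζ s) j))⁻¹ =
      Complex.I ^ (∑ s, expansion Q Iᶜ s j - 1) *
        ((1 / 2 * CS (rSum Q Iᶜ ζ j) (Real.pi * coordZ Q Iᶜ ζ j) : ℝ) : ℂ) := by
    intro j
    rw [basisExponent_univ, inv_two_sin, CS_congr (even_rSum_sub (hζ j))]
  have hB : ∀ i : I, Complex.exp (2 * Real.pi * (1 / 2 + Complex.I * ζ i) * offset Q Iᶜ m i) /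
      (1 + chi Q Iᶜ m i) = (-1) ^ (∑ j : (Iᶜ : Finset (Fin n)), expansion Q Iᶜ i j) *
        (Complex.exp (2 * Real.pi * (coordZ P I m i * (Complex.I * ζ i))) *
          ((1 / 2 * CS (rSum P I m i) (Real.pi * coordZ P I m i) : ℝ) : ℂ)) := by
    intro i
    rw [chi, offset_compl h hI, exp_div_one_add, ← sum_expansion_eq h hI,
      CS_congr (even_rSum_sub (hm i))]
  have hu : Finset.univ \ Iᶜ = I := by ext; simp
  rw [residueTerm, hu, ← Finset.prod_coe_sort I]
  simp only [hA, hB]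
  rw [Finset.prod_mul_distrib, Finset.prod_mul_distrib, ← prod_sgn_mul_higgsTrace_one ζ hm, vermaCoeff,
    Finset.prod_mul_distrib, Finset.prod_mul_distrib]
  linear_combination (∏ j : (Iᶜ : Finset (Fin n)),
    ((1 / 2 * CS (rSum Q Iᶜ ζ j) (Real.pi * coordZ Q Iᶜ ζ j) : ℝ) : ℂ)) *
    ((∏ i : I, (sgn P I m i : ℂ) ^ (rSum P I m i + 1)) * higgsTrace P I m ζ 1) * prod_phase h hI hζ

/-! ## The expansion of the integral of a monomial -/

variable {n k d : ℕ} {Q : Matrix (Fin n) (Fin k) ℤ} {P : Matrix (Fin n) (Fin d) ℤ}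
  {I : Finset (Fin n)}

theorem sin_pi_mul_ne_zero {x : ℂ} (hx : x.im ≠ 0) : Complex.sin (Real.pi * x) ≠ 0 := by
  intro h
  obtain ⟨l, hl⟩ := Complex.sin_eq_zero_iff.1 h
  have h1 := congrArg Complex.im hl
  rw [Complex.im_ofReal_mul] at h1
  have h2 : ((l : ℂ) * (Real.pi : ℂ)).im = 0 := by simp
  rw [h2] at h1
  exact hx ((mul_eq_zero.1 h1).resolve_left Real.pi_ne_zero)

theorem integral_hyperIntegrand_zero (h : IsExactSequence Q P) (hu : IsUnimodular P)
    {m ζ : Fin n → ℝ} (hm : ∀ (I : Bases P) (i : I.1), coordZ P I.1 m i ≠ 0)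
    (hζ : ∀ (I : Bases P) (j : (I.1ᶜ : Finset (Fin n))), coordZ Q I.1ᶜ ζ j ≠ 0) :
    ∫ t : Fin k → ℝ, hyperIntegrand ζ 0 (contourPoint Q m t) =
      ∑ I : Bases P, vermaCoeff Q P m ζ I.1 * higgsTrace P I.1 m ζ 1 := by
  have hc : ∀ J, IsLatticeBasis Q J → IsLatticeBasis P Jᶜ := fun J hJ => hJ.compl h.symm
  have hexp : ∀ J, IsLatticeBasis Q J → ∀ i, ∀ hi : i ∉ J, ∀ j : J,
      expansion Q J i j = -expansion P Jᶜ j ⟨i, Finset.mem_compl.2 hi⟩ := by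
    intro J hJ i hi j
    rw [expansion_compl h.symm hJ j ⟨i, Finset.mem_compl.2 hi⟩, neg_neg]
  -- Here `e^{2πi b ζ} / (2 cosh πb)` is recognized as `phi` at `1/2 + iζ`.
  have hphi : ∀ t : Fin k → ℝ, hyperIntegrand ζ 0 (contourPoint Q m t) =
      ∏ s ∈ Finset.univ, phi (1 / 2 + Complex.I * ζ s) (contourPoint Q m t s) := by
    intro t
    refine Finset.prod_congr rfl fun s _ => ?_
    generalize contourPoint Q m t s = b
    have h1 : ((sechDeriv 0 b : ℝ) : ℂ) = ((1 / 2 * CS 1 (Real.pi * b) : ℝ) : ℂ) := by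
      simp [sechDeriv, tanhPoly, CS]
      ring
    have h2 := exp_div_one_add 0 (ζ s) b
    simp only [zpow_zero, mul_one, one_mul, sub_zero] at h2
    rw [Pi.zero_apply, h1, phi, h2]
    congr 2
    ring
  simp only [hphi]
  have hres := residueFormula (Q := Q) (m := m) ?_ ?_ ?_ Finset.univ ?_
    (fun s => 1 / 2 + Complex.I * ζ s) ?_ ?_
  · rw [ResidueFormula] at hres
    rw [hres]
    symm
    refine Finset.sum_bij (fun (I : Bases P) _ => I.1ᶜ) ?_ ?_ ?_ ?_
    · exact fun I _ => mem_basesIn.2 ⟨I.2.compl h, Finset.subset_univ _⟩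
    · exact fun I _ I' _ hII' => Subtype.ext (compl_injective hII')
    · intro J hJ
      exact ⟨⟨Jᶜ, hc J (mem_basesIn.1 hJ).1⟩, Finset.mem_univ _, compl_compl J⟩
    · exact fun I _ => (residueTerm_compl h I.2 (hm I) (hζ I)).symm
  · intro J hJ i hi j hij
    rw [hexp J hJ i hi j, neg_ne_zero] at hij
    have h1 := ((hc J hJ).exchange hu ⟨i, Finset.mem_compl.2 hi⟩ (by simp) hij).compl h
    have h2 : (insert (j : Fin n) (Jᶜ.erase i))ᶜ = insert i (J.erase j) := by
      ext x
      have hij' : i ≠ j := fun h => hi (h ▸ j.2)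
      by_cases hx : x = i
      · subst hx; simp [hij']
      · simp [hx]
    rwa [h2] at h1
  · intro J hJ i hi j
    rw [hexp J hJ i hi j]
    rcases expansion_eq_zero_or hu (hc J hJ) j ⟨i, Finset.mem_compl.2 hi⟩ with h1 | h1 | h1 <;>
      simp [h1]
  · intro J hJ i hi
    have h1 := offset_compl h (hc J hJ) m ⟨i, Finset.mem_compl.2 hi⟩
    rw [compl_compl] at h1
    rw [h1]
    exact hm ⟨Jᶜ, hc J hJ⟩ _
  · obtain ⟨I, hI⟩ := exists_isLatticeBasis h hu
    exact ⟨Iᶜ, mem_basesIn.2 ⟨hI.compl h, Finset.subset_univ _⟩⟩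
  · intro s _
    norm_num
  · intro J hJ j
    rw [basisExponent_univ]
    -- The imaginary part of the exponent is `z^!_j`, nonzero by genericity.
    refine sin_pi_mul_ne_zero ?_
    have h2 : (((∑ s, expansion Q J s j : ℤ) : ℂ) / 2 + Complex.I * coordZ Q J ζ j).im =
        coordZ Q J ζ j := by simp
    rw [h2]
    obtain ⟨I, rfl⟩ : ∃ I, J = Iᶜ := ⟨Jᶜ, (compl_compl J).symm⟩
    have hI := hc _ (mem_basesIn.1 hJ).1
    rw [compl_compl] at hI
    exact hζ ⟨I, hI⟩ j

theorem coordZ_add_single (m : Fin n → ℝ) (s : Fin n) (τ : ℝ) (i : I) :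
    coordZ P I (m + Pi.single s τ) i = coordZ P I m i + τ * expansion P I s i := by
  simp only [coordZ, Pi.add_apply, add_mul, Finset.sum_add_distrib]
  congr 1
  rw [Finset.sum_eq_single s] <;> simp +contextual

theorem rSum_congr {m m' : Fin n → ℝ} {i : I} (h : sgn P I m' i = sgn P I m i) :
    rSum P I m' i = rSum P I m i := by
  simp only [rSum, h]

theorem vermaCoeff_congr {m m' : Fin n → ℝ} (h : ∀ i, sgn P I m' i = sgn P I m i) (ζ : Fin n → ℝ) :
    vermaCoeff Q P m' ζ I = vermaCoeff Q P m ζ I := by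
  simp only [vermaCoeff, h, rSum_congr (h _)]

/-- The mass is quantified inside the induction, because the derivative needs the formula in a
neighbourhood of `m`. There the signs are constant, and so are the coefficients; comparing
derivatives in `m_s` isolates the next monomial. -/
theorem integral_hyperIntegrand (h : IsExactSequence Q P) (hu : IsUnimodular P) {ζ : Fin n → ℝ}
    (hζ : ∀ (I : Bases P) (j : (I.1ᶜ : Finset (Fin n))), coordZ Q I.1ᶜ ζ j ≠ 0) (a : Fin n → ℕ) :
    ∀ m : Fin n → ℝ, (∀ (I : Bases P) (i : I.1), coordZ P I.1 m i ≠ 0) →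
    ∫ t : Fin k → ℝ, hyperIntegrand ζ a (contourPoint Q m t) =
      ∑ I : Bases P, vermaCoeff Q P m ζ I.1 * higgsTrace P I.1 m ζ (hMon a) := by
  induction a using pi_nat_induction with
  | zero =>
    intro m hm
    rw [integral_hyperIntegrand_zero h hu hm hζ, hMon_zero]
  | succ a s ih =>
    intro m hm
    obtain ⟨J, hJ⟩ : ∃ J, IsLatticeBasis Q J := by
      obtain ⟨I, hI⟩ := exists_isLatticeBasis h hu
      exact ⟨_, hI.compl h⟩
    have hev : ∀ᶠ τ in nhds (0 : ℝ), ∀ (I : Bases P) (i : I.1),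
        SignType.sign (coordZ P I.1 (m + Pi.single s τ) i) = SignType.sign (coordZ P I.1 m i) := by
      refine Filter.eventually_all.2 fun I => Filter.eventually_all.2 fun i => ?_
      simp only [coordZ_add_single]
      have := eventually_sign_eq (f := fun τ => coordZ P I.1 m i + τ * expansion P I.1 s i)
        (by fun_prop) (by simpa using hm I i)
      simpa using this
    have h1 : ∀ I : Bases P, HasDerivAt (fun τ : ℝ => vermaCoeff Q P m ζ I.1 *
        ladderTrace (fun s (i : I.1) => (expansion P I.1 s i : ℝ)) (fun i => ζ i) ζ
          (fun i => (sgn P I.1 m i : ℝ)) (fun i => (-1) ^ rSum P I.1 m i) (hMon a)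
          fun i => coordZ P I.1 m i + τ * expansion P I.1 s i)
        (vermaCoeff Q P m ζ I.1 * (2 * Real.pi * (higgsTrace P I.1 m ζ (hMon (a + Pi.single s 1)) +
          Complex.I * ζ s * higgsTrace P I.1 m ζ (hMon a)))) 0 := by
      intro I
      rw [hMon_add_single]
      exact (hasDerivAt_ladderTrace (abs_sgn (hm I)) (fun _ => norm_neg_one_zpow _) (hMon a)
        (sgn_mul_coordZ_pos (hm I)) s).const_mul _
    have hEq : (fun τ : ℝ => ∫ t : Fin k → ℝ, hyperIntegrand ζ a (contourPoint Q (m + Pi.single s τ) t))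
        =ᶠ[nhds 0] fun τ : ℝ => ∑ I : Bases P, vermaCoeff Q P m ζ I.1 *
          ladderTrace (fun s (i : I.1) => (expansion P I.1 s i : ℝ)) (fun i => ζ i) ζ
          (fun i => (sgn P I.1 m i : ℝ)) (fun i => (-1) ^ rSum P I.1 m i) (hMon a)
          fun i => coordZ P I.1 m i + τ * expansion P I.1 s i := by
      filter_upwards [hev] with τ hτ
      have hgen : ∀ (I : Bases P) (i : I.1), coordZ P I.1 (m + Pi.single s τ) i ≠ 0 := fun I i => by
        rw [← sign_ne_zero, hτ I i, sign_ne_zero]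
        exact hm I i
      rw [ih _ hgen]
      refine Finset.sum_congr rfl fun I _ => ?_
      have hs : ∀ i : I.1, sgn P I.1 (m + Pi.single s τ) i = sgn P I.1 m i := fun i => by
        rw [sgn, sgn, hτ I i]
      have hz : coordZ P I.1 (m + Pi.single s τ) =
          fun i => coordZ P I.1 m i + τ * expansion P I.1 s i := funext (coordZ_add_single m s τ)
      rw [vermaCoeff_congr hs, higgsTrace, hz]
      simp only [hs, rSum_congr (hs _)]
    have h2 := (HasDerivAt.fun_sum fun (I : Bases P) (_ : I ∈ Finset.univ) => h1 I).congr_of_eventuallyEq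
      hEq
    have h3 := hasDerivAt_integral_hyperIntegrand ζ hJ m a s
    have h4 := HasDerivAt.unique h2 h3
    have hpi : (2 * Real.pi : ℂ) ≠ 0 := by simp [Real.pi_ne_zero]
    rw [ih m hm] at h4
    have h5 : 2 * Real.pi * ((∑ I : Bases P, vermaCoeff Q P m ζ I.1 *
        higgsTrace P I.1 m ζ (hMon (a + Pi.single s 1))) + Complex.I * ζ s *
        ∑ I : Bases P, vermaCoeff Q P m ζ I.1 * higgsTrace P I.1 m ζ (hMon a)) =
        ∑ I : Bases P, vermaCoeff Q P m ζ I.1 *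
          (2 * Real.pi * (higgsTrace P I.1 m ζ (hMon (a + Pi.single s 1)) +
          Complex.I * ζ s * higgsTrace P I.1 m ζ (hMon a))) := by
      rw [Finset.mul_sum, ← Finset.sum_add_distrib, Finset.mul_sum]
      exact Finset.sum_congr rfl fun I _ => by ring
    rw [← h5] at h4
    exact (add_right_cancel (mul_left_cancel₀ hpi h4)).symm

/-! ## Traces as ladder sums -/

variable {n k d : ℕ} {Q : Matrix (Fin n) (Fin k) ℤ} {P : Matrix (Fin n) (Fin d) ℤ}
  {I : Finset (Fin n)}

/-- In a basis of joint eigenvectors of the `h_j`, the diagonal of `w` is the polynomial `p` in the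
eigenvalues. -/
def IsSymbol (Q : Matrix (Fin n) (Fin k) ℤ) (w : invariants Q) (p : MvPolynomial (Fin n) ℂ) : Prop :=
  ∀ (V : Type) [AddCommGroup V] [Module ℂ V] (ρ : invariants Q →ₐ[ℂ] Module.End ℂ V) (ι : Type)
    (B : Module.Basis ι ℂ V) (l : ι → Fin n → ℂ),
    (∀ c j, ρ ⟨Weyl.h j, h_mem_invariants Q j⟩ (B c) = l c j • B c) →
      ∀ c, B.repr (ρ w (B c)) c = p.eval (l c)

theorem isSymbol_one : IsSymbol Q 1 1 := by
  intro V _ _ ρ ι B l _ c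
  simp

theorem muHat_eq_sum (ζ : Fin n → ℝ) (β : Fin n → ℂ) :
    (⟨muHat ζ β, muHat_mem_invariants Q ζ β⟩ : invariants Q) =
      ∑ j, β j • (⟨Weyl.h j, h_mem_invariants Q j⟩ +
        algebraMap ℂ (invariants Q) (Complex.I * (ζ j : ℂ))) := by
  apply Subtype.ext
  simp [muHat]

theorem map_muHat_apply {V : Type} [AddCommGroup V] [Module ℂ V]
    (ρ : invariants Q →ₐ[ℂ] Module.End ℂ V) {v : V} {l : Fin n → ℂ}
    (hv : ∀ j, ρ ⟨Weyl.h j, h_mem_invariants Q j⟩ v = l j • v) (ζ : Fin n → ℝ) (β : Fin n → ℂ) :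
    ρ ⟨muHat ζ β, muHat_mem_invariants Q ζ β⟩ v = (∑ j, β j * (l j + Complex.I * ζ j)) • v := by
  rw [muHat_eq_sum, map_sum, LinearMap.sum_apply, Finset.sum_smul]
  refine Finset.sum_congr rfl fun j _ => ?_
  rw [map_smul, map_add, AlgHom.commutes, LinearMap.smul_apply, LinearMap.add_apply, hv,
    Module.algebraMap_end_apply, ← add_smul, smul_smul]

/-! ### Vacuum modules as ladders -/

section Fock

variable {b : Fin n → ℝ}

theorem fock_h (hb : ∀ j, b j ≠ 0) (u : Fin n →₀ ℕ) (j : Fin n) :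
    fock b (Weyl.h j) (MvPolynomial.monomial u 1) =
      (-((SignType.sign (b j) : ℝ) : ℂ) * ((u j : ℂ) + 1 / 2)) • MvPolynomial.monomial u (1 : ℂ) := by
  have h1 : fock b (Weyl.h j) = flipX (fun j => 0 < b j) mulOp derOp j *
      flipD (fun j => 0 < b j) mulOp derOp j + algebraMap ℂ _ (1 / 2) := by
    simp [Weyl.h, fock, Weyl.lift_x, Weyl.lift_del]
  have h2 : mulOp j (derOp j (MvPolynomial.monomial u 1)) =
      (u j : ℂ) • MvPolynomial.monomial u (1 : ℂ) := by
    simp only [mulOp, derOp, LinearMap.mulLeft_apply, Derivation.coeFn_coe,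
      MvPolynomial.pderiv_monomial, one_mul, MvPolynomial.X, MvPolynomial.monomial_mul,
      MvPolynomial.smul_monomial, smul_eq_mul, mul_one]
    by_cases h : u j = 0
    · simp [h]
    · congr 2
      exact add_tsub_cancel_of_le (by simpa [Finsupp.single_le_iff] using Nat.one_le_iff_ne_zero.2 h)
  have h3 : derOp j (mulOp j (MvPolynomial.monomial u 1)) =
      ((u j : ℂ) + 1) • MvPolynomial.monomial u (1 : ℂ) := by
    have := congrArg (fun f : Module.End ℂ (MvPolynomial (Fin n) ℂ) =>
      f (MvPolynomial.monomial u 1)) (derOp_mulOp j j)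
    simp only [if_true, LinearMap.add_apply, Module.End.mul_apply, Module.End.one_apply] at this
    rw [this, h2, add_smul, one_smul]
  rw [h1, LinearMap.add_apply, Module.End.mul_apply, Module.algebraMap_end_apply]
  unfold flipX flipD
  rcases lt_or_gt_of_ne (hb j) with h | h
  · rw [if_neg h.not_gt, if_neg h.not_gt, h2, sign_neg h, ← add_smul]
    congr 1
    simp
  · rw [if_pos h, if_pos h, LinearMap.neg_apply, h3, sign_pos h, ← neg_smul, ← add_smul]
    congr 1
    simp
    ring

theorem weylTraceTerm_eq (hb : ∀ j, b j ≠ 0) (ζ : Fin n → ℝ) {w : invariants Q}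
    {p : MvPolynomial (Fin n) ℂ} (hp : IsSymbol Q w p) (u : Fin n →₀ ℕ) :
    weylTraceTerm ζ b w u = ladderTerm (fun s i => if s = i then (1 : ℝ) else 0) ζ ζ
      (fun j => (SignType.sign (b j) : ℝ)) (fun _ => -1) p b u := by
  have h1 := hp (MvPolynomial (Fin n) ℂ) ((fock b).comp (invariants Q).val) (Fin n →₀ ℕ)
    (MvPolynomial.basisMonomials (Fin n) ℂ)
    (fun u j => -((SignType.sign (b j) : ℝ) : ℂ) * ((u j : ℂ) + 1 / 2))
    (fun u j => by simpa using fock_h hb u j) u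
  have h2 := map_muHat_apply (Q := Q) ((fock b).comp (invariants Q).val)
    (v := MvPolynomial.monomial u (1 : ℂ))
    (l := fun j => -((SignType.sign (b j) : ℝ) : ℂ) * ((u j : ℂ) + 1 / 2))
    (fun j => fock_h hb u j) ζ fun j => (b j : ℂ)
  have h3 : fockDiag b (muHat ζ fun j => (b j : ℂ)) u =
      ∑ j, (b j : ℂ) * (-((SignType.sign (b j) : ℝ) : ℂ) * ((u j : ℂ) + 1 / 2) + Complex.I * ζ j) := by
    have h4 := congrArg (MvPolynomial.coeff u) h2
    rw [MvPolynomial.coeff_smul, MvPolynomial.coeff_monomial, if_pos rfl, smul_eq_mul, mul_one] at h4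
    exact h4
  have h5 : fockDiag b w u =
      p.eval fun j => -((SignType.sign (b j) : ℝ) : ℂ) * ((u j : ℂ) + 1 / 2) := by
    rw [← h1, MvPolynomial.coe_basisMonomials]
    rfl
  have h6 : (fun j => -((SignType.sign (b j) : ℝ) : ℂ) * ((u j : ℂ) + 1 / 2)) =
      ladderWeight (fun s i => if s = i then (1 : ℝ) else 0) ζ ζ
        (fun j => (SignType.sign (b j) : ℝ)) u := by
    ext j
    rw [ladderWeight, Finset.sum_eq_single j]
    · simp [ladder]
    · intro i _ hij
      simp [Ne.symm hij]
    · simp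
  rw [weylTraceTerm, ladderTerm, h3, h5, h6, Finset.prod_pow_eq_pow_sum]
  rfl

theorem summable_weylTraceTerm (hb : ∀ j, b j ≠ 0) (ζ : Fin n → ℝ) {w : invariants Q}
    {p : MvPolynomial (Fin n) ℂ} (hp : IsSymbol Q w p) : Summable (weylTraceTerm ζ b w) := by
  have h1 := summable_ladderTerm (R := fun s i : Fin n => if s = i then (1 : ℝ) else 0) (θ := ζ)
    (ζ := ζ) (sg := fun _ => -1) (fun j => abs_sign_eq_one (hb j)) (fun _ => by simp) p
    fun j => sign_mul_pos (hb j)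
  refine (Finsupp.equivFunOnFinite.summable_iff.2 h1).congr fun u => ?_
  rw [weylTraceTerm_eq hb ζ hp]
  rfl

theorem weylTrace_eq (hb : ∀ j, b j ≠ 0) (ζ : Fin n → ℝ) {w : invariants Q}
    {p : MvPolynomial (Fin n) ℂ} (hp : IsSymbol Q w p) : weylTrace ζ b w = fockTrace ζ b p := by
  rw [weylTrace, fockTrace, ladderTrace, ← Finsupp.equivFunOnFinite.tsum_eq]
  exact tsum_congr fun u => weylTraceTerm_eq hb ζ hp u

end Fock

/-! ### Verma modules as ladders -/

section Verma

theorem toHiggs_muHat (ζ : Fin n → ℝ) (v : Fin k → ℤ) :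
    toHiggs Q ζ ⟨muHat ζ fun j => (((Q *ᵥ v) j : ℤ) : ℂ), muHat_mem_invariants Q ζ _⟩ = 0 := by
  rw [← map_zero (toHiggs Q ζ)]
  refine RingQuot.mkAlgHom_rel ℂ ?_
  have h1 : muHat ζ (fun j => (((Q *ᵥ v) j : ℤ) : ℂ)) =
      ∑ a, (v a : ℂ) • muHat ζ fun j => (Q j a : ℂ) := by
    simp only [muHat, Finset.smul_sum, smul_smul]
    rw [Finset.sum_comm]
    refine Finset.sum_congr rfl fun j _ => ?_
    rw [← Finset.sum_smul]
    congr 1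
    simp [Matrix.mulVec, dotProduct, mul_comm]
  change muHat ζ (fun j => (((Q *ᵥ v) j : ℤ) : ℂ)) - 0 ∈ momentIdeal Q ζ
  rw [sub_zero, h1]
  refine Submodule.sum_mem _ fun a _ => Submodule.smul_of_tower_mem _ _ ?_
  exact Submodule.subset_span ⟨a, rfl⟩

variable {m ζ : Fin n → ℝ}

/-- The vector `e_s - ∑ r_i e_i`. -/
def basisRelation (s : Fin n) (r : I → ℤ) (j : Fin n) : ℤ :=
  (if j = s then 1 else 0) - ∑ i : I, r i * if j = i then 1 else 0

theorem sum_basisRelation_smul {V : Type*} [AddCommGroup V] (s : Fin n) (r : I → ℤ) (y : Fin n → V) :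
    ∑ j, basisRelation s r j • y j = y s - ∑ i : I, r i • y i := by
  simp only [basisRelation, sub_smul, Finset.sum_sub_distrib, Finset.sum_smul]
  rw [Finset.sum_comm]
  simp

/-- A Verma module prescribes the eigenvalues of `h_i` only for `i ∈ I`. The vector `e_s - Σ_i
R_{si} e_i` is killed by `Pᵀ`, hence lies in the image of `Q`, and its moment map vanishes in `A`;
this fixes `h_s`. Traces therefore do not depend on the choice of the module. -/
theorem higgsH_smul (h : IsExactSequence Q P) (hI : IsLatticeBasis P I) (Δ : VermaModule Q P m ζ I)
    (c : I → ℕ) (s : Fin n) :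
    higgsH Q ζ s • Δ.basis c = ladderWeight (fun s (i : I) => (expansion P I s i : ℝ))
      (fun i => ζ i) ζ (fun i => (sgn P I m i : ℝ)) c s • Δ.basis c := by
  set y : Fin n → Δ.carrier := fun j =>
    higgsH Q ζ j • Δ.basis c + (Complex.I * (ζ j : ℂ)) • Δ.basis c with hy
  have hlad : ∀ i : I, y i =
      ladder (fun i : I => ζ i) (fun i => (sgn P I m i : ℝ)) c i • Δ.basis c := by
    intro i
    simp only [hy]
    rw [Δ.eigen, ← add_smul]
    simp [ladder]
  obtain ⟨v, hv⟩ := (h.symm.2.1 (basisRelation s (expansion P I s))).1 (by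
    rw [transpose_mulVec_eq_sum]
    refine (sum_basisRelation_smul s (expansion P I s) fun j => P j).trans ?_
    exact sub_eq_zero.2 (expansion_sum hI s).symm)
  have h1 : ∑ j, basisRelation s (expansion P I s) j • y j = 0 := by
    have h2 := congrArg (fun x => x • Δ.basis c) (toHiggs_muHat (Q := Q) ζ v)
    simp only [muHat_eq_sum, map_sum, Finset.sum_smul, zero_smul] at h2
    rw [← h2]
    refine Finset.sum_congr rfl fun j _ => ?_
    rw [← hv, map_smul, map_add, AlgHom.commutes, smul_assoc, add_smul, algebraMap_smul,
      Int.cast_smul_eq_zsmul]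
    rfl
  rw [sum_basisRelation_smul, sub_eq_zero] at h1
  have h3 : higgsH Q ζ s • Δ.basis c = y s - (Complex.I * (ζ s : ℂ)) • Δ.basis c := by
    simp [hy]
  rw [h3, h1, ladderWeight, sub_smul, Finset.sum_smul]
  simp only [hlad, ← smul_smul, Complex.ofReal_intCast, Int.cast_smul_eq_zsmul]

theorem traceTerm_eq (h : IsExactSequence Q P) (hI : IsLatticeBasis P I) (Δ : VermaModule Q P m ζ I)
    {w : invariants Q} {p : MvPolynomial (Fin n) ℂ} (hp : IsSymbol Q w p) (c : I → ℕ) :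
    Δ.traceTerm (toHiggs Q ζ w) c = ladderTerm (fun s (i : I) => (expansion P I s i : ℝ))
      (fun i => ζ i) ζ (fun i => (sgn P I m i : ℝ)) (fun i => (-1) ^ rSum P I m i) p
      (coordZ P I m) c := by
  set ρ : invariants Q →ₐ[ℂ] Module.End ℂ Δ.carrier :=
    (Algebra.lsmul ℂ ℂ Δ.carrier).comp (toHiggs Q ζ) with hρ
  set l := ladderWeight (fun s (i : I) => (expansion P I s i : ℝ)) (fun i => ζ i) ζ
    (fun i => (sgn P I m i : ℝ)) with hl
  have hev : ∀ c j, ρ ⟨Weyl.h j, h_mem_invariants Q j⟩ (Δ.basis c) = l c j • Δ.basis c :=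
    fun c j => higgsH_smul h hI Δ c j
  have h1 : Δ.diag (toHiggs Q ζ w) c = p.eval (l c) := hp Δ.carrier ρ (I → ℕ) Δ.basis l hev c
  have h2 : Δ.diag (higgsMu Q m ζ) c = ∑ s, (m s : ℂ) * (l c s + Complex.I * ζ s) := by
    have h3 : higgsMu Q m ζ • Δ.basis c = (∑ s, (m s : ℂ) * (l c s + Complex.I * ζ s)) • Δ.basis c :=
      map_muHat_apply ρ (hev c) ζ fun j => (m j : ℂ)
    rw [VermaModule.diag, h3]
    simp
  have h4 : ∑ s, (m s : ℂ) * (l c s + Complex.I * ζ s) = ∑ i : I, (coordZ P I m i : ℂ) *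
      ladder (fun i : I => ζ i) (fun i => (sgn P I m i : ℝ)) c i := by
    simp only [hl, ladderWeight, sub_add_cancel, coordZ, Finset.mul_sum]
    rw [Finset.sum_comm]
    refine Finset.sum_congr rfl fun i _ => ?_
    push_cast
    rw [Finset.sum_mul]
    exact Finset.sum_congr rfl fun s _ => by ring
  rw [VermaModule.traceTerm, ladderTerm, h1, h2, h4]
  congr 2
  rw [← prod_zpow_eq_zpow_sum₀ (by norm_num)]
  refine Finset.prod_congr rfl fun i _ => ?_
  rw [zpow_mul, zpow_natCast]

theorem summable_traceTerm (h : IsExactSequence Q P) (hI : IsLatticeBasis P I)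
    (hm : ∀ i : I, coordZ P I m i ≠ 0) (Δ : VermaModule Q P m ζ I) (a : AHiggs Q ζ) :
    Summable (Δ.traceTerm a) := by
  obtain ⟨w, rfl⟩ := RingQuot.mkAlgHom_surjective ℂ _ a
  obtain ⟨p, hp⟩ := exists_eval_diag Q w
  have h1 := summable_ladderTerm (R := fun s (i : I) => (expansion P I s i : ℝ))
    (θ := fun i => ζ i) (ζ := ζ) (abs_sgn hm)
    (fun i => norm_neg_one_zpow (rSum P I m i)) p (sgn_mul_coordZ_pos hm)
  exact h1.congr fun c => (traceTerm_eq h hI Δ hp c).symm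

theorem trace_eq (h : IsExactSequence Q P) (hI : IsLatticeBasis P I) (Δ : VermaModule Q P m ζ I)
    {w : invariants Q} {p : MvPolynomial (Fin n) ℂ} (hp : IsSymbol Q w p) :
    Δ.trace (toHiggs Q ζ w) = higgsTrace P I m ζ p :=
  tsum_congr fun c => traceTerm_eq h hI Δ hp c

end Verma

/-! ## The expansion of the sphere trace -/

section Linear

variable {ι : Type} [Fintype ι] {n : ℕ} {R : Fin n → ι → ℝ} {θ : ι → ℝ} {ζ : Fin n → ℝ}
  {σ : ι → ℝ} {sg : ι → ℂ}

theorem ladderTrace_eq_sum (hσ : ∀ i, |σ i| = 1) (hsg : ∀ i, ‖sg i‖ = 1)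
    (p : MvPolynomial (Fin n) ℂ) {z : ι → ℝ} (hz : ∀ i, 0 < σ i * z i) :
    ladderTrace R θ ζ σ sg p z =
      ∑ u ∈ p.support, p.coeff u * ladderTrace R θ ζ σ sg (hMon u) z := by
  have h1 : ∀ u : Fin n →₀ ℕ, hMon (u : Fin n → ℕ) = MvPolynomial.monomial u 1 := fun u => by
    rw [hMon, Finsupp.equivFunOnFinite_symm_coe]
  have h2 : ∀ c, ladderTerm R θ ζ σ sg p z c =
      ∑ u ∈ p.support, p.coeff u * ladderTerm R θ ζ σ sg (hMon u) z c := by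
    intro c
    simp only [ladderTerm, h1]
    conv_lhs => rw [p.as_sum, map_sum, Finset.mul_sum]
    refine Finset.sum_congr rfl fun u _ => ?_
    simp only [MvPolynomial.eval_monomial, one_mul]
    ring
  simp only [ladderTrace, h2, ← tsum_mul_left]
  exact Summable.tsum_finsetSum fun u _ => (summable_ladderTerm hσ hsg _ hz).mul_left _

end Linear

variable {n k d : ℕ} {Q : Matrix (Fin n) (Fin k) ℤ} {P : Matrix (Fin n) (Fin d) ℤ}
  {I : Finset (Fin n)} {m ζ : Fin n → ℝ}

theorem fockTrace_eq_sum {b : Fin n → ℝ} (hb : ∀ j, b j ≠ 0) (p : MvPolynomial (Fin n) ℂ) :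
    fockTrace ζ b p = ∑ u ∈ p.support, p.coeff u * hyperIntegrand ζ u b := by
  rw [fockTrace, ladderTrace_eq_sum (fun j => abs_sign_eq_one (hb j)) (fun _ => by simp) p
    fun j => sign_mul_pos (hb j)]
  simp only [← fockTrace_hMon ζ _ b hb]
  rfl

theorem higgsTrace_eq_sum (hm : ∀ i : I, coordZ P I m i ≠ 0) (p : MvPolynomial (Fin n) ℂ) :
    higgsTrace P I m ζ p = ∑ u ∈ p.support, p.coeff u * higgsTrace P I m ζ (hMon u) :=
  ladderTrace_eq_sum (abs_sgn hm) (fun _ => norm_neg_one_zpow _) p (sgn_mul_coordZ_pos hm)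

/-- The zero set is a proper affine subspace, which is a null set. -/
theorem ae_sum_mul_ne {k : ℕ} (r : Fin k → ℝ) (c : ℝ) (h : c ≠ 0 ∨ r ≠ 0) :
    ∀ᵐ t : Fin k → ℝ, c + ∑ a, r a * t a ≠ 0 := by
  by_cases hr : r = 0
  · refine Filter.Eventually.of_forall fun t => ?_
    simpa [hr] using h
  · set f : (Fin k → ℝ) →ₗ[ℝ] ℝ := Fintype.linearCombination ℝ r with hf
    have hfa : ∀ t, f t = ∑ a, r a * t a := fun t => by
      simp [hf, Fintype.linearCombination_apply, mul_comm]
    set A : AffineSubspace ℝ (Fin k → ℝ) := (affineSpan ℝ {-c}).comap f.toAffineMap with hA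
    have hmem : ∀ t, t ∈ A ↔ c + ∑ a, r a * t a = 0 := fun t => by
      rw [hA, AffineSubspace.mem_comap, AffineSubspace.mem_affineSpan_singleton, ← hfa]
      simp only [LinearMap.coe_toAffineMap]
      constructor <;> intro h <;> linarith
    have hA' : A ≠ ⊤ := by
      intro htop
      have h0 := (hmem 0).1 (htop ▸ AffineSubspace.mem_top _ _ _)
      refine hr (funext fun a => ?_)
      have h1 := (hmem (Pi.single a 1)).1 (htop ▸ AffineSubspace.mem_top _ _ _)
      simp [Pi.single_apply] at h0 h1
      simpa [h0] using h1
    have h1 := Measure.addHaar_affineSubspace volume A hA'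
    rw [ae_iff]
    refine (congrArg _ ?_).trans h1
    ext t
    simp [← hmem]

/-- The delicate case is `Q j = 0`, where `b_j = m_j` is constant. Such a `j` cannot belong to the
complementary basis, so `j ∈ I`, and then `m_j = z_j ≠ 0`. -/
theorem ae_contourPoint_ne_zero (h : IsExactSequence Q P) (hI : IsLatticeBasis P I)
    (hm : ∀ i : I, coordZ P I m i ≠ 0) :
    ∀ᵐ t : Fin k → ℝ, ∀ j, contourPoint Q m t j ≠ 0 := by
  refine ae_all_iff.2 fun j => ae_sum_mul_ne (fun a => (Q j a : ℝ)) (m j) ?_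
  by_contra! hcon
  have hQ : Q j = 0 := funext fun a => by
    have := congrFun hcon.2 a
    simpa using this
  have hJ := hI.compl h
  have hexp : ∀ i, expansion Q Iᶜ j i = 0 :=
    expansion_unique hJ (c := 0) (by simp [hQ])
  have hj : j ∈ I := by
    by_contra hj
    have h1 := expansion_self hJ ⟨j, Finset.mem_compl.2 hj⟩ ⟨j, Finset.mem_compl.2 hj⟩
    rw [if_pos rfl, hexp] at h1
    exact zero_ne_one h1
  refine hm ⟨j, hj⟩ ?_
  rw [← offset_compl h hI, offset]
  simp [hexp, hcon.1]

theorem integrable_weylTrace (h : IsExactSequence Q P) (hI : IsLatticeBasis P I)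
    (hm : ∀ i : I, coordZ P I m i ≠ 0) (ζ : Fin n → ℝ) {w : invariants Q}
    {p : MvPolynomial (Fin n) ℂ} (hp : IsSymbol Q w p) :
    Integrable (fun t : Fin k → ℝ => weylTrace ζ (contourPoint Q m t) w) ∧
      sphereTrace Q m ζ w = ∑ u ∈ p.support,
        p.coeff u * ∫ t : Fin k → ℝ, hyperIntegrand ζ u (contourPoint Q m t) := by
  have hae : (fun t : Fin k → ℝ => weylTrace ζ (contourPoint Q m t) w) =ᵐ[volume]
      fun t => ∑ u ∈ p.support, p.coeff u * hyperIntegrand ζ u (contourPoint Q m t) := by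
    filter_upwards [ae_contourPoint_ne_zero h hI hm] with t ht
    rw [weylTrace_eq ht ζ hp, fockTrace_eq_sum ht]
  have hint : ∀ u ∈ p.support, Integrable fun t : Fin k → ℝ =>
      p.coeff u * hyperIntegrand ζ u (contourPoint Q m t) := fun u _ =>
    (integrable_hyperIntegrand ζ (hI.compl h) m u).const_mul _
  refine ⟨(integrable_finsetSum _ hint).congr hae.symm, ?_⟩
  rw [sphereTrace, integral_congr_ae hae, integral_finsetSum _ hint]
  simp only [integral_const_mul]

theorem sphereTrace_eq_sum (h : IsExactSequence Q P) (hu : IsUnimodular P)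
    (hm : ∀ (I : Bases P) (i : I.1), coordZ P I.1 m i ≠ 0)
    (hζ : ∀ (I : Bases P) (j : (I.1ᶜ : Finset (Fin n))), coordZ Q I.1ᶜ ζ j ≠ 0)
    {w : invariants Q} {p : MvPolynomial (Fin n) ℂ} (hp : IsSymbol Q w p) :
    sphereTrace Q m ζ w = ∑ I : Bases P, vermaCoeff Q P m ζ I.1 * higgsTrace P I.1 m ζ p := by
  obtain ⟨I, hI⟩ := exists_isLatticeBasis h hu
  rw [(integrable_weylTrace h hI (hm ⟨I, hI⟩) ζ hp).2]
  simp only [integral_hyperIntegrand h hu hζ _ m hm, higgsTrace_eq_sum (hm _) p, Finset.mul_sum]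
  rw [Finset.sum_comm]
  refine Finset.sum_congr rfl fun I _ => Finset.sum_congr rfl fun u _ => ?_
  ring

/-! ## The coefficients as traces on the dual modules -/

theorem sgn_zpow_pow_four {i : I} (hm : coordZ P I m i ≠ 0) (r : ℤ) :
    ((sgn P I m i : ℂ) ^ r) ^ 4 = 1 := by
  rw [← zpow_natCast, ← zpow_mul, mul_comm, zpow_mul]
  rcases sgn_eq_or hm with h | h <;> rw [h] <;> norm_num

theorem sechPhase_pow_four (r : ℤ) : sechPhase r ^ 4 = 1 := by
  rw [sechPhase_eq, ← zpow_natCast, ← zpow_mul, mul_comm, zpow_mul]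
  have : Complex.I ^ ((4 : ℕ) : ℤ) = 1 := by rw [zpow_natCast, Complex.I_pow_four]
  rw [this, one_zpow]

/-- Both sides carry the same factors `CS(πz^!_j) / 2` and the same exponentials, hence differ only
by phases. The dual signs occur twice in `u`: once from `C_I` and once from the evaluation of the
dual trace. -/
theorem vermaCoeff_eq (hm : ∀ i : I, coordZ P I m i ≠ 0)
    (hζ : ∀ j : (Iᶜ : Finset (Fin n)), coordZ Q Iᶜ ζ j ≠ 0) :
    ∃ u : ℂ, u ^ 4 = 1 ∧ vermaCoeff Q P m ζ I * Complex.exp (2 * Real.pi * Complex.I *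
      ∑ j : (Iᶜ : Finset (Fin n)), (coordZ Q Iᶜ ζ j : ℂ) * (m j : ℂ)) =
        u * higgsTrace Q Iᶜ ζ m 1 := by
  refine ⟨(∏ i : I, sechPhase (rTilde Q ζ Iᶜ i) * (sgn P I m i : ℂ) ^ (rSum P I m i + 1)) *
    ((∏ j : (Iᶜ : Finset (Fin n)), (sgn Q Iᶜ ζ j : ℂ) ^ (rSum Q Iᶜ ζ j + 1)) *
      ∏ j : (Iᶜ : Finset (Fin n)), (sgn Q Iᶜ ζ j : ℂ) ^ (rSum Q Iᶜ ζ j + 1)), ?_, ?_⟩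
  · simp only [mul_pow, ← Finset.prod_pow, sgn_zpow_pow_four (hm _), sgn_zpow_pow_four (hζ _),
      sechPhase_pow_four, one_mul, Finset.prod_const_one]
  · have h1 := prod_sgn_mul_higgsTrace_one m hζ
    have h2 : Complex.exp (2 * Real.pi * Complex.I *
        ∑ j : (Iᶜ : Finset (Fin n)), (coordZ Q Iᶜ ζ j : ℂ) * (m j : ℂ)) =
        ∏ j : (Iᶜ : Finset (Fin n)), Complex.exp (2 * Real.pi *
          (coordZ Q Iᶜ ζ j * (Complex.I * m j))) := by
      rw [← Complex.exp_sum, Finset.mul_sum]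
      congr 1
      exact Finset.sum_congr rfl fun j _ => by ring
    rw [Finset.prod_mul_distrib, ← h2] at h1
    rw [vermaCoeff, Finset.prod_mul_distrib (s := (Finset.univ : Finset (Iᶜ : Finset (Fin n))))]
    linear_combination (-(∏ i : I, sechPhase (rTilde Q ζ Iᶜ i) *
      (sgn P I m i : ℂ) ^ (rSum P I m i + 1)) * ∏ j : (Iᶜ : Finset (Fin n)),
        (sgn Q Iᶜ ζ j : ℂ) ^ (rSum Q Iᶜ ζ j + 1)) * h1

end SphereTrace

end

/-! ### The expansion theorem -/

theorem mainTheorem4 {n k d : ℕ}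
    (Q : Matrix (Fin n) (Fin k) ℤ) (P : Matrix (Fin n) (Fin d) ℤ)
    (hexact : SphereTrace.IsExactSequence Q P) (hunimodular : SphereTrace.IsUnimodular P)
    (m ζ : Fin n → ℝ)
    (hm : ∀ (I : SphereTrace.Bases P) (i : I.1), SphereTrace.coordZ P I.1 m i ≠ 0)
    (hζ : ∀ (I : SphereTrace.Bases P) (j : (I.1ᶜ : Finset (Fin n))),
      SphereTrace.coordZ Q I.1ᶜ ζ j ≠ 0) :
    -- the Verma modules of the theory and of its dual exist
    (∀ I : SphereTrace.Bases P,
      SphereTrace.IsLatticeBasis Q I.1ᶜ ∧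
      Nonempty (SphereTrace.VermaModule Q P m ζ I.1) ∧
      Nonempty (SphereTrace.VermaModule P Q ζ m I.1ᶜ)) ∧
    -- the sphere trace is well defined
    (∀ w : SphereTrace.invariants Q,
      (∀ᵐ t : Fin k → ℝ, Summable
        (SphereTrace.weylTraceTerm ζ (SphereTrace.contourPoint Q m t) (w : SphereTrace.Weyl n))) ∧
      MeasureTheory.Integrable (fun t : Fin k → ℝ =>
        SphereTrace.weylTrace ζ (SphereTrace.contourPoint Q m t) (w : SphereTrace.Weyl n))) ∧
    -- the traces of the Verma modules converge
    (∀ (I : SphereTrace.Bases P) (Δ : SphereTrace.VermaModule Q P m ζ I.1)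
      (a : SphereTrace.AHiggs Q ζ), Summable (Δ.traceTerm a)) ∧
    -- the expansion of the sphere trace
    (∀ (Δ : (I : SphereTrace.Bases P) → SphereTrace.VermaModule Q P m ζ I.1)
      (w : SphereTrace.invariants Q),
      SphereTrace.sphereTrace Q m ζ (w : SphereTrace.Weyl n) =
        ∑ I : SphereTrace.Bases P, SphereTrace.vermaCoeff Q P m ζ I.1 *
          (Δ I).trace (SphereTrace.toHiggs Q ζ w)) ∧
    -- the coefficients are traces of `1` on the dual Verma modules up to a fourth root of unity
    (∀ (I : SphereTrace.Bases P) (Δ' : SphereTrace.VermaModule P Q ζ m I.1ᶜ),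
      Summable (Δ'.traceTerm 1) ∧
      ∃ u : ℂ, u ^ 4 = 1 ∧
        SphereTrace.vermaCoeff Q P m ζ I.1 *
          Complex.exp (2 * Real.pi * Complex.I *
            ∑ j : (I.1ᶜ : Finset (Fin n)), (SphereTrace.coordZ Q I.1ᶜ ζ j : ℂ) * (m j : ℂ)) =
          u * Δ'.trace 1) := by
  have hbasis := SphereTrace.exists_isLatticeBasis hexact hunimodular
  refine ⟨fun I => ⟨I.2.compl hexact, ?_, ?_⟩, fun w => ?_, fun I Δ a => ?_, fun Δ w => ?_,
    fun I Δ' => ?_⟩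
  · exact SphereTrace.exists_vermaModule hexact I.2 (hm I) (hζ I)
  · refine SphereTrace.exists_vermaModule hexact.symm (I.2.compl hexact) (hζ I) ?_
    -- The dual of the dual is the original theory, so the second genericity condition of the dual
    -- is the one on `m`.
    rw [compl_compl]
    exact hm I
  · obtain ⟨I, hI⟩ := hbasis
    obtain ⟨p, hp⟩ := SphereTrace.exists_eval_diag Q w
    refine ⟨?_, (SphereTrace.integrable_weylTrace hexact hI (hm ⟨I, hI⟩) ζ hp).1⟩
    filter_upwards [SphereTrace.ae_contourPoint_ne_zero hexact hI (hm ⟨I, hI⟩)] with t ht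
    exact SphereTrace.summable_weylTraceTerm ht ζ hp
  · exact SphereTrace.summable_traceTerm hexact I.2 (hm I) Δ a
  · obtain ⟨p, hp⟩ := SphereTrace.exists_eval_diag Q w
    rw [SphereTrace.sphereTrace_eq_sum hexact hunimodular hm hζ hp]
    exact Finset.sum_congr rfl fun I _ => by rw [SphereTrace.trace_eq hexact I.2 (Δ I) hp]
  · refine ⟨SphereTrace.summable_traceTerm hexact.symm (I.2.compl hexact) (hζ I) Δ' 1, ?_⟩
    obtain ⟨u, hu, h⟩ := SphereTrace.vermaCoeff_eq (hm I) (hζ I)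
    refine ⟨u, hu, ?_⟩
    have h1 := SphereTrace.trace_eq hexact.symm (I.2.compl hexact) Δ' SphereTrace.isSymbol_one
    rw [map_one] at h1
    rw [h, h1]
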